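/- All vector spaces are over $\mathbb C$; superspaces are $\mathbb Z/2\mathbb Z$-graded and $p(a,b)=(-1)^{p(a)p(b)}$. In a vertex algebra with vacuum $|0\rangle$ and $Y(a,z)=\sum_{n\in\mathbb Z}a_{(n)}z^{-n-1}$ put $Ta=a_{(-2)}|0\rangle$, $:\!ab\!:\,=a_{(-1)}b$ and $[a_\lambda b]=\sum_{n\ge0}\frac{\lambda^n}{n!}a_{(n)}b$. For a Lie conformal superalgebra $R$ let $V(R)$ be its universal enveloping vertex algebra: it is generated by the fields $Y(a,z)$, $a\in R$, and is the module induced from the trivial one-dimensional module of the modes $a_{(n)}$, $n\ge 0$, over the associative algebra generated by the modes $a_{(n)}$ ($a\in R$, $n\in\mathbb Z$), linear in $a$, with relations $(Ta)_{(n)}=-n\,a_{(n-1)}$ and $a_{(m)}b_{(n)}-p(a,b)\,b_{(n)}a_{(m)}=\sum_{j\ge0}\binom mj(a_{(j)}b)_{(m+n-j)}$; the canonical map $R\to V(R)$ is $a\mapsto a_{(-1)}|0\rangle$. Let $\mathfrak g$ be a finite-dimensional complex Lie algebra, semisimple or abelian, with a nondegenerate symmetric invariant bilinear form $(\cdot,\cdot)$,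 and let $\{x_i\}$ be an orthonormal basis of $\mathfrak g$. Assume that the Casimir operator $\sum_i(\mathrm{ad}\,x_i)^2$ equals $2g\,I_{\mathfrak g}$, with $g\in\mathbb C$. Let $\bar{\mathfrak g}=\{\bar a: a\in\mathfrak g\}$ be $\mathfrak g$ viewed as an odd superspace. Consider the Lie conformal superalgebras * $Cur(\mathfrak g)=(\mathbb C[T]\otimes\mathfrak g)\oplus\mathbb CK$, with $[a_\lambda b]=[a,b]+\lambda(a,b)K$; * $R^{Cl}(\bar{\mathfrak g})=(\mathbb C[T]\otimes\bar{\mathfrak g})\oplus\mathbb CK'$, with $[\bar a_\lambda\bar b]=(a,b)K'$; * $R^{super}=(\mathbb C[T]\otimes\mathfrak g)\oplus(\mathbb C[T]\otimes\bar{\mathfrak g})\oplus\mathbb C\mathcal K\oplus\mathbb C\overline{\mathcal K}$, with $[a_\lambda b]=[a,b]+\lambda(a,b)\mathcal K$, $[a_\lambda\bar b]=[\bar a_\lambda b]=\overline{[a,b]}$, $[\bar a_\lambda\bar b]=(a,b)\overline{\mathcal K}$, for $a,b\in\mathfrak g$, where $K,K',\mathcal K,\overline{\mathcal K}$ are even,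 central and annihilated by $T$. For $k\in\mathbb C$ let $V^k(\mathfrak g)$, $F(\bar{\mathfrak g})$, $V^1(R^{super})$, $V^{k,1}(R^{super})$ be the quotients of $V(Cur(\mathfrak g))$, $V(R^{Cl}(\bar{\mathfrak g}))$, $V(R^{super})$, $V(R^{super})$ by the ideals generated respectively by $K-k|0\rangle$; by $K'-|0\rangle$; by $\overline{\mathcal K}-|0\rangle$; by $\mathcal K-k|0\rangle$ and $\overline{\mathcal K}-|0\rangle$. The tensor product of two vertex algebras has vacuum $|0\rangle\otimes|0\rangle$ and $Y(a\otimes b,z)=Y(a,z)\otimes Y(b,z)$. For $x\in\mathfrak g$ put, in $V^1(R^{super})$, $$\tilde x=x-\tfrac12\sum_i:\overline{[x,x_i]}\,\bar x_i:.$$ **Proposition.** There is exactly one homomorphism of Lie conformal superalgebras $$\varphi: Cur(\mathfrak g)\oplus R^{Cl}(\bar{\mathfrak g})\to V^1(R^{super})$$ such that $\varphi(x)=\tilde x$ and $\varphi(\bar x)=\bar x$ for all $x\in\mathfrak g$, $\varphi(K)=\mathcal K-g|0\rangle$ and $\varphi(K')=|0\rangle$. For every $k\in\mathbb C$ it induces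 an isomorphism of vertex algebras $$\Phi:V^k(\mathfrak g)\otimes F(\bar{\mathfrak g})\to V^{k+g,1}(R^{super}),$$ that is, there is an isomorphism $\Phi$ of vertex algebras such that $\Phi(r\otimes|0\rangle)$ and $\Phi(|0\rangle\otimes s)$ are the images of $\varphi(r)$ and $\varphi(s)$ in $V^{k+g,1}(R^{super})$, for all $r\in Cur(\mathfrak g)$ and $s\in R^{Cl}(\bar{\mathfrak g})$. -/

import Mathlib

open scoped TensorProduct

namespace SuperAffine

/-! ### Vector superspaces -/

/-- The sign `(-1)^i` for `i ∈ ℤ/2ℤ`. -/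
def sgn (i : ZMod 2) : ℂ := if i = 1 then -1 else 1

/-- The sign `p(a,b) = (-1)^{p(a)p(b)}` for elements of parities `i`, `j`. -/
def koszul (i j : ZMod 2) : ℂ := sgn (i * j)

theorem sgn_add (i j : ZMod 2) : sgn (i + j) = sgn i * sgn j := by
  have h : ∀ i : ZMod 2, i = 0 ∨ i = 1 := by decide
  have h2 : (1 : ZMod 2) + 1 = 0 := rfl
  rcases h i with rfl | rfl <;> rcases h j with rfl | rfl <;> simp [sgn, h2]

theorem koszul_comm (i j : ZMod 2) : koszul i j = koszul j i := by
  simp [koszul, mul_comm]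

theorem sgn_mul_self (i : ZMod 2) : sgn i * sgn i = 1 := by
  unfold sgn; split_ifs <;> norm_num

theorem koszul_mul_self (i j : ZMod 2) : koszul i j * koszul i j = 1 := sgn_mul_self _

theorem koszul_add_left (i j k : ZMod 2) : koszul (i + j) k = koszul i k * koszul j k := by
  simp [koszul, add_mul, sgn_add]

theorem koszul_add_right (i j k : ZMod 2) : koszul k (i + j) = koszul k i * koszul k j := by
  simp [koszul, mul_add, sgn_add]

/-- A `ℤ/2ℤ`-grading `V = V₀ ⊕ V₁` of a complex vector space, encoded by its parity involution,
the linear map equal to `(-1)^i` on `V_i`; see `SuperSpace.part` and `SuperSpace.isCompl_part`. -/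
structure SuperSpace (V : Type*) [AddCommGroup V] [Module ℂ V] where
  par : V →ₗ[ℂ] V
  par_par : ∀ v, par (par v) = v

section SuperSpace

variable {V : Type*} [AddCommGroup V] [Module ℂ V]

/-- The homogeneous component `V_i`. -/
def SuperSpace.part (S : SuperSpace V) (i : ZMod 2) : Submodule ℂ V where
  carrier := {v | S.par v = sgn i • v}
  add_mem' {a b} ha hb := by
    simp only [Set.mem_ofPred_eq] at *; rw [map_add, ha, hb, smul_add]
  zero_mem' := by simp
  smul_mem' c a ha := by
    simp only [Set.mem_ofPred_eq] at *; rw [map_smul, ha, smul_comm]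

theorem SuperSpace.mem_part {S : SuperSpace V} {i : ZMod 2} {v : V} :
    v ∈ S.part i ↔ S.par v = sgn i • v := Iff.rfl

/-- The projection of `V` onto `V_i`. -/
noncomputable def SuperSpace.proj (S : SuperSpace V) (i : ZMod 2) : V →ₗ[ℂ] V :=
  (1 / 2 : ℂ) • (LinearMap.id + sgn i • S.par)

theorem SuperSpace.proj_mem (S : SuperSpace V) (i : ZMod 2) (v : V) : S.proj i v ∈ S.part i := by
  rw [SuperSpace.mem_part]
  simp only [SuperSpace.proj, LinearMap.smul_apply, LinearMap.add_apply, LinearMap.id_apply,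
    map_smul, map_add, S.par_par]
  rw [smul_comm (sgn i), smul_add (sgn i), smul_smul (sgn i) (sgn i), sgn_mul_self, one_smul,
    add_comm]

theorem SuperSpace.proj_add (S : SuperSpace V) (v : V) : S.proj 0 v + S.proj 1 v = v := by
  simp only [SuperSpace.proj, LinearMap.smul_apply, LinearMap.add_apply, LinearMap.id_apply, sgn]
  simp only [show (0 : ZMod 2) ≠ 1 by decide, if_false, if_true]
  module

theorem SuperSpace.proj_of_mem (S : SuperSpace V) {i : ZMod 2} {v : V} (h : v ∈ S.part i) :
    S.proj i v = v := by
  rw [SuperSpace.mem_part] at h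
  simp only [SuperSpace.proj, LinearMap.smul_apply, LinearMap.add_apply, LinearMap.id_apply, h,
    smul_smul, sgn_mul_self]
  module

theorem SuperSpace.isCompl_part (S : SuperSpace V) : IsCompl (S.part 0) (S.part 1) := by
  constructor
  · rw [Submodule.disjoint_def]
    intro v h0 h1
    have h0' := S.proj_of_mem h0
    have h1' := S.proj_of_mem h1
    have h := S.proj_add v
    rw [h0', h1'] at h
    simpa using h
  · rw [codisjoint_iff, eq_top_iff]
    intro v _
    rw [← S.proj_add v]
    exact Submodule.add_mem_sup (S.proj_mem 0 v) (S.proj_mem 1 v)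

/-- Induction over homogeneous elements. -/
theorem SuperSpace.hom_induction (S : SuperSpace V) {p : V → Prop}
    (h : ∀ i, ∀ v ∈ S.part i, p v) (hadd : ∀ v w, p v → p w → p (v + w)) (v : V) : p v := by
  rw [← S.proj_add v]
  exact hadd _ _ (h 0 _ (S.proj_mem 0 v)) (h 1 _ (S.proj_mem 1 v))

end SuperSpace

/-! ### Quantum fields -/

section Fields

variable {V : Type*} [AddCommGroup V] [Module ℂ V]

/-- Coefficientwise multiplication of `∑ c_{m,n} z^{-m-1} w^{-n-1}` by `z - w`. -/
def mulSub : Module.End ℂ (ℤ → ℤ → V) where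
  toFun c m n := c (m + 1) n - c m (n + 1)
  map_add' a b := by funext m n; simp only [Pi.add_apply]; abel
  map_smul' r a := by funext m n; simp only [Pi.smul_apply, RingHom.id_apply, smul_sub]

theorem mulSub_apply (c : ℤ → ℤ → V) (m n : ℤ) :
    mulSub c m n = c (m + 1) n - c m (n + 1) := rfl

/-- An `End(V)`-valued formal distribution `∑ f_n z^{-n-1}` is a quantum field if `f_n v = 0`
for `n ≫ 0`, for every `v`. -/
def IsField (f : ℤ → V →ₗ[ℂ] V) : Prop := ∀ v, ∃ N : ℤ, ∀ n ≥ N, f n v = 0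

/-- Mutual locality: `(z - w)^N (f(z) g(w) - ε g(w) f(z)) = 0` for some `N`. -/
def IsLocal (ε : ℂ) (f g : ℤ → V →ₗ[ℂ] V) : Prop :=
  ∃ N : ℕ, ∀ v, (mulSub ^ N) (fun m n => f m (g n v) - ε • g n (f m v)) = 0

/-- Translation covariance: `[T, f(z)] = ∂_z f(z)`. -/
def IsCov (T : V →ₗ[ℂ] V) (f : ℤ → V →ₗ[ℂ] V) : Prop :=
  ∀ n v, T (f n v) - f n (T v) = -(n : ℂ) • f (n - 1) v

theorem mulSub_pow_mono {c : ℤ → ℤ → V} {N M : ℕ} (h : N ≤ M) (hc : (mulSub ^ N) c = 0) :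
    (mulSub ^ M) c = 0 := by
  obtain ⟨k, rfl⟩ := Nat.exists_eq_add_of_le h
  rw [add_comm, pow_add, Module.End.mul_apply, hc, map_zero]

theorem eq_zero_of_mulSub {c : ℤ → ℤ → V} (h : mulSub c = 0) {N : ℤ}
    (hN : ∀ n ≥ N, ∀ m, c m n = 0) : c = 0 := by
  have key : ∀ k : ℕ, ∀ m n, c m n = c (m - k) (n + k) := by
    intro k
    induction k with
    | zero => simp
    | succ k ih =>
      intro m n
      rw [ih m n]
      have := congrFun (congrFun h (m - k - 1)) (n + k)
      rw [mulSub_apply, Pi.zero_apply, Pi.zero_apply, sub_eq_zero] at this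
      push_cast
      rw [show m - (k + 1 : ℤ) = m - k - 1 by ring, show n + (k + 1 : ℤ) = n + k + 1 by ring,
        ← this]
      rw [show m - k - 1 + 1 = m - (k : ℤ) by ring]
  funext m n
  rw [key (N - n).toNat m n]
  exact hN _ (by omega) _

theorem eq_zero_of_mulSub_pow {N : ℕ} : ∀ {c : ℤ → ℤ → V}, (mulSub ^ N) c = 0 → ∀ {M : ℤ},
    (∀ n ≥ M, ∀ m, c m n = 0) → c = 0 := by
  induction N with
  | zero => intro c h _ _; simpa using h
  | succ k ih =>
    intro c h M hM
    rw [pow_succ, Module.End.mul_apply] at h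
    refine eq_zero_of_mulSub (ih h (M := M) ?_) hM
    intro n hn m
    rw [mulSub_apply, hM n hn, hM (n + 1) (by omega), sub_zero]

theorem IsLocal.symm {ε : ℂ} (hε : ε * ε = 1) {f g : ℤ → V →ₗ[ℂ] V} (h : IsLocal ε f g) :
    IsLocal ε g f := by
  obtain ⟨N, hN⟩ := h
  refine ⟨N, fun v => ?_⟩
  have swap : ∀ (k : ℕ) (c : ℤ → ℤ → V) (m n : ℤ),
      (mulSub ^ k) (fun m n => c n m) m n = (-1 : ℂ) ^ k • (mulSub ^ k) c n m := by
    intro k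
    induction k with
    | zero => intro c m n; simp
    | succ k ih =>
      intro c m n
      have h1 := ih c (m + 1) n
      have h2 := ih c m (n + 1)
      simp only [pow_succ' mulSub, Module.End.mul_apply, mulSub_apply] at h1 h2 ⊢
      rw [h1, h2, pow_succ]
      module
  funext m n
  have h1 : (fun m n => g m (f n v) - ε • f n (g m v)) =
      (-ε) • (fun m n => (fun a b => f a (g b v) - ε • g b (f a v)) n m) := by
    funext m n
    simp only [Pi.smul_apply, smul_sub, smul_smul, neg_mul, hε, neg_smul, one_smul]
    abel
  rw [h1, map_smul, Pi.smul_apply, Pi.smul_apply, swap, hN v]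
  simp

/-- The coefficients of `f(z) g(w)` times the expansion of `(z - w)⁻¹` in the region `|z| > |w|`. -/
noncomputable def half (f g : ℤ → V →ₗ[ℂ] V) (m n : ℤ) (v : V) : V :=
  ∑ᶠ j : ℕ, f (m - 1 - j) (g (n + j) v)

theorem half_eq_sum (f : ℤ → V →ₗ[ℂ] V) {g : ℤ → V →ₗ[ℂ] V} (m : ℤ) {n : ℤ} {v : V} {N : ℤ}
    (hN : ∀ k ≥ N, g k v = 0) {K : ℕ} (hK : N ≤ n + K) :
    half f g m n v = ∑ j ∈ Finset.range K, f (m - 1 - j) (g (n + j) v) := by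
  refine finsum_eq_sum_of_support_subset _ ?_
  intro j hj
  by_contra hj'
  refine hj ?_
  simp only [Finset.coe_range, Set.mem_Iio, not_lt] at hj'
  show f _ (g _ v) = 0
  rw [hN _ (by omega), map_zero]

theorem half_add (f : ℤ → V →ₗ[ℂ] V) {g : ℤ → V →ₗ[ℂ] V} (hg : IsField g) (m n : ℤ) (v w : V) :
    half f g m n (v + w) = half f g m n v + half f g m n w := by
  obtain ⟨N, hN⟩ := hg v
  obtain ⟨M, hM⟩ := hg w
  have h1 : ∀ k ≥ max N M, g k v = 0 := fun k hk => hN k (le_trans (le_max_left _ _) hk)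
  have h2 : ∀ k ≥ max N M, g k w = 0 := fun k hk => hM k (le_trans (le_max_right _ _) hk)
  have h3 : ∀ k ≥ max N M, g k (v + w) = 0 := fun k hk => by rw [map_add, h1 k hk, h2 k hk, add_zero]
  have hK : max N M ≤ n + ((max N M - n).toNat : ℤ) := by omega
  rw [half_eq_sum f m h1 hK, half_eq_sum f m h2 hK, half_eq_sum f m h3 hK,
    ← Finset.sum_add_distrib]
  simp

theorem half_smul (f : ℤ → V →ₗ[ℂ] V) {g : ℤ → V →ₗ[ℂ] V} (hg : IsField g) (m n : ℤ) (c : ℂ)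
    (v : V) : half f g m n (c • v) = c • half f g m n v := by
  obtain ⟨N, h1⟩ := hg v
  have h2 : ∀ k ≥ N, g k (c • v) = 0 := fun k hk => by rw [map_smul, h1 k hk, smul_zero]
  have hK : N ≤ n + ((N - n).toNat : ℤ) := by omega
  rw [half_eq_sum f m h1 hK, half_eq_sum f m h2 hK, Finset.smul_sum]
  simp

theorem half_rec (f : ℤ → V →ₗ[ℂ] V) {g : ℤ → V →ₗ[ℂ] V} (hg : IsField g) (m n : ℤ) (v : V) :
    half f g (m + 1) n v - half f g m (n + 1) v = f m (g n v) := by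
  obtain ⟨N, hN⟩ := hg v
  rw [half_eq_sum f (m + 1) hN (K := (N - n).toNat + 1) (by push_cast; omega),
    half_eq_sum f m hN (K := (N - n).toNat) (by omega), Finset.sum_range_succ']
  have : ∀ j : ℕ, f (m + 1 - 1 - ((j + 1 : ℕ) : ℤ)) (g (n + ((j + 1 : ℕ) : ℤ)) v) =
      f (m - 1 - j) (g (n + 1 + j) v) := by
    intro j
    push_cast
    rw [show m + 1 - 1 - (j + 1 : ℤ) = m - 1 - j by ring, show n + (j + 1 : ℤ) = n + 1 + j by ring]
  simp only [this]
  simp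

theorem half_vanish (f : ℤ → V →ₗ[ℂ] V) {g : ℤ → V →ₗ[ℂ] V} {v : V} {N : ℤ}
    (hN : ∀ k ≥ N, g k v = 0) (n : ℤ) (hn : N ≤ n) (m : ℤ) : half f g m n v = 0 := by
  rw [half_eq_sum f m hN (K := 0) (by simpa using hn)]
  simp

/-- The normally ordered product of two fields,
`:fg:_n = ∑_{j ≥ 0} (f_{-1-j} g_{n+j} + ε g_{n-1-j} f_j)`, that is
`f(z)^+ g(z) + ε g(z) f(z)^-`. -/
noncomputable def nop (ε : ℂ) (f g : ℤ → V →ₗ[ℂ] V) (hf : IsField f) (hg : IsField g) :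
    ℤ → V →ₗ[ℂ] V := fun n =>
  { toFun := fun v => half f g 0 n v + ε • half g f n 0 v
    map_add' := fun v w => by
      rw [half_add f hg, half_add g hf, smul_add]; abel
    map_smul' := fun c v => by
      rw [half_smul f hg, half_smul g hf, RingHom.id_apply, smul_add, smul_comm ε c] }

theorem nop_apply (ε : ℂ) (f g : ℤ → V →ₗ[ℂ] V) (hf : IsField f) (hg : IsField g) (n : ℤ) (v : V) :
    nop ε f g hf hg n v = half f g 0 n v + ε • half g f n 0 v := rfl

theorem IsField.nop {ε : ℂ} {f g : ℤ → V →ₗ[ℂ] V} (hf : IsField f) (hg : IsField g) :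
    IsField (nop ε f g hf hg) := by
  intro v
  obtain ⟨N, hN⟩ := hg v
  obtain ⟨M, hM⟩ := hf v
  choose B hB using fun j : ℕ => hg (f j v)
  set K := M.toNat with hK
  refine ⟨max N (∑ j ∈ Finset.range K, (|B j| + 1 + j)), fun n hn => ?_⟩
  rw [nop_apply, half_vanish f hN n (le_trans (le_max_left _ _) hn),
    half_eq_sum g n hM (K := K) (by omega), Finset.sum_eq_zero, smul_zero, add_zero]
  intro j hj
  have h1 : |B j| + 1 + j ≤ ∑ j ∈ Finset.range K, (|B j| + 1 + (j : ℤ)) :=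
    Finset.single_le_sum (f := fun j : ℕ => |B j| + 1 + (j : ℤ)) (fun i _ => by positivity) hj
  have h2 := le_trans (le_max_right _ _) hn
  have h3 := le_abs_self (B j)
  rw [zero_add]
  exact hB j _ (by linarith)

theorem half_cov {T : V →ₗ[ℂ] V} {f g : ℤ → V →ₗ[ℂ] V} (hg : IsField g)
    (hTf : IsCov T f) (hTg : IsCov T g) (m n : ℤ) (v : V) :
    T (half f g m n v) - half f g m n (T v) =
      -(m : ℂ) • half f g (m - 1) n v + -(n : ℂ) • half f g m (n - 1) v := by
  set X : ℤ → ℤ → V := fun m n => T (half f g m n v) - half f g m n (T v) +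
    ((m : ℂ) • half f g (m - 1) n v + (n : ℂ) • half f g m (n - 1) v) with hX
  obtain ⟨N, hN⟩ := hg v
  obtain ⟨M, hM⟩ := hg (T v)
  have h0 : X = 0 := by
    refine eq_zero_of_mulSub ?_ (N := max N M + 1) ?_
    · funext m n
      rw [mulSub_apply]
      simp only [hX, Pi.zero_apply]
      have r1 := half_rec f hg m n v
      have r2 := half_rec f hg m n (T v)
      have r3 := half_rec f hg (m - 1) n v
      have r4 := half_rec f hg m (n - 1) v
      have c1 := hTf m (g n v)
      have c2 := congrArg (f m) (hTg n v)
      rw [sub_add_cancel] at r3 r4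
      rw [map_sub, map_smul, ← r4] at c2
      rw [← r3] at c1
      rw [← r1, map_sub] at c1
      rw [← r2] at c2
      rw [show m + 1 - 1 = m by ring, show n + 1 - 1 = n by ring]
      push_cast
      linear_combination (norm := module) c1 + c2
    · intro n hn m
      simp only [hX]
      rw [half_vanish f hN n (by omega), half_vanish f hM n (by omega),
        half_vanish f hN n (by omega), half_vanish f hN (n - 1) (by omega)]
      simp
  have := congrFun (congrFun h0 m) n
  simp only [hX, Pi.zero_apply] at this
  linear_combination (norm := module) this

theorem IsCov.nop {T : V →ₗ[ℂ] V} {ε : ℂ} {f g : ℤ → V →ₗ[ℂ] V} (hf : IsField f) (hg : IsField g)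
    (hTf : IsCov T f) (hTg : IsCov T g) : IsCov T (nop ε f g hf hg) := by
  intro n v
  have h1 := half_cov hg hTf hTg 0 n v
  have h2 := half_cov hf hTg hTf n 0 v
  rw [nop_apply, nop_apply, nop_apply, map_add, map_smul]
  simp only [Int.cast_zero, neg_zero, zero_smul, zero_add, add_zero] at h1 h2
  linear_combination (norm := module) h1 + ε • h2

theorem nop_vac {ε : ℂ} {f g : ℤ → V →ₗ[ℂ] V} (hf : IsField f) (hg : IsField g) {o : V}
    (hfo : ∀ n ≥ 0, f n o = 0) (hgo : ∀ n ≥ 0, g n o = 0) :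
    (∀ n ≥ 0, nop ε f g hf hg n o = 0) ∧ nop ε f g hf hg (-1) o = f (-1) (g (-1) o) := by
  constructor
  · intro n hn
    rw [nop_apply, half_vanish f hgo n hn, half_vanish g hfo 0 le_rfl]
    simp
  · rw [nop_apply, half_vanish g hfo 0 le_rfl, half_eq_sum f 0 hgo (K := 1) (by norm_num)]
    simp

end Fields

section Dong

variable {V : Type*} [AddCommGroup V] [Module ℂ V]

/-- Multiplication of three-variable distributions by `z - w`, where the variables are
`z, w, u`. -/
def mul12 : Module.End ℂ (ℤ → ℤ → ℤ → V) where
  toFun c m n l := c (m + 1) n l - c m (n + 1) l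
  map_add' a b := by funext m n l; simp only [Pi.add_apply]; abel
  map_smul' r a := by funext m n l; simp only [Pi.smul_apply, RingHom.id_apply, smul_sub]

/-- Multiplication by `z - u`. -/
def mul13 : Module.End ℂ (ℤ → ℤ → ℤ → V) where
  toFun c m n l := c (m + 1) n l - c m n (l + 1)
  map_add' a b := by funext m n l; simp only [Pi.add_apply]; abel
  map_smul' r a := by funext m n l; simp only [Pi.smul_apply, RingHom.id_apply, smul_sub]

/-- Multiplication by `w - u`. -/
def mul23 : Module.End ℂ (ℤ → ℤ → ℤ → V) where
  toFun c m n l := c m (n + 1) l - c m n (l + 1)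
  map_add' a b := by funext m n l; simp only [Pi.add_apply]; abel
  map_smul' r a := by funext m n l; simp only [Pi.smul_apply, RingHom.id_apply, smul_sub]

theorem commute_12_13 : Commute (mul12 (V := V)) mul13 := by
  ext c m n l
  simp only [Module.End.mul_apply, mul12, mul13, LinearMap.coe_mk, AddHom.coe_mk]; abel

theorem commute_12_23 : Commute (mul12 (V := V)) mul23 := by
  ext c m n l
  simp only [Module.End.mul_apply, mul12, mul23, LinearMap.coe_mk, AddHom.coe_mk]; abel

theorem commute_13_23 : Commute (mul13 (V := V)) mul23 := by
  ext c m n l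
  simp only [Module.End.mul_apply, mul13, mul23, LinearMap.coe_mk, AddHom.coe_mk]; abel

theorem mul23_eq : (mul23 (V := V)) = mul13 + (-1 : ℂ) • mul12 := by
  ext c m n l
  simp only [LinearMap.add_apply, LinearMap.smul_apply, mul12, mul13, mul23, LinearMap.coe_mk,
    AddHom.coe_mk, Pi.add_apply, Pi.smul_apply]
  module

theorem mul12_pow (N : ℕ) : ∀ (c : ℤ → ℤ → ℤ → V) (m n l : ℤ),
    (mul12 ^ N) c m n l = (mulSub ^ N) (fun m n => c m n l) m n := by
  induction N with
  | zero => intro c m n l; rfl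
  | succ k ih =>
    intro c m n l
    rw [pow_succ, pow_succ, Module.End.mul_apply, Module.End.mul_apply, ih]; rfl

theorem mul13_pow (N : ℕ) : ∀ (c : ℤ → ℤ → ℤ → V) (m n l : ℤ),
    (mul13 ^ N) c m n l = (mulSub ^ N) (fun m l => c m n l) m l := by
  induction N with
  | zero => intro c m n l; rfl
  | succ k ih =>
    intro c m n l
    rw [pow_succ, pow_succ, Module.End.mul_apply, Module.End.mul_apply, ih]; rfl

theorem mul23_pow (N : ℕ) : ∀ (c : ℤ → ℤ → ℤ → V) (m n l : ℤ),
    (mul23 ^ N) c m n l = (mulSub ^ N) (fun n l => c m n l) n l := by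
  induction N with
  | zero => intro c m n l; rfl
  | succ k ih =>
    intro c m n l
    rw [pow_succ, pow_succ, Module.End.mul_apply, Module.End.mul_apply, ih]; rfl

theorem add_pow_kill {W : Type*} [AddCommGroup W] [Module ℂ W] {x y : Module.End ℂ W}
    (hxy : Commute x y) : ∀ (k p q : ℕ), p + q ≤ k + 1 → ∀ v : W, (x ^ p) v = 0 → (y ^ q) v = 0 →
      ((x + y) ^ k) v = 0 := by
  have comm : ∀ {x y : Module.End ℂ W}, Commute x y → ∀ (q : ℕ) (v : W), (y ^ q) v = 0 →
      (y ^ q) (x v) = 0 := by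
    intro x y h q v hv
    have := congrArg (fun f => f v) (h.pow_right q).eq
    simp only [Module.End.mul_apply] at this
    rw [← this, hv, map_zero]
  intro k
  induction k with
  | zero =>
    intro p q h v hp hq
    rcases Nat.eq_zero_or_pos p with rfl | h1
    · simpa using hp
    · obtain rfl : q = 0 := by omega
      simpa using hq
  | succ k ih =>
    intro p q h v hp hq
    rcases Nat.eq_zero_or_pos p with rfl | h1
    · have : v = 0 := by simpa using hp
      rw [this, map_zero]
    rcases Nat.eq_zero_or_pos q with rfl | h2
    · have : v = 0 := by simpa using hq
      rw [this, map_zero]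
    obtain ⟨p, rfl⟩ := Nat.exists_eq_add_of_le' h1
    obtain ⟨q, rfl⟩ := Nat.exists_eq_add_of_le' h2
    rw [pow_succ, Module.End.mul_apply, LinearMap.add_apply, map_add]
    rw [ih p (q + 1) (by omega) (x v), ih (p + 1) q (by omega) (y v), add_zero]
    · exact comm hxy.symm _ _ hp
    · rw [pow_succ, Module.End.mul_apply] at hq; exact hq
    · rw [pow_succ, Module.End.mul_apply] at hp; exact hp
    · exact comm hxy _ _ hq

theorem mulSub_pow_comp (φ : V →ₗ[ℂ] V) (k : ℕ) : ∀ (c : ℤ → ℤ → V),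
    (mulSub ^ k) (fun n l => φ (c n l)) = fun n l => φ ((mulSub ^ k) c n l) := by
  induction k with
  | zero => intro c; rfl
  | succ k ih =>
    intro c
    rw [pow_succ, Module.End.mul_apply, Module.End.mul_apply, ← ih]
    congr 1
    funext n l
    simp only [mulSub_apply, map_sub]

theorem commute_apply {W : Type*} [AddCommGroup W] [Module ℂ W] {x y : Module.End ℂ W}
    (h : Commute x y) (v : W) : x (y v) = y (x v) :=
  congrArg (fun f => f v) h.eq

/-- Vanishing in the second variable, uniformly in the first one. -/
def Van2 (c : ℤ → ℤ → ℤ → V) : Prop := ∀ l, ∃ N : ℤ, ∀ n ≥ N, ∀ m, c m n l = 0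

/-- Vanishing in the first variable, uniformly in the second one. -/
def Van1 (c : ℤ → ℤ → ℤ → V) : Prop := ∀ l, ∃ N : ℤ, ∀ m ≥ N, ∀ n, c m n l = 0

theorem Van2.mul13 {c : ℤ → ℤ → ℤ → V} (h : Van2 c) : Van2 (mul13 c) := by
  intro l
  obtain ⟨N, hN⟩ := h l
  obtain ⟨M, hM⟩ := h (l + 1)
  refine ⟨max N M, fun n hn m => ?_⟩
  show c _ _ _ - c _ _ _ = 0
  rw [hN n (by omega), hM n (by omega), sub_zero]

theorem Van2.mul23 {c : ℤ → ℤ → ℤ → V} (h : Van2 c) : Van2 (mul23 c) := by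
  intro l
  obtain ⟨N, hN⟩ := h l
  obtain ⟨M, hM⟩ := h (l + 1)
  refine ⟨max N M, fun n hn m => ?_⟩
  show c _ _ _ - c _ _ _ = 0
  rw [hN _ (by omega), hM n (by omega), sub_zero]

theorem Van1.mul13 {c : ℤ → ℤ → ℤ → V} (h : Van1 c) : Van1 (mul13 c) := by
  intro l
  obtain ⟨N, hN⟩ := h l
  obtain ⟨M, hM⟩ := h (l + 1)
  refine ⟨max N M, fun m hm n => ?_⟩
  show c _ _ _ - c _ _ _ = 0
  rw [hN _ (by omega), hM m (by omega), sub_zero]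

theorem Van1.mul23 {c : ℤ → ℤ → ℤ → V} (h : Van1 c) : Van1 (mul23 c) := by
  intro l
  obtain ⟨N, hN⟩ := h l
  obtain ⟨M, hM⟩ := h (l + 1)
  refine ⟨max N M, fun m hm n => ?_⟩
  show c _ _ _ - c _ _ _ = 0
  rw [hN _ (by omega), hM m (by omega), sub_zero]

theorem pow_induct {W : Type*} [AddCommGroup W] [Module ℂ W] {x : Module.End ℂ W} {P : W → Prop}
    (h : ∀ v, P v → P (x v)) (N : ℕ) : ∀ v, P v → P ((x ^ N) v) := by
  induction N with
  | zero => intro v hv; simpa using hv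
  | succ k ih => intro v hv; rw [pow_succ, Module.End.mul_apply]; exact ih _ (h _ hv)

theorem eq_zero_of_mul12_van2 {c : ℤ → ℤ → ℤ → V} (h : mul12 c = 0) (hc : Van2 c) : c = 0 := by
  funext m n l
  obtain ⟨N, hN⟩ := hc l
  have : (fun m n => c m n l) = 0 := by
    refine eq_zero_of_mulSub (N := N) ?_ hN
    funext m n
    exact congrFun (congrFun (congrFun h m) n) l
  exact congrFun (congrFun this m) n

theorem eq_zero_of_mul12_van1 {c : ℤ → ℤ → ℤ → V} (h : mul12 c = 0) (hc : Van1 c) : c = 0 := by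
  funext m n l
  obtain ⟨N, hN⟩ := hc l
  have : (fun n m => c m n l) = 0 := by
    refine eq_zero_of_mulSub (N := N) ?_ hN
    funext n m
    have := congrFun (congrFun (congrFun h m) n) l
    change c (m + 1) n l - c m (n + 1) l = 0 at this
    rw [mulSub_apply, sub_eq_zero.mp this, sub_self]; rfl
  exact congrFun (congrFun this n) m

theorem mul12_comm (p q : ℕ) (c : ℤ → ℤ → ℤ → V) : mul12 ((mul13 ^ p) ((mul23 ^ q) c)) =
    (mul13 ^ p) ((mul23 ^ q) (mul12 c)) := by
  rw [commute_apply ((commute_12_13 (V := V)).pow_right p),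
    commute_apply ((commute_12_23 (V := V)).pow_right q)]

theorem half_bracket_left {ε ε' : ℂ} {f g h : ℤ → V →ₗ[ℂ] V} (hg : IsField g) {N M : ℕ} (v : V)
    (h₂ : ∀ v, (mulSub ^ N) (fun m n => f m (h n v) - ε • h n (f m v)) = 0)
    (h₃ : ∀ v, (mulSub ^ M) (fun m n => g m (h n v) - ε' • h n (g m v)) = 0) :
    (mul13 ^ N) ((mul23 ^ M) (fun m n l =>
      half f g m n (h l v) - (ε * ε') • h l (half f g m n v))) = 0 := by
  refine eq_zero_of_mul12_van2 ?_ ?_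
  · rw [mul12_comm]
    have a1 : mul12 (fun m n l => half f g m n (h l v) - (ε * ε') • h l (half f g m n v)) =
        (fun m n l => f m (g n (h l v) - ε' • h l (g n v))) +
        ε' • (fun m n l => f m (h l (g n v)) - ε • h l (f m (g n v))) := by
      funext m n l
      show (half f g (m + 1) n (h l v) - (ε * ε') • h l (half f g (m + 1) n v)) -
        (half f g m (n + 1) (h l v) - (ε * ε') • h l (half f g m (n + 1) v)) =
        f m (g n (h l v) - ε' • h l (g n v)) + ε' • (f m (h l (g n v)) - ε • h l (f m (g n v)))
      have r1 := half_rec f hg m n (h l v)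
      have r2 := half_rec f hg m n v
      rw [map_sub, map_smul, ← r1, ← r2, map_sub]
      module
    have e1 : (mul23 ^ M) (fun m n l => f m (g n (h l v) - ε' • h l (g n v))) = 0 := by
      funext m n l
      rw [mul23_pow, mulSub_pow_comp, h₃ v]; simp
    have e2 : (mul13 ^ N) (fun m n l => f m (h l (g n v)) - ε • h l (f m (g n v))) = 0 := by
      funext m n l
      rw [mul13_pow, h₂ (g n v)]; rfl
    rw [a1, map_add, map_add, e1, map_zero, map_smul, map_smul,
      commute_apply ((commute_13_23 (V := V)).pow_pow N M), e2, map_zero, smul_zero, add_zero]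
  · refine pow_induct (fun c => Van2.mul13) _ _ (pow_induct (fun c => Van2.mul23) _ _ ?_)
    intro l
    obtain ⟨M₁, k₁⟩ := hg v
    obtain ⟨M₂, k₂⟩ := hg (h l v)
    refine ⟨max M₁ M₂, fun n hn m => ?_⟩
    show half f g m n (h l v) - (ε * ε') • h l (half f g m n v) = 0
    rw [half_vanish f k₁ n (by omega), half_vanish f k₂ n (by omega)]
    simp

theorem half_bracket_right {ε ε' : ℂ} {f g h : ℤ → V →ₗ[ℂ] V} (hf : IsField f) {N M : ℕ} (v : V)
    (h₂ : ∀ v, (mulSub ^ N) (fun m n => f m (h n v) - ε • h n (f m v)) = 0)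
    (h₃ : ∀ v, (mulSub ^ M) (fun m n => g m (h n v) - ε' • h n (g m v)) = 0) :
    (mul13 ^ N) ((mul23 ^ M) (fun m n l =>
      half g f n m (h l v) - (ε * ε') • h l (half g f n m v))) = 0 := by
  refine eq_zero_of_mul12_van1 ?_ ?_
  · rw [mul12_comm]
    have a1 : mul12 (fun m n l => half g f n m (h l v) - (ε * ε') • h l (half g f n m v)) =
        (-1 : ℂ) • ((fun m n l => g n (f m (h l v) - ε • h l (f m v))) +
        ε • (fun m n l => g n (h l (f m v)) - ε' • h l (g n (f m v)))) := by
      funext m n l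
      show (half g f n (m + 1) (h l v) - (ε * ε') • h l (half g f n (m + 1) v)) -
        (half g f (n + 1) m (h l v) - (ε * ε') • h l (half g f (n + 1) m v)) =
        (-1 : ℂ) • (g n (f m (h l v) - ε • h l (f m v)) +
          ε • (g n (h l (f m v)) - ε' • h l (g n (f m v))))
      have r1 := half_rec g hf n m (h l v)
      have r2 := half_rec g hf n m v
      rw [map_sub, map_smul, ← r1, ← r2, map_sub]
      module
    have e1 : (mul13 ^ N) (fun m n l => g n (f m (h l v) - ε • h l (f m v))) = 0 := by
      funext m n l
      rw [mul13_pow, mulSub_pow_comp, h₂ v]; simp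
    have e2 : (mul23 ^ M) (fun m n l => g n (h l (f m v)) - ε' • h l (g n (f m v))) = 0 := by
      funext m n l
      rw [mul23_pow, h₃ (f m v)]; rfl
    rw [a1, map_smul, map_smul, map_add, map_add, commute_apply ((commute_13_23 (V := V)).pow_pow N M), e1,
      map_zero, map_smul, map_smul, e2, map_zero, smul_zero, add_zero, smul_zero]
  · refine pow_induct (fun c => Van1.mul13) _ _ (pow_induct (fun c => Van1.mul23) _ _ ?_)
    intro l
    obtain ⟨M₁, k₁⟩ := hf v
    obtain ⟨M₂, k₂⟩ := hf (h l v)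
    refine ⟨max M₁ M₂, fun m hm n => ?_⟩
    show half g f n m (h l v) - (ε * ε') • h l (half g f n m v) = 0
    rw [half_vanish g k₁ m (by omega), half_vanish g k₂ m (by omega)]
    simp

theorem half_bracket_mid {ε e : ℂ} {f g h : ℤ → V →ₗ[ℂ] V} (hf : IsField f) (hg : IsField g)
    {N : ℕ} (v : V) (h₁ : ∀ v, (mulSub ^ N) (fun m n => f m (g n v) - ε • g n (f m v)) = 0) :
    (mul12 ^ (N + 1)) ((fun m n l => half f g m n (h l v) - e • h l (half f g m n v)) +
      ε • (fun m n l => half g f n m (h l v) - e • h l (half g f n m v))) = 0 := by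
  have a1 : mul12 ((fun m n l => half f g m n (h l v) - e • h l (half f g m n v)) +
      ε • (fun m n l => half g f n m (h l v) - e • h l (half g f n m v))) =
      (fun m n l => (f m (g n (h l v)) - ε • g n (f m (h l v)))) -
        e • (fun m n l => h l (f m (g n v) - ε • g n (f m v))) := by
    funext m n l
    show (half f g (m + 1) n (h l v) - e • h l (half f g (m + 1) n v)) +
        ε • (half g f n (m + 1) (h l v) - e • h l (half g f n (m + 1) v)) -
      ((half f g m (n + 1) (h l v) - e • h l (half f g m (n + 1) v)) +
        ε • (half g f (n + 1) m (h l v) - e • h l (half g f (n + 1) m v))) =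
      (f m (g n (h l v)) - ε • g n (f m (h l v))) - e • h l (f m (g n v) - ε • g n (f m v))
    rw [← half_rec f hg m n (h l v), ← half_rec g hf n m (h l v), ← half_rec f hg m n v,
      ← half_rec g hf n m v, map_sub, map_sub, map_smul, map_sub]
    module
  have e1 : (mul12 ^ N) (fun m n l => (f m (g n (h l v)) - ε • g n (f m (h l v)))) = 0 := by
    funext m n l
    rw [mul12_pow, h₁ (h l v)]; rfl
  have e2 : (mul12 ^ N) (fun m n l => h l (f m (g n v) - ε • g n (f m v))) = 0 := by
    funext m n l
    rw [mul12_pow, mulSub_pow_comp, h₁ v]; simp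
  rw [pow_succ, Module.End.mul_apply, a1, map_sub, map_smul, e1, e2, smul_zero, sub_zero]

/-- Dong's lemma for the normally ordered product. -/
theorem IsLocal.nop {ε εf εg : ℂ} {f g h : ℤ → V →ₗ[ℂ] V} (hf : IsField f) (hg : IsField g)
    (hfg : IsLocal ε f g) (hfh : IsLocal εf f h) (hgh : IsLocal εg g h) :
    IsLocal (εf * εg) (nop ε f g hf hg) h := by
  obtain ⟨N₁, h₁⟩ := hfg
  obtain ⟨N₂, h₂⟩ := hfh
  obtain ⟨N₃, h₃⟩ := hgh
  refine ⟨(N₁ + N₂) + N₃, fun v => ?_⟩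
  have H1 := half_bracket_left (f := f) hg v h₂ h₃
  have H2 := half_bracket_right (g := g) hf v h₂ h₃
  have H3 := half_bracket_mid (h := h) (e := εf * εg) hf hg v h₁
  generalize hA : (fun m n l => half f g m n (h l v) - (εf * εg) • h l (half f g m n v)) = A
    at H1 H3
  generalize hB : (fun m n l => half g f n m (h l v) - (εf * εg) • h l (half g f n m v)) = B
    at H2 H3
  have H4 : (mul13 ^ N₂) ((mul23 ^ N₃) (A + ε • B)) = 0 := by
    rw [map_add, map_add, map_smul, map_smul, H1, H2, smul_zero, add_zero]
  have H5 : (mul23 ^ (N₁ + N₂ + N₃)) (A + ε • B) = 0 := by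
    rw [pow_add, Module.End.mul_apply]
    generalize hG : (mul23 ^ N₃) (A + ε • B) = G at H4
    have H6 : (mul12 ^ (N₁ + 1)) G = 0 := by
      rw [← hG, commute_apply ((commute_12_23 (V := V)).pow_pow (N₁ + 1) N₃), H3, map_zero]
    rw [mul23_eq]
    refine add_pow_kill (W := ℤ → ℤ → ℤ → V) (x := mul13) (y := (-1 : ℂ) • mul12) ?_ (N₁ + N₂) N₂ (N₁ + 1) (by omega) _ H4 ?_
    · exact (commute_12_13.symm).smul_right _
    · rw [smul_pow, LinearMap.smul_apply, H6, smul_zero]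
  funext n l
  have H7 := congrFun (congrFun (congrFun H5 0) n) l
  rw [mul23_pow] at H7
  refine Eq.trans ?_ H7
  refine congrFun (congrFun (congrArg _ ?_) n) l
  funext n l
  rw [← hA, ← hB]
  show (half f g 0 n (h l v) + ε • half g f n 0 (h l v)) -
    (εf * εg) • h l (half f g 0 n v + ε • half g f n 0 v) =
    (half f g 0 n (h l v) - (εf * εg) • h l (half f g 0 n v)) +
    ε • (half g f n 0 (h l v) - (εf * εg) • h l (half g f n 0 v))
  rw [map_add, map_smul]
  module

end Dong

/-! ### Vertex algebras -/

section VertexAlgebra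

variable {V : Type*} [AddCommGroup V] [Module ℂ V] {W : Type*} [AddCommGroup W] [Module ℂ W]

/-- A vertex algebra structure on `V`. Here `prod n a b` is `a_{(n)} b`, so that
`Y(a,z) = ∑ a_{(n)} z^{-n-1}`, and the translation operator is `T a = a_{(-2)} |0⟩`. -/
structure VertexAlgebra (V : Type*) [AddCommGroup V] [Module ℂ V] extends SuperSpace V where
  /-- The vacuum vector. -/
  vac : V
  /-- The products `a_{(n)} b`. -/
  prod : ℤ → V →ₗ[ℂ] V →ₗ[ℂ] V
  par_vac : par vac = vac
  /-- `Y` is parity preserving. -/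
  par_prod : ∀ n a b, par (prod n a b) = prod n (par a) (par b)
  isField : ∀ a, IsField (fun n => prod n a)
  trans_vac : prod (-2) vac vac = 0
  /-- `Y(a,z)|0⟩` has no negative powers of `z`, and its constant term is `a`. -/
  creation : ∀ a, (∀ n ≥ 0, prod n a vac = 0) ∧ prod (-1) a vac = a
  cov : ∀ a, IsCov ((prod (-2)).flip vac) (fun n => prod n a)
  locality : ∀ i j, ∀ a ∈ toSuperSpace.part i, ∀ b ∈ toSuperSpace.part j,
    IsLocal (koszul i j) (fun n => prod n a) (fun n => prod n b)

/-- The translation operator. -/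
def VertexAlgebra.T (A : VertexAlgebra V) : V →ₗ[ℂ] V := (A.prod (-2)).flip A.vac

/-- An isomorphism of vertex algebras. -/
structure VertexAlgebra.Iso (A : VertexAlgebra V) (B : VertexAlgebra W) extends V ≃ₗ[ℂ] W where
  map_par : ∀ a, toFun (A.par a) = B.par (toFun a)
  map_vac : toFun A.vac = B.vac
  map_prod : ∀ n a b, toFun (A.prod n a b) = B.prod n (toFun a) (toFun b)

/-- A (two-sided, `ℤ/2ℤ`-graded) ideal of a vertex algebra. -/
structure VertexAlgebra.Ideal (A : VertexAlgebra V) extends Submodule ℂ V where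
  par_mem : ∀ v ∈ toSubmodule, A.par v ∈ toSubmodule
  prod_mem_left : ∀ n a, ∀ v ∈ toSubmodule, A.prod n a v ∈ toSubmodule
  prod_mem_right : ∀ n a, ∀ v ∈ toSubmodule, A.prod n v a ∈ toSubmodule

/-- The ideal generated by a set, that is the smallest ideal containing it. -/
def VertexAlgebra.idealGen (A : VertexAlgebra V) (S : Set V) : A.Ideal where
  toSubmodule := ⨅ I : {I : A.Ideal // S ⊆ I.toSubmodule}, I.1.toSubmodule
  par_mem v hv := by
    rw [Submodule.mem_iInf] at *
    exact fun I => I.1.par_mem v (hv I)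
  prod_mem_left n a v hv := by
    rw [Submodule.mem_iInf] at *
    exact fun I => I.1.prod_mem_left n a v (hv I)
  prod_mem_right n a v hv := by
    rw [Submodule.mem_iInf] at *
    exact fun I => I.1.prod_mem_right n a v (hv I)

theorem VertexAlgebra.idealGen_mono (A : VertexAlgebra V) {S S' : Set V} (h : S ⊆ S') :
    (A.idealGen S).toSubmodule ≤ (A.idealGen S').toSubmodule := by
  intro v hv
  simp only [VertexAlgebra.idealGen, Submodule.mem_iInf] at *
  exact fun I => hv ⟨I.1, h.trans I.2⟩

/-- The underlying space of the quotient of a vertex algebra by an ideal. -/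
abbrev VertexAlgebra.Ideal.Quot {A : VertexAlgebra V} (I : A.Ideal) : Type _ := V ⧸ I.toSubmodule

theorem mulSub_pow_mk {U : Type*} [AddCommGroup U] [Module ℂ U] (φ : V →ₗ[ℂ] U) (k : ℕ) :
    ∀ (c : ℤ → ℤ → V), (mulSub ^ k) (fun n l => φ (c n l)) = fun n l => φ ((mulSub ^ k) c n l) := by
  induction k with
  | zero => intro c; rfl
  | succ k ih =>
    intro c
    rw [pow_succ, pow_succ, Module.End.mul_apply, Module.End.mul_apply, ← ih]
    congr 1
    funext n l
    simp only [mulSub_apply, map_sub]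

/-- The products of the quotient: `[a]_{(n)} [b] = [a_{(n)} b]`. -/
def VertexAlgebra.Ideal.quotProd {A : VertexAlgebra V} (I : A.Ideal) (n : ℤ) :
    I.Quot →ₗ[ℂ] I.Quot →ₗ[ℂ] I.Quot :=
  I.toSubmodule.liftQ
    { toFun := fun a => I.toSubmodule.mapQ I.toSubmodule (A.prod n a)
        (fun v hv => I.prod_mem_left n a v hv)
      map_add' := fun a b => by
        refine LinearMap.ext fun x => ?_
        obtain ⟨x, rfl⟩ := Submodule.Quotient.mk_surjective _ x
        simp
      map_smul' := fun c a => by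
        refine LinearMap.ext fun x => ?_
        obtain ⟨x, rfl⟩ := Submodule.Quotient.mk_surjective _ x
        simp }
    (fun v hv => by
      rw [LinearMap.mem_ker]
      refine LinearMap.ext fun x => ?_
      obtain ⟨x, rfl⟩ := Submodule.Quotient.mk_surjective _ x
      exact (Submodule.Quotient.mk_eq_zero _).2 (I.prod_mem_right n x v hv))

/-- The quotient of a vertex algebra by an ideal. -/
def VertexAlgebra.quotient (A : VertexAlgebra V) (I : A.Ideal) : VertexAlgebra I.Quot where
  par := I.toSubmodule.mapQ I.toSubmodule A.par (fun v hv => I.par_mem v hv)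
  par_par v := by
    obtain ⟨x, rfl⟩ := Submodule.Quotient.mk_surjective _ v
    exact congrArg _ (A.par_par x)
  vac := I.toSubmodule.mkQ A.vac
  prod := I.quotProd
  par_vac := congrArg I.toSubmodule.mkQ A.par_vac
  par_prod n a b := by
    obtain ⟨a, rfl⟩ := Submodule.Quotient.mk_surjective _ a
    obtain ⟨b, rfl⟩ := Submodule.Quotient.mk_surjective _ b
    exact congrArg I.toSubmodule.mkQ (A.par_prod n a b)
  isField a v := by
    obtain ⟨a, rfl⟩ := Submodule.Quotient.mk_surjective _ a
    obtain ⟨v, rfl⟩ := Submodule.Quotient.mk_surjective _ v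
    obtain ⟨N, hN⟩ := A.isField a v
    exact ⟨N, fun n hn => (congrArg I.toSubmodule.mkQ (hN n hn)).trans (map_zero _)⟩
  trans_vac := (congrArg I.toSubmodule.mkQ A.trans_vac).trans (map_zero _)
  creation a := by
    obtain ⟨a, rfl⟩ := Submodule.Quotient.mk_surjective _ a
    exact ⟨fun n hn => (congrArg I.toSubmodule.mkQ ((A.creation a).1 n hn)).trans (map_zero _),
      congrArg I.toSubmodule.mkQ (A.creation a).2⟩
  cov a n v := by
    obtain ⟨a, rfl⟩ := Submodule.Quotient.mk_surjective _ a
    obtain ⟨v, rfl⟩ := Submodule.Quotient.mk_surjective _ v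
    exact congrArg I.toSubmodule.mkQ (A.cov a n v)
  locality i j a ha b hb := by
    set π := I.toSubmodule.mkQ
    have lift : ∀ k : ZMod 2, ∀ q : I.Quot,
        (I.toSubmodule.mapQ I.toSubmodule A.par (fun v hv => I.par_mem v hv)) q = sgn k • q →
        ∃ v ∈ A.part k, π v = q := by
      intro k q hq
      obtain ⟨v, rfl⟩ := Submodule.Quotient.mk_surjective _ q
      refine ⟨A.proj k v, A.proj_mem k v, ?_⟩
      change π (A.par v) = sgn k • π v at hq
      change _ = π v
      simp only [SuperSpace.proj, LinearMap.smul_apply, LinearMap.add_apply, LinearMap.id_apply,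
        map_smul, map_add, hq, smul_smul, sgn_mul_self]
      module
    obtain ⟨a, ha', rfl⟩ := lift i a ha
    obtain ⟨b, hb', rfl⟩ := lift j b hb
    obtain ⟨N, hN⟩ := A.locality i j a ha' b hb'
    refine ⟨N, fun v => ?_⟩
    obtain ⟨v, rfl⟩ := Submodule.Quotient.mk_surjective _ v
    have h := mulSub_pow_mk π N
      (fun m n => A.prod m a (A.prod n b v) - koszul i j • A.prod n b (A.prod m a v))
    rw [hN v] at h
    simp only [Pi.zero_apply, map_zero] at h
    exact h

end VertexAlgebra

/-! ### Tensor products of vertex algebras -/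

section Tensor

variable {V : Type*} [AddCommGroup V] [Module ℂ V] {W : Type*} [AddCommGroup W] [Module ℂ W]

theorem finsum_int_split {M : Type*} [AddCommGroup M] {h : ℤ → M} (hh : h.support.Finite) :
    ∑ᶠ i, h i = (∑ᶠ k : ℕ, h (-1 - k)) + ∑ᶠ k : ℕ, h k := by
  have i1 : Function.Injective (fun k : ℕ => (-1 - k : ℤ)) := fun a b hab => by
    simp only at hab; omega
  have i2 : Function.Injective (fun k : ℕ => (k : ℤ)) := fun a b hab => by
    simp only at hab; omega
  have hu : (Set.univ : Set ℤ) = Set.range (fun k : ℕ => (-1 - k : ℤ)) ∪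
      Set.range (fun k : ℕ => (k : ℤ)) := by
    ext i
    simp only [Set.mem_univ, Set.mem_union, Set.mem_range, true_iff]
    rcases lt_or_ge i 0 with h | h
    · exact Or.inl ⟨(-1 - i).toNat, by omega⟩
    · exact Or.inr ⟨i.toNat, by omega⟩
  have hd : Disjoint (Set.range (fun k : ℕ => (-1 - k : ℤ))) (Set.range (fun k : ℕ => (k : ℤ))) := by
    rw [Set.disjoint_left]
    rintro _ ⟨a, rfl⟩ ⟨b, hb⟩
    simp only at hb; omega
  rw [← finsum_mem_univ h, hu, finsum_mem_union' hd (hh.inter_of_right _) (hh.inter_of_right _),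
    finsum_mem_range i1, finsum_mem_range i2]

theorem IsLocal.zero_left (ε : ℂ) (g : ℤ → V →ₗ[ℂ] V) : IsLocal ε 0 g :=
  ⟨0, fun v => by funext m n; simp⟩

theorem IsLocal.add_left {ε : ℂ} {f f' g : ℤ → V →ₗ[ℂ] V} (h : IsLocal ε f g)
    (h' : IsLocal ε f' g) : IsLocal ε (f + f') g := by
  obtain ⟨N, hN⟩ := h
  obtain ⟨M, hM⟩ := h'
  refine ⟨max N M, fun v => ?_⟩
  have e : (fun m n => (f + f') m (g n v) - ε • g n ((f + f') m v)) =
      (fun m n => f m (g n v) - ε • g n (f m v)) + (fun m n => f' m (g n v) - ε • g n (f' m v)) := by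
    funext m n
    simp only [Pi.add_apply, LinearMap.add_apply, map_add, smul_add]; abel
  rw [e, map_add, mulSub_pow_mono (le_max_left _ _) (hN v),
    mulSub_pow_mono (le_max_right _ _) (hM v), add_zero]

theorem IsLocal.smul_left {ε : ℂ} {f g : ℤ → V →ₗ[ℂ] V} (c : ℂ) (h : IsLocal ε f g) :
    IsLocal ε (c • f) g := by
  obtain ⟨N, hN⟩ := h
  refine ⟨N, fun v => ?_⟩
  have e : (fun m n => (c • f) m (g n v) - ε • g n ((c • f) m v)) =
      c • (fun m n => f m (g n v) - ε • g n (f m v)) := by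
    funext m n
    simp only [Pi.smul_apply, LinearMap.smul_apply, map_smul, smul_sub, smul_comm ε c]
  rw [e, map_smul, hN v, smul_zero]

theorem isField_tensor {F : ℤ → V ⊗[ℂ] W →ₗ[ℂ] V ⊗[ℂ] W}
    (h : ∀ c d, ∃ N : ℤ, ∀ n ≥ N, F n (c ⊗ₜ d) = 0) : IsField F := by
  intro x
  induction x with
  | zero => exact ⟨0, fun n _ => map_zero _⟩
  | tmul c d => exact h c d
  | add x y hx hy =>
    obtain ⟨N, hN⟩ := hx
    obtain ⟨M, hM⟩ := hy
    refine ⟨max N M, fun n hn => ?_⟩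
    rw [map_add, hN n (by omega), hM n (by omega), add_zero]

/-- `A.par ^ j` for `j ∈ ℤ/2ℤ`. -/
def SuperSpace.parPow (S : SuperSpace V) (j : ZMod 2) : V →ₗ[ℂ] V :=
  if j = 1 then S.par else LinearMap.id

theorem SuperSpace.parPow_comm (S : SuperSpace V) (j k : ZMod 2) (v : V) :
    S.parPow j (S.parPow k v) = S.parPow k (S.parPow j v) := by
  unfold SuperSpace.parPow; split_ifs <;> rfl

theorem SuperSpace.proj_ne (S : SuperSpace V) {i j : ZMod 2} (hij : i ≠ j) {v : V}
    (h : v ∈ S.part j) : S.proj i v = 0 := by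
  rw [SuperSpace.mem_part] at h
  have key : sgn i * sgn j = -1 := by
    have : ∀ i j : ZMod 2, i ≠ j → i + j = 1 := by decide
    rw [← sgn_add, this i j hij]; simp [sgn]
  simp only [SuperSpace.proj, LinearMap.smul_apply, LinearMap.add_apply, LinearMap.id_apply, h,
    smul_smul, key]
  module

namespace VertexAlgebra

variable (A : VertexAlgebra V) (B : VertexAlgebra W)

/-- The summand `a_{(i)} ⊗ b_{(m)}`, with the sign rule
`(a_{(i)} ⊗ b_{(m)}) (c ⊗ d) = p(b,c) a_{(i)} c ⊗ b_{(m)} d` and `b` split into its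
homogeneous components. -/
noncomputable def tensorTerm (i m : ℤ) (a : V) (b : W) : V ⊗[ℂ] W →ₗ[ℂ] V ⊗[ℂ] W :=
  TensorProduct.map (A.prod i a) (B.prod m (B.proj 0 b)) +
    TensorProduct.map (A.prod i a ∘ₗ A.par) (B.prod m (B.proj 1 b))

theorem tensorTerm_finite (n : ℤ) (a : V) (b : W) (x : V ⊗[ℂ] W) :
    (Function.support fun i : ℤ => tensorTerm A B i (n - 1 - i) a b x).Finite := by
  induction x with
  | zero => simp
  | tmul c d =>
    obtain ⟨N₀, h₀⟩ := A.isField a c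
    obtain ⟨N₁, h₁⟩ := A.isField a (A.par c)
    obtain ⟨M₀, k₀⟩ := B.isField (B.proj 0 b) d
    obtain ⟨M₁, k₁⟩ := B.isField (B.proj 1 b) d
    refine (Set.finite_Icc (n - 1 - max M₀ M₁) (max N₀ N₁)).subset fun i hi => ?_
    by_contra hi'
    refine hi ?_
    rw [Set.mem_Icc, not_and_or, not_le, not_le] at hi'
    simp only at h₀ h₁ k₀ k₁
    simp only [tensorTerm, LinearMap.add_apply, TensorProduct.map_tmul, LinearMap.comp_apply]
    rcases hi' with hi' | hi'
    · rw [k₀ _ (by omega), k₁ _ (by omega)]; simp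
    · rw [h₀ _ (by omega), h₁ _ (by omega)]; simp
  | add x y hx hy =>
    refine (hx.union hy).subset fun i hi => ?_
    by_contra hi'
    rw [Set.mem_union, not_or, Function.notMem_support, Function.notMem_support] at hi'
    refine hi ?_
    show tensorTerm A B i (n - 1 - i) a b (x + y) = 0
    rw [map_add, hi'.1, hi'.2, add_zero]

/-- The `n`-th mode of `Y(a,z) ⊗ Y(b,z)`, namely `∑_{i ∈ ℤ} a_{(i)} ⊗ b_{(n-1-i)}`; the sum is
finite on each vector. -/
noncomputable def tensorMode (n : ℤ) (a : V) (b : W) : V ⊗[ℂ] W →ₗ[ℂ] V ⊗[ℂ] W where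
  toFun x := ∑ᶠ i : ℤ, tensorTerm A B i (n - 1 - i) a b x
  map_add' x y := by
    rw [← finsum_add_distrib (tensorTerm_finite A B n a b x) (tensorTerm_finite A B n a b y)]
    simp only [map_add]
  map_smul' c x := by
    rw [RingHom.id_apply, smul_finsum' c (tensorTerm_finite A B n a b x)]
    simp only [map_smul]

theorem tensorMode_apply (n : ℤ) (a : V) (b : W) (x : V ⊗[ℂ] W) :
    tensorMode A B n a b x = ∑ᶠ i : ℤ, tensorTerm A B i (n - 1 - i) a b x := rfl

/-- The products of `V ⊗ W`, determined by `Y(a ⊗ b, z) = Y(a,z) ⊗ Y(b,z)`. -/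
noncomputable def tensorProd (n : ℤ) : V ⊗[ℂ] W →ₗ[ℂ] V ⊗[ℂ] W →ₗ[ℂ] V ⊗[ℂ] W :=
  TensorProduct.lift (LinearMap.mk₂ ℂ (tensorMode A B n)
    (fun a a' b => by
      refine LinearMap.ext fun x => ?_
      rw [LinearMap.add_apply, tensorMode_apply, tensorMode_apply, tensorMode_apply,
        ← finsum_add_distrib (tensorTerm_finite A B n a b x) (tensorTerm_finite A B n a' b x)]
      refine finsum_congr fun i => ?_
      simp only [tensorTerm, map_add, LinearMap.add_comp, TensorProduct.map_add_left,
        LinearMap.add_apply]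
      abel)
    (fun c a b => by
      refine LinearMap.ext fun x => ?_
      rw [LinearMap.smul_apply, tensorMode_apply, tensorMode_apply,
        smul_finsum' c (tensorTerm_finite A B n a b x)]
      refine finsum_congr fun i => ?_
      simp only [tensorTerm, map_smul, LinearMap.smul_comp, TensorProduct.map_smul_left,
        LinearMap.add_apply, LinearMap.smul_apply, smul_add])
    (fun a b b' => by
      refine LinearMap.ext fun x => ?_
      rw [LinearMap.add_apply, tensorMode_apply, tensorMode_apply, tensorMode_apply,
        ← finsum_add_distrib (tensorTerm_finite A B n a b x) (tensorTerm_finite A B n a b' x)]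
      refine finsum_congr fun i => ?_
      simp only [tensorTerm, map_add, TensorProduct.map_add_right,
        LinearMap.add_apply]
      abel)
    (fun c a b => by
      refine LinearMap.ext fun x => ?_
      rw [LinearMap.smul_apply, tensorMode_apply, tensorMode_apply,
        smul_finsum' c (tensorTerm_finite A B n a b x)]
      refine finsum_congr fun i => ?_
      simp only [tensorTerm, map_smul, TensorProduct.map_smul_right,
        LinearMap.add_apply, LinearMap.smul_apply, smul_add]))

theorem tensorProd_tmul (n : ℤ) (a : V) (b : W) :
    tensorProd A B n (a ⊗ₜ b) = tensorMode A B n a b := by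
  simp [tensorProd]

/-- The fields `Y(a,z) ⊗ 1`. -/
noncomputable def leftField (a : V) (n : ℤ) : V ⊗[ℂ] W →ₗ[ℂ] V ⊗[ℂ] W :=
  TensorProduct.map (A.prod n a) LinearMap.id

/-- The fields `1 ⊗ Y(b,z)`, for `b` of parity `j`. -/
noncomputable def rightField (j : ZMod 2) (b : W) (n : ℤ) : V ⊗[ℂ] W →ₗ[ℂ] V ⊗[ℂ] W :=
  TensorProduct.map (A.parPow j) (B.prod n b)

theorem leftField_isField (a : V) : IsField (leftField (W := W) A a) :=
  isField_tensor fun c d => by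
    obtain ⟨N, hN⟩ := A.isField a c
    refine ⟨N, fun n hn => ?_⟩
    simp only at hN
    rw [leftField, TensorProduct.map_tmul, hN n hn, TensorProduct.zero_tmul]

theorem rightField_isField (j : ZMod 2) (b : W) : IsField (rightField A B j b) :=
  isField_tensor fun c d => by
    obtain ⟨N, hN⟩ := B.isField b d
    refine ⟨N, fun n hn => ?_⟩
    simp only at hN
    rw [rightField, TensorProduct.map_tmul, hN n hn, TensorProduct.tmul_zero]

theorem parPow_prod {i : ZMod 2} {a : V} (ha : a ∈ A.part i) (j : ZMod 2) (n : ℤ) (c : V) :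
    A.parPow j (A.prod n a c) = koszul i j • A.prod n a (A.parPow j c) := by
  have h2 : ∀ i : ZMod 2, i = 0 ∨ i = 1 := by decide
  rcases h2 j with rfl | rfl
  · simp [SuperSpace.parPow, koszul, sgn]
  · simp only [SuperSpace.parPow, koszul, mul_one, if_true, A.par_prod]
    rw [SuperSpace.mem_part.1 ha, map_smul, LinearMap.smul_apply]

theorem left_right_comm {i j : ZMod 2} {a : V} (ha : a ∈ A.part i) (b : W) (m n : ℤ)
    (x : V ⊗[ℂ] W) : rightField A B j b n (leftField A a m x) =
      koszul i j • leftField A a m (rightField A B j b n x) := by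
  induction x with
  | zero => simp
  | tmul c d =>
    simp only [leftField, rightField, TensorProduct.map_tmul, LinearMap.id_apply,
      A.parPow_prod ha, TensorProduct.smul_tmul']
  | add x y hx hy => simp only [map_add, hx, hy, smul_add]

theorem tensorTerm_eq {j : ZMod 2} (a : V) {b : W} (hb : b ∈ B.part j) (i m : ℤ)
    (x : V ⊗[ℂ] W) : tensorTerm A B i m a b x = leftField A a i (rightField A B j b m x) := by
  have h2 : ∀ i : ZMod 2, i = 0 ∨ i = 1 := by decide
  rw [leftField, rightField, ← LinearMap.comp_apply, ← TensorProduct.map_comp, LinearMap.id_comp,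
    tensorTerm]
  rcases h2 j with rfl | rfl
  · rw [B.proj_of_mem hb, B.proj_ne (by decide) hb, map_zero, TensorProduct.map_zero_right,
      add_zero]
    rfl
  · rw [B.proj_of_mem hb, B.proj_ne (by decide) hb, map_zero, TensorProduct.map_zero_right,
      zero_add]
    rfl

theorem tensorMode_eq_nop {i j : ZMod 2} {a : V} (ha : a ∈ A.part i) {b : W}
    (hb : b ∈ B.part j) : (fun n => tensorMode A B n a b) =
      nop (koszul i j) (leftField A a) (rightField A B j b) (leftField_isField A a)
        (rightField_isField A B j b) := by
  funext n
  refine LinearMap.ext fun x => ?_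
  rw [tensorMode_apply, finsum_int_split (tensorTerm_finite A B n a b x), nop_apply, half, half]
  congr 1
  · refine finsum_congr fun k => ?_
    rw [tensorTerm_eq A B a hb]
    rw [show n - 1 - (-1 - (k : ℤ)) = n + k by ring, zero_sub]
  · have fin : (Function.support fun k : ℕ =>
        rightField A B j b (n - 1 - k) (leftField A a (0 + k) x)).Finite := by
      obtain ⟨N, hN⟩ := leftField_isField (W := W) A a x
      refine (Set.finite_Iio N.toNat).subset fun k hk => ?_
      by_contra hk'
      rw [Set.mem_Iio, not_lt] at hk'
      refine hk ?_
      show rightField A B j b _ (leftField A a _ x) = 0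
      rw [hN _ (by omega), map_zero]
    rw [smul_finsum' _ fin]
    refine finsum_congr fun k => ?_
    rw [tensorTerm_eq A B a hb, left_right_comm A B ha, smul_smul, koszul_mul_self, one_smul,
      zero_add]

theorem isLocal_left {i i' : ZMod 2} {a a' : V} (ha : a ∈ A.part i) (ha' : a' ∈ A.part i') :
    IsLocal (koszul i i') (leftField (W := W) A a) (leftField A a') := by
  obtain ⟨N, hN⟩ := A.locality i i' a ha a' ha'
  refine ⟨N, fun x => ?_⟩
  induction x with
  | zero => simp only [map_zero, smul_zero, sub_zero]; exact map_zero _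
  | tmul c d =>
    have := mulSub_pow_mk ((TensorProduct.mk ℂ V W).flip d) N
      (fun m n => A.prod m a (A.prod n a' c) - koszul i i' • A.prod n a' (A.prod m a c))
    rw [hN c] at this
    simp only [leftField, TensorProduct.map_tmul, LinearMap.id_apply, LinearMap.flip_apply,
      TensorProduct.mk_apply, TensorProduct.sub_tmul, TensorProduct.smul_tmul', Pi.zero_apply,
      TensorProduct.zero_tmul] at this ⊢
    exact this
  | add x y hx hy =>
    have e : (fun m n => leftField A a m (leftField A a' n (x + y)) -
        koszul i i' • leftField A a' n (leftField A a m (x + y))) =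
        (fun m n => leftField A a m (leftField A a' n x) -
          koszul i i' • leftField A a' n (leftField A a m x)) +
        (fun m n => leftField A a m (leftField A a' n y) -
          koszul i i' • leftField A a' n (leftField A a m y)) := by
      funext m n
      simp only [map_add, smul_add, Pi.add_apply]; abel
    rw [e, map_add, hx, hy, add_zero]

theorem isLocal_right {j j' : ZMod 2} {b b' : W} (hb : b ∈ B.part j) (hb' : b' ∈ B.part j') :
    IsLocal (koszul j j') (rightField A B j b) (rightField A B j' b') := by
  obtain ⟨N, hN⟩ := B.locality j j' b hb b' hb'
  refine ⟨N, fun x => ?_⟩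
  induction x with
  | zero => simp only [map_zero, smul_zero, sub_zero]; exact map_zero _
  | tmul c d =>
    have := mulSub_pow_mk (TensorProduct.mk ℂ V W (A.parPow j (A.parPow j' c))) N
      (fun m n => B.prod m b (B.prod n b' d) - koszul j j' • B.prod n b' (B.prod m b d))
    rw [hN d] at this
    simp only [rightField, TensorProduct.map_tmul, A.parPow_comm j' j,
      TensorProduct.mk_apply, TensorProduct.tmul_sub, TensorProduct.tmul_smul, Pi.zero_apply,
      TensorProduct.tmul_zero] at this ⊢
    exact this
  | add x y hx hy =>
    have e : (fun m n => rightField A B j b m (rightField A B j' b' n (x + y)) -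
        koszul j j' • rightField A B j' b' n (rightField A B j b m (x + y))) =
        (fun m n => rightField A B j b m (rightField A B j' b' n x) -
          koszul j j' • rightField A B j' b' n (rightField A B j b m x)) +
        (fun m n => rightField A B j b m (rightField A B j' b' n y) -
          koszul j j' • rightField A B j' b' n (rightField A B j b m y)) := by
      funext m n
      simp only [map_add, smul_add, Pi.add_apply]; abel
    rw [e, map_add, hx, hy, add_zero]

theorem isLocal_left_right {i j : ZMod 2} {a : V} (ha : a ∈ A.part i) (b : W) :
    IsLocal (koszul i j) (leftField A a) (rightField A B j b) := by
  refine ⟨0, fun x => ?_⟩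
  funext m n
  simp only [pow_zero, Module.End.one_apply, Pi.zero_apply]
  rw [left_right_comm A B ha, smul_smul, koszul_mul_self, one_smul, sub_self]

theorem isLocal_right_left {i j : ZMod 2} {a : V} (ha : a ∈ A.part i) (b : W) :
    IsLocal (koszul j i) (rightField A B j b) (leftField A a) := by
  rw [koszul_comm]
  exact (isLocal_left_right A B ha b).symm (koszul_mul_self _ _)

theorem isLocal_tensorMode {i j i' j' : ZMod 2} {a a' : V} {b b' : W} (ha : a ∈ A.part i)
    (hb : b ∈ B.part j) (ha' : a' ∈ A.part i') (hb' : b' ∈ B.part j') :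
    IsLocal (koszul (i + j) (i' + j')) (fun n => tensorMode A B n a b)
      (fun n => tensorMode A B n a' b') := by
  rw [tensorMode_eq_nop A B ha hb, tensorMode_eq_nop A B ha' hb', koszul_add_left]
  have sq : ∀ k, (koszul i' k * koszul j' k) * (koszul i' k * koszul j' k) = 1 := fun k => by
    rw [mul_mul_mul_comm, koszul_mul_self, koszul_mul_self, one_mul]
  have r : ∀ k, koszul k (i' + j') = koszul i' k * koszul j' k := fun k => by
    rw [koszul_add_right, koszul_comm k, koszul_comm k]
  refine IsLocal.nop _ _ (isLocal_left_right A B ha b) ?_ ?_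
  · rw [r]
    refine IsLocal.symm (sq i) (IsLocal.nop _ _ (isLocal_left_right A B ha' b') ?_ ?_)
    · exact isLocal_left A ha' ha
    · exact isLocal_right_left A B ha b'
  · rw [r]
    refine IsLocal.symm (sq j) (IsLocal.nop _ _ (isLocal_left_right A B ha' b') ?_ ?_)
    · exact isLocal_left_right A B ha' b
    · exact isLocal_right A B hb' hb

/-- The grading of the tensor product of two superspaces. -/
noncomputable def _root_.SuperAffine.SuperSpace.tensor (S : SuperSpace V) (S' : SuperSpace W) :
    SuperSpace (V ⊗[ℂ] W) where
  par := TensorProduct.map S.par S'.par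
  par_par x := by
    induction x with
    | zero => simp
    | tmul c d => simp [S.par_par, S'.par_par]
    | add x y hx hy => simp only [map_add, hx, hy]

@[elab_as_elim]
theorem tmul_induction (S : SuperSpace V) (S' : SuperSpace W) {p : V ⊗[ℂ] W → Prop}
    (h : ∀ i j, ∀ a ∈ S.part i, ∀ b ∈ S'.part j, p (a ⊗ₜ b)) (h0 : p 0)
    (hadd : ∀ x y, p x → p y → p (x + y)) (x : V ⊗[ℂ] W) : p x := by
  induction x with
  | zero => exact h0
  | tmul c d =>
    refine S.hom_induction (p := fun c => p (c ⊗ₜ d)) (fun i a ha => ?_) (fun v w hv hw => ?_) c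
    · refine S'.hom_induction (p := fun d => p (a ⊗ₜ d)) (fun j b hb => ?_) (fun v w hv hw => ?_) d
      · exact h i j a ha b hb
      · rw [TensorProduct.tmul_add]; exact hadd _ _ hv hw
    · rw [TensorProduct.add_tmul]; exact hadd _ _ hv hw
  | add x y hx hy => exact hadd _ _ hx hy

theorem tensor_part_induction (S : SuperSpace V) (S' : SuperSpace W) {k : ZMod 2}
    {p : V ⊗[ℂ] W → Prop} (h : ∀ i j, i + j = k → ∀ a ∈ S.part i, ∀ b ∈ S'.part j, p (a ⊗ₜ b))
    (h0 : p 0) (hadd : ∀ x y, p x → p y → p (x + y)) {x : V ⊗[ℂ] W}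
    (hx : x ∈ (S.tensor S').part k) : p x := by
  rw [← (S.tensor S').proj_of_mem hx]
  refine tmul_induction S S' (p := fun x => p ((S.tensor S').proj k x)) ?_ ?_ ?_ x
  · intro i j a ha b hb
    have hab : a ⊗ₜ b ∈ (S.tensor S').part (i + j) := by
      rw [SuperSpace.mem_part] at *
      simp only [SuperSpace.tensor, TensorProduct.map_tmul, ha, hb, sgn_add,
        TensorProduct.smul_tmul', TensorProduct.tmul_smul, smul_smul]
      rw [mul_comm]
    by_cases hk : i + j = k
    · rw [(S.tensor S').proj_of_mem (hk ▸ hab)]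
      exact h i j hk a ha b hb
    · rw [(S.tensor S').proj_ne (fun e => hk e.symm) hab]
      exact h0
  · simpa using h0
  · intro x y hx hy
    rw [map_add]; exact hadd _ _ hx hy

theorem tensorProd_T (x : V ⊗[ℂ] W) : tensorProd A B (-2) x (A.vac ⊗ₜ B.vac) =
    TensorProduct.map A.T LinearMap.id x + TensorProduct.map LinearMap.id B.T x := by
  induction x using tmul_induction A.toSuperSpace B.toSuperSpace
  · rename_i i j a ha b hb
    rw [tensorProd_tmul, tensorMode_apply, finsum_eq_sum_of_support_subset (s := {-1, -2})]
    · rw [Finset.sum_pair (by decide)]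
      simp only [tensorTerm_eq A B a hb, leftField, rightField, TensorProduct.map_tmul,
        LinearMap.id_apply]
      have : A.parPow j A.vac = A.vac := by
        unfold SuperSpace.parPow; split_ifs <;> simp [A.par_vac]
      rw [this, (A.creation a).2]
      rw [show (-2 : ℤ) - 1 - -2 = -1 by norm_num, (B.creation b).2, add_comm]
      rfl
    · intro k hk
      by_contra hk'
      refine hk ?_
      simp only [Finset.coe_insert, Finset.coe_singleton, Set.mem_insert_iff,
        Set.mem_singleton_iff, not_or] at hk'
      have : A.parPow j A.vac = A.vac := by
        unfold SuperSpace.parPow; split_ifs <;> simp [A.par_vac]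
      show tensorTerm A B k _ a b _ = 0
      simp only [tensorTerm_eq A B a hb, leftField, rightField, TensorProduct.map_tmul,
        LinearMap.id_apply, this]
      rcases le_or_gt 0 k with h | h
      · rw [(A.creation a).1 k h, TensorProduct.zero_tmul]
      · rw [(B.creation b).1 _ (by omega), TensorProduct.tmul_zero]
  · simp
  · rename_i x y hx hy
    rw [map_add, LinearMap.add_apply, hx, hy, map_add, map_add]; abel

theorem T_par (a : V) : A.T (A.par a) = A.par (A.T a) := by
  simp only [VertexAlgebra.T, LinearMap.flip_apply, A.par_prod, A.par_vac]

theorem tensorProd_cov (x : V ⊗[ℂ] W) :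
    IsCov ((tensorProd A B (-2)).flip (A.vac ⊗ₜ B.vac)) (fun n => tensorProd A B n x) := by
  have hT : (tensorProd A B (-2)).flip (A.vac ⊗ₜ B.vac) =
      TensorProduct.map A.T LinearMap.id + TensorProduct.map LinearMap.id B.T := by
    refine LinearMap.ext fun x => ?_
    exact tensorProd_T A B x
  rw [hT]
  induction x using tmul_induction A.toSuperSpace B.toSuperSpace
  · rename_i i j a ha b hb
    simp only [tensorProd_tmul]
    rw [tensorMode_eq_nop A B ha hb]
    refine IsCov.nop _ _ ?_ ?_
    · intro n y
      induction y with
      | zero => simp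
      | tmul c d =>
        have := A.cov a n c
        simp only [leftField, LinearMap.add_apply, TensorProduct.map_tmul, LinearMap.id_apply,
          map_add, TensorProduct.smul_tmul']
        rw [← this, TensorProduct.sub_tmul]
        simp only [VertexAlgebra.T]
        abel
      | add x y hx hy =>
        simp only [map_add, smul_add] at *
        rw [← hx, ← hy]; abel
    · intro n y
      induction y with
      | zero => simp
      | tmul c d =>
        have := B.cov b n d
        have hp : A.parPow j (A.T c) = A.T (A.parPow j c) := by
          unfold SuperSpace.parPow; split_ifs <;> simp [A.T_par]
        simp only [rightField, LinearMap.add_apply, TensorProduct.map_tmul, LinearMap.id_apply,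
          map_add, hp]
        rw [← TensorProduct.tmul_smul, ← this, TensorProduct.tmul_sub]
        simp only [VertexAlgebra.T]
        abel
      | add x y hx hy =>
        simp only [map_add, smul_add] at *
        rw [← hx, ← hy]; abel
  · intro n y; simp
  · rename_i x y hx hy
    intro n z
    have h1 := hx n z
    have h2 := hy n z
    simp only [map_add (tensorProd A B _), LinearMap.add_apply _ _ z, map_add, smul_add,
      LinearMap.add_apply (tensorProd A B _ x)] at *
    rw [← h1, ← h2]; abel

/-- The tensor product of two vertex algebras, with vacuum `|0⟩ ⊗ |0⟩` and
`Y(a ⊗ b, z) = Y(a,z) ⊗ Y(b,z)`. -/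
noncomputable def tensor : VertexAlgebra (V ⊗[ℂ] W) where
  toSuperSpace := A.toSuperSpace.tensor B.toSuperSpace
  vac := A.vac ⊗ₜ B.vac
  prod := tensorProd A B
  par_vac := by simp [SuperSpace.tensor, A.par_vac, B.par_vac]
  par_prod n x y := by
    induction x with
    | zero => simp
    | tmul a b =>
      simp only [SuperSpace.tensor, TensorProduct.map_tmul, tensorProd_tmul, tensorMode_apply]
      rw [← LinearMap.toAddMonoidHom_coe, AddMonoidHom.map_finsum _ (tensorTerm_finite A B n a b y)]
      refine finsum_congr fun i => ?_
      rw [LinearMap.toAddMonoidHom_coe]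
      have hp : ∀ k, B.proj k (B.par b) = B.par (B.proj k b) := fun k => by
        simp [SuperSpace.proj]
      induction y with
      | zero => simp
      | tmul c d =>
        simp only [tensorTerm, LinearMap.add_apply, TensorProduct.map_tmul, map_add,
          LinearMap.comp_apply, A.par_prod, B.par_prod, hp]
      | add x y hx hy => simp only [map_add, hx, hy]
    | add x y hx hy => simp only [map_add, LinearMap.add_apply, hx, hy]
  isField x := by
    intro y
    induction x using tmul_induction A.toSuperSpace B.toSuperSpace
    · rename_i i j a ha b hb
      have := IsField.nop (ε := koszul i j) (leftField_isField (W := W) A a)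
        (rightField_isField A B j b) y
      rw [← tensorMode_eq_nop A B ha hb] at this
      simpa only [tensorProd_tmul] using this
    · exact ⟨0, fun n _ => by simp⟩
    · rename_i x x' hx hy
      revert hx hy
      rintro ⟨N, hN⟩ ⟨M, hM⟩
      refine ⟨max N M, fun n hn => ?_⟩
      simp only at hN hM
      show tensorProd A B n (x + x') y = 0
      rw [map_add, LinearMap.add_apply, hN n (by omega), hM n (by omega), add_zero]
  trans_vac := by
    rw [tensorProd_T]
    simp only [TensorProduct.map_tmul, VertexAlgebra.T, LinearMap.flip_apply, A.trans_vac,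
      B.trans_vac, LinearMap.id_apply, TensorProduct.zero_tmul, TensorProduct.tmul_zero, add_zero]
  creation x := by
    induction x using tmul_induction A.toSuperSpace B.toSuperSpace
    · rename_i i j a ha b hb
      have hv : A.parPow j A.vac = A.vac := by
        unfold SuperSpace.parPow; split_ifs <;> simp [A.par_vac]
      have h := nop_vac (ε := koszul i j) (leftField_isField (W := W) A a)
        (rightField_isField A B j b) (o := A.vac ⊗ₜ B.vac)
        (fun n hn => by
          rw [leftField, TensorProduct.map_tmul, (A.creation a).1 n hn, TensorProduct.zero_tmul])
        (fun n hn => by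
          rw [rightField, TensorProduct.map_tmul, (B.creation b).1 n hn, TensorProduct.tmul_zero])
      rw [← tensorMode_eq_nop A B ha hb] at h
      simp only [tensorProd_tmul]
      refine ⟨h.1, h.2.trans ?_⟩
      rw [rightField, TensorProduct.map_tmul, (B.creation b).2, hv, leftField,
        TensorProduct.map_tmul, (A.creation a).2]
      rfl
    · exact ⟨fun n _ => by simp, by simp⟩
    · rename_i x y hx hy
      revert hx hy
      rintro ⟨h1, h2⟩ ⟨h3, h4⟩
      refine ⟨fun n hn => ?_, ?_⟩
      · rw [map_add, LinearMap.add_apply, h1 n hn, h3 n hn, add_zero]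
      · rw [map_add, LinearMap.add_apply, h2, h4]
  cov := tensorProd_cov A B
  locality k l x hx y hy := by
    refine tensor_part_induction A.toSuperSpace B.toSuperSpace
      (p := fun x => IsLocal (koszul k l) (fun n => tensorProd A B n x)
        (fun n => tensorProd A B n y)) ?_ ?_ ?_ hx
    · rintro i j rfl a ha b hb
      refine IsLocal.symm (koszul_mul_self _ _) ?_
      refine tensor_part_induction A.toSuperSpace B.toSuperSpace
        (p := fun y => IsLocal (koszul (i + j) l) (fun n => tensorProd A B n y)
          (fun n => tensorProd A B n (a ⊗ₜ b))) ?_ ?_ ?_ hy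
      · rintro i' j' rfl a' ha' b' hb'
        simp only [tensorProd_tmul]
        exact (isLocal_tensorMode A B ha hb ha' hb').symm (koszul_mul_self _ _)
      · simp only [map_zero]; exact IsLocal.zero_left _ _
      · intro x y hx hy
        simp only [map_add]; exact hx.add_left hy
    · simp only [map_zero]; exact IsLocal.zero_left _ _
    · intro x y hx hy
      simp only [map_add]; exact hx.add_left hy

end VertexAlgebra

end Tensor

/-! ### Lie conformal superalgebras -/

section LieConformal

variable {R : Type*} [AddCommGroup R] [Module ℂ R]

/-- A Lie conformal superalgebra. Here `T` gives the `ℂ[T]`-module structure and `prod n a b` is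
the coefficient `a_{(n)} b` in the `λ`-bracket `[a_λ b] = ∑_{n ≥ 0} (λ^n / n!) a_{(n)} b`, which is
a polynomial in `λ`. The axioms are sesquilinearity, skewsymmetry and the Jacobi identity,
written coefficient by coefficient. -/
structure LieConformalSuperalgebra (R : Type*) [AddCommGroup R] [Module ℂ R] extends
    SuperSpace R where
  T : R →ₗ[ℂ] R
  prod : ℕ → R →ₗ[ℂ] R →ₗ[ℂ] R
  par_T : ∀ a, par (T a) = T (par a)
  par_prod : ∀ n a b, par (prod n a b) = prod n (par a) (par b)
  bounded : ∀ a b, ∃ N, ∀ n ≥ N, prod n a b = 0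
  /-- `[T a_λ b] = -λ [a_λ b]`. -/
  sesq_left : ∀ n a b, prod n (T a) b = -(n : ℂ) • prod (n - 1) a b
  /-- `T [a_λ b] = [T a_λ b] + [a_λ T b]`. -/
  sesq_right : ∀ n a b, T (prod n a b) = prod n (T a) b + prod n a (T b)
  /-- `[b_λ a] = -p(a,b) [a_{-λ-T} b]`; the sum runs up to any bound beyond which `a_{(n)} b`
  vanishes. -/
  skew : ∀ i j, ∀ a ∈ toSuperSpace.part i, ∀ b ∈ toSuperSpace.part j, ∀ n N,
    (∀ m ≥ N, prod m a b = 0) → prod n b a = -koszul i j • ∑ s ∈ Finset.range N,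
      ((-1 : ℂ) ^ (n + s) / (s.factorial : ℂ)) • (T ^ s) (prod (n + s) a b)
  /-- `[a_λ [b_μ c]] - p(a,b) [b_μ [a_λ c]] = [[a_λ b]_{λ+μ} c]`. -/
  jacobi : ∀ i j, ∀ a ∈ toSuperSpace.part i, ∀ b ∈ toSuperSpace.part j, ∀ c m n,
    prod m a (prod n b c) - koszul i j • prod n b (prod m a c) =
      ∑ s ∈ Finset.range (m + 1), (m.choose s : ℂ) • prod (m + n - s) (prod s a b) c

/-- A homomorphism of Lie conformal superalgebras from `L` to a vertex algebra `A`, the latter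
being equipped with the `λ`-bracket `[a_λ b] = ∑_{n ≥ 0} (λ^n / n!) a_{(n)} b` and its
translation operator. -/
structure LieConformalSuperalgebra.HomToVA (L : LieConformalSuperalgebra R) {V : Type*}
    [AddCommGroup V] [Module ℂ V] (A : VertexAlgebra V) extends R →ₗ[ℂ] V where
  map_par : ∀ a, toFun (L.par a) = A.par (toFun a)
  map_T : ∀ a, toFun (L.T a) = A.T (toFun a)
  map_prod : ∀ (n : ℕ) a b, toFun (L.prod n a b) = A.prod n (toFun a) (toFun b)

/-- The direct sum of two Lie conformal superalgebras. -/
def LieConformalSuperalgebra.directSum (L : LieConformalSuperalgebra R) {R' : Type*}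
    [AddCommGroup R'] [Module ℂ R'] (L' : LieConformalSuperalgebra R') :
    LieConformalSuperalgebra (R × R') where
  par := L.par.prodMap L'.par
  par_par v := by simp [L.par_par, L'.par_par]
  T := L.T.prodMap L'.T
  prod n := LinearMap.mk₂ ℂ (fun a b => (L.prod n a.1 b.1, L'.prod n a.2 b.2))
    (fun a b c => by simp) (fun c a b => by simp) (fun a b c => by simp) (fun c a b => by simp)
  par_T a := by simp [L.par_T, L'.par_T]
  par_prod n a b := by simp [L.par_prod, L'.par_prod]
  bounded a b := by
    obtain ⟨N, hN⟩ := L.bounded a.1 b.1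
    obtain ⟨M, hM⟩ := L'.bounded a.2 b.2
    refine ⟨max N M, fun n hn => ?_⟩
    simp only [LinearMap.mk₂_apply]
    rw [hN n (by omega), hM n (by omega)]; rfl
  sesq_left n a b := by
    simp [L.sesq_left, L'.sesq_left]
  sesq_right n a b := by
    simp [L.sesq_right, L'.sesq_right]
  skew i j a ha b hb n N hN := by
    have ha1 : a.1 ∈ L.part i := congrArg Prod.fst ha
    have ha2 : a.2 ∈ L'.part i := congrArg Prod.snd ha
    have hb1 : b.1 ∈ L.part j := congrArg Prod.fst hb
    have hb2 : b.2 ∈ L'.part j := congrArg Prod.snd hb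
    have hT : ∀ (s : ℕ) (x : R × R'), ((L.T.prodMap L'.T) ^ s) x = ((L.T ^ s) x.1, (L'.T ^ s) x.2) := by
      intro s
      induction s with
      | zero => intro x; rfl
      | succ k ih =>
        intro x
        rw [pow_succ, pow_succ, pow_succ, Module.End.mul_apply, Module.End.mul_apply,
          Module.End.mul_apply, ih]; rfl
    have e1 := L.skew i j a.1 ha1 b.1 hb1 n N (fun m hm => congrArg Prod.fst (hN m hm))
    have e2 := L'.skew i j a.2 ha2 b.2 hb2 n N (fun m hm => congrArg Prod.snd (hN m hm))
    simp only [LinearMap.mk₂_apply, hT]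
    refine Prod.ext ?_ ?_
    · simpa [Prod.fst_sum] using e1
    · simpa [Prod.snd_sum] using e2
  jacobi i j a ha b hb c m n := by
    have ha1 : a.1 ∈ L.part i := congrArg Prod.fst ha
    have ha2 : a.2 ∈ L'.part i := congrArg Prod.snd ha
    have hb1 : b.1 ∈ L.part j := congrArg Prod.fst hb
    have hb2 : b.2 ∈ L'.part j := congrArg Prod.snd hb
    have e1 := L.jacobi i j a.1 ha1 b.1 hb1 c.1 m n
    have e2 := L'.jacobi i j a.2 ha2 b.2 hb2 c.2 m n
    simp only [LinearMap.mk₂_apply]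
    refine Prod.ext ?_ ?_
    · simpa [Prod.fst_sum] using e1
    · simpa [Prod.snd_sum] using e2

end LieConformal

/-! ### The universal enveloping vertex algebra -/

section Envelope

variable {R : Type*} [AddCommGroup R] [Module ℂ R]

namespace LieConformalSuperalgebra

/-- The defining relations of the algebra of modes `a_{(n)}`, `a ∈ R`, `n ∈ ℤ`: linearity in `a`,
`(T a)_{(n)} = -n a_{(n-1)}` and the supercommutators
`[a_{(m)}, b_{(n)}] = ∑_{s ≥ 0} (m choose s) (a_{(s)} b)_{(m+n-s)}`. -/
inductive ModeRel (L : LieConformalSuperalgebra R) :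
    FreeAlgebra ℂ (R × ℤ) → FreeAlgebra ℂ (R × ℤ) → Prop
  | add (a b : R) (n : ℤ) : ModeRel L (FreeAlgebra.ι ℂ (a + b, n))
      (FreeAlgebra.ι ℂ (a, n) + FreeAlgebra.ι ℂ (b, n))
  | smul (c : ℂ) (a : R) (n : ℤ) : ModeRel L (FreeAlgebra.ι ℂ (c • a, n))
      (c • FreeAlgebra.ι ℂ (a, n))
  | trans (a : R) (n : ℤ) : ModeRel L (FreeAlgebra.ι ℂ (L.T a, n))
      (-(n : ℂ) • FreeAlgebra.ι ℂ (a, n - 1))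
  | comm (i j : ZMod 2) (a b : R) (ha : a ∈ L.part i) (hb : b ∈ L.part j) (N : ℕ)
      (hN : ∀ s ≥ N, L.prod s a b = 0) (m n : ℤ) :
      ModeRel L (FreeAlgebra.ι ℂ (a, m) * FreeAlgebra.ι ℂ (b, n))
        (koszul i j • (FreeAlgebra.ι ℂ (b, n) * FreeAlgebra.ι ℂ (a, m)) +
          ∑ s ∈ Finset.range N, ((Ring.choose m s : ℤ) : ℂ) •
            FreeAlgebra.ι ℂ (L.prod s a b, m + n - s))

variable (L : LieConformalSuperalgebra R)

/-- The associative algebra of modes: the universal enveloping algebra of the Lie superalgebra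
spanned by the modes `a_{(n)}`. -/
def ModeAlg : Type _ := RingQuot L.ModeRel

noncomputable instance : Ring L.ModeAlg := inferInstanceAs (Ring (RingQuot L.ModeRel))
noncomputable instance : Algebra ℂ L.ModeAlg := inferInstanceAs (Algebra ℂ (RingQuot L.ModeRel))

/-- The mode `a_{(n)}`. -/
noncomputable def mode (a : R) (n : ℤ) : L.ModeAlg :=
  RingQuot.mkAlgHom ℂ L.ModeRel (FreeAlgebra.ι ℂ (a, n))

theorem mode_add (a b : R) (n : ℤ) : L.mode (a + b) n = L.mode a n + L.mode b n :=
  (RingQuot.mkAlgHom_rel ℂ (ModeRel.add (L := L) a b n)).trans (map_add _ _ _)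

theorem mode_smul (c : ℂ) (a : R) (n : ℤ) : L.mode (c • a) n = c • L.mode a n :=
  (RingQuot.mkAlgHom_rel ℂ (ModeRel.smul (L := L) c a n)).trans (map_smul _ _ _)

theorem mode_T (a : R) (n : ℤ) : L.mode (L.T a) n = -(n : ℂ) • L.mode a (n - 1) :=
  (RingQuot.mkAlgHom_rel ℂ (ModeRel.trans (L := L) a n)).trans (map_smul _ _ _)

theorem mode_comm {i j : ZMod 2} {a b : R} (ha : a ∈ L.part i) (hb : b ∈ L.part j) {N : ℕ}
    (hN : ∀ s ≥ N, L.prod s a b = 0) (m n : ℤ) : L.mode a m * L.mode b n =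
      koszul i j • (L.mode b n * L.mode a m) + ∑ s ∈ Finset.range N,
        ((Ring.choose m s : ℤ) : ℂ) • L.mode (L.prod s a b) (m + n - s) := by
  have h := RingQuot.mkAlgHom_rel ℂ (ModeRel.comm (L := L) i j a b ha hb N hN m n)
  simp only [map_add, map_smul, map_mul, map_sum] at h
  exact h

/-- The universal property of the algebra of modes. -/
noncomputable def modeLift {S : Type*} [Ring S] [Algebra ℂ S] (f : R → ℤ → S)
    (hadd : ∀ a b n, f (a + b) n = f a n + f b n) (hsmul : ∀ (c : ℂ) a n, f (c • a) n = c • f a n)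
    (htrans : ∀ a n, f (L.T a) n = -(n : ℂ) • f a (n - 1))
    (hcomm : ∀ i j a b, a ∈ L.part i → b ∈ L.part j → ∀ N, (∀ s ≥ N, L.prod s a b = 0) →
      ∀ m n : ℤ, f a m * f b n = koszul i j • (f b n * f a m) + ∑ s ∈ Finset.range N,
        ((Ring.choose m s : ℤ) : ℂ) • f (L.prod s a b) (m + n - s)) : L.ModeAlg →ₐ[ℂ] S :=
  RingQuot.liftAlgHom ℂ ⟨FreeAlgebra.lift ℂ (fun p : R × ℤ => f p.1 p.2), by
    intro x y h
    induction h with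
    | add a b n => simpa using hadd a b n
    | smul c a n => simpa using hsmul c a n
    | trans a n => simpa using htrans a n
    | comm i j a b ha hb N hN m n => simpa using hcomm i j a b ha hb N hN m n⟩

theorem modeLift_mode {S : Type*} [Ring S] [Algebra ℂ S] (f : R → ℤ → S) (h₁ h₂ h₃ h₄)
    (a : R) (n : ℤ) : L.modeLift f h₁ h₂ h₃ h₄ (L.mode a n) = f a n := by
  exact (RingQuot.liftAlgHom_mkAlgHom_apply ℂ _ _ _).trans (FreeAlgebra.lift_ι_apply _ _)

theorem mode_induction {p : L.ModeAlg → Prop} (h1 : ∀ c : ℂ, p (algebraMap ℂ _ c))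
    (hm : ∀ a n, p (L.mode a n)) (hadd : ∀ x y, p x → p y → p (x + y))
    (hmul : ∀ x y, p x → p y → p (x * y)) (u : L.ModeAlg) : p u := by
  obtain ⟨x, rfl⟩ := RingQuot.mkAlgHom_surjective ℂ L.ModeRel u
  induction x using FreeAlgebra.induction with
  | grade0 c => rw [AlgHom.commutes]; exact h1 c
  | grade1 x => exact hm x.1 x.2
  | mul a b ha hb => rw [map_mul]; exact hmul _ _ ha hb
  | add a b ha hb => rw [map_add]; exact hadd _ _ ha hb

theorem choose_deriv (m : ℤ) (s : ℕ) :
    m * Ring.choose (m - 1) s = (m - s) * Ring.choose m s := by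
  have h1 := Ring.descPochhammer_eq_factorial_smul_choose (m - 1) s
  have h2 := Ring.descPochhammer_eq_factorial_smul_choose m s
  have h3 : ((descPochhammer ℤ (s + 1)).smeval m : ℤ) = m * (descPochhammer ℤ s).smeval (m - 1) := by
    simp only [← Polynomial.aeval_eq_smeval, descPochhammer_succ_left]
    simp
  have h4 : ((descPochhammer ℤ (s + 1)).smeval m : ℤ) = (descPochhammer ℤ s).smeval m * (m - s) := by
    simp only [← Polynomial.aeval_eq_smeval, descPochhammer_succ_right]
    simp
  rw [h4, h1, h2] at h3
  have : ((s.factorial : ℕ) : ℤ) ≠ 0 := by exact_mod_cast s.factorial_ne_zero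
  apply mul_left_cancel₀ this
  simp only [nsmul_eq_mul] at h3
  linear_combination -h3

/-- The left ideal generated by the annihilation modes `a_{(n)}`, `n ≥ 0`. -/
noncomputable def annih : Submodule ℂ L.ModeAlg :=
  Submodule.span ℂ {x | ∃ (u : L.ModeAlg) (a : R) (n : ℤ), 0 ≤ n ∧ x = u * L.mode a n}

/-- The underlying space of the universal enveloping vertex algebra `V(R)`: the module over the
algebra of modes induced from the trivial one-dimensional module of the annihilation modes. -/
def Env : Type _ := L.ModeAlg ⧸ L.annih

noncomputable instance : AddCommGroup L.Env := inferInstanceAs (AddCommGroup (L.ModeAlg ⧸ L.annih))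
noncomputable instance : Module ℂ L.Env := inferInstanceAs (Module ℂ (L.ModeAlg ⧸ L.annih))

namespace Env

/-- The projection of the algebra of modes onto `V(R)`. -/
noncomputable def mk : L.ModeAlg →ₗ[ℂ] L.Env := L.annih.mkQ

theorem mk_surjective : Function.Surjective (mk L) := L.annih.mkQ_surjective

theorem mk_eq_zero {u : L.ModeAlg} (h : u ∈ L.annih) : mk L u = 0 :=
  (Submodule.Quotient.mk_eq_zero _).2 h

/-- A linear map of the algebra of modes which preserves the left ideal of annihilation modes
induces a linear map of `V(R)`. -/
noncomputable def map (f : L.ModeAlg →ₗ[ℂ] L.ModeAlg)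
    (h : ∀ u a n, 0 ≤ n → f (u * L.mode a n) ∈ L.annih) : L.Env →ₗ[ℂ] L.Env :=
  L.annih.mapQ L.annih f (by
    rw [annih, Submodule.span_le]
    rintro _ ⟨u, a, n, hn, rfl⟩
    exact h u a n hn)

theorem map_mk (f : L.ModeAlg →ₗ[ℂ] L.ModeAlg) (h) (u : L.ModeAlg) :
    map L f h (mk L u) = mk L (f u) := rfl

theorem mul_mode_mem (u : L.ModeAlg) (a : R) {n : ℤ} (hn : 0 ≤ n) : u * L.mode a n ∈ L.annih :=
  Submodule.subset_span ⟨u, a, n, hn, rfl⟩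

/-- The action of the algebra of modes on `V(R)`. -/
noncomputable def act (u : L.ModeAlg) : L.Env →ₗ[ℂ] L.Env :=
  map L (LinearMap.mulLeft ℂ u) (fun v a n hn => by
    rw [LinearMap.mulLeft_apply, ← mul_assoc]; exact mul_mode_mem L _ a hn)

theorem act_mk (u v : L.ModeAlg) : act L u (mk L v) = mk L (u * v) := rfl

theorem act_mul (u v : L.ModeAlg) (x : L.Env) : act L (u * v) x = act L u (act L v x) := by
  obtain ⟨x, rfl⟩ := mk_surjective L x
  simp only [act_mk, mul_assoc]

theorem act_add (u v : L.ModeAlg) : act L (u + v) = act L u + act L v := by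
  refine LinearMap.ext fun x => ?_
  obtain ⟨x, rfl⟩ := mk_surjective L x
  simp only [act_mk, add_mul, map_add, LinearMap.add_apply]

theorem act_smul (c : ℂ) (u : L.ModeAlg) : act L (c • u) = c • act L u := by
  refine LinearMap.ext fun x => ?_
  obtain ⟨x, rfl⟩ := mk_surjective L x
  simp only [act_mk, smul_mul_assoc, map_smul, LinearMap.smul_apply]

/-- `act` as a linear map. -/
noncomputable def actₗ : L.ModeAlg →ₗ[ℂ] L.Env →ₗ[ℂ] L.Env where
  toFun := act L
  map_add' := act_add L
  map_smul' := act_smul L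

/-- The vacuum vector. -/
noncomputable def vac : L.Env := mk L 1

/-- The generating fields `Y(a,z)`, `a ∈ R`. -/
noncomputable def gen (a : R) (n : ℤ) : L.Env →ₗ[ℂ] L.Env := act L (L.mode a n)

theorem gen_add (a b : R) (n : ℤ) : gen L (a + b) n = gen L a n + gen L b n := by
  rw [gen, mode_add, act_add]; rfl

theorem gen_smul (c : ℂ) (a : R) (n : ℤ) : gen L (c • a) n = c • gen L a n := by
  rw [gen, mode_smul, act_smul]; rfl

theorem gen_T (a : R) (n : ℤ) : gen L (L.T a) n = -(n : ℂ) • gen L a (n - 1) := by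
  rw [gen, mode_T, act_smul]; rfl

theorem gen_vac (a : R) (n : ℤ) (hn : n ≥ 0) : gen L a n (vac L) = 0 := by
  rw [gen, vac, act_mk, mul_one, ← one_mul (L.mode a n)]
  exact mk_eq_zero L (mul_mode_mem L 1 a hn)

theorem gen_comm {i j : ZMod 2} {a b : R} (ha : a ∈ L.part i) (hb : b ∈ L.part j) {N : ℕ}
    (hN : ∀ s ≥ N, L.prod s a b = 0) (m n : ℤ) (x : L.Env) : gen L a m (gen L b n x) =
      koszul i j • gen L b n (gen L a m x) + ∑ s ∈ Finset.range N,
        ((Ring.choose m s : ℤ) : ℂ) • gen L (L.prod s a b) (m + n - s) x := by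
  rw [gen, gen, ← act_mul, ← act_mul, L.mode_comm ha hb hN]
  change actₗ L _ x = _
  rw [map_add, map_smul, map_sum, LinearMap.add_apply, LinearMap.sum_apply]
  simp only [map_smul, LinearMap.smul_apply]
  rfl

theorem gen_bilin_induction (p : R → Prop) (h : ∀ i, ∀ a ∈ L.part i, p a)
    (hadd : ∀ a b, p a → p b → p (a + b)) (a : R) : p a :=
  L.toSuperSpace.hom_induction h hadd a

theorem gen_neg (a : R) (k : ℕ) :
    gen L a (-1 - k) = ((k.factorial : ℂ))⁻¹ • gen L ((L.T ^ k) a) (-1) := by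
  induction k generalizing a with
  | zero => simp
  | succ k ih =>
    have h1 := ih (L.T a)
    rw [gen_T] at h1
    rw [pow_succ, Module.End.mul_apply, Nat.factorial_succ, Nat.cast_mul, mul_inv, mul_comm,
      mul_comm, mul_smul, ← h1, smul_smul]
    have : (((k + 1 : ℕ) : ℂ))⁻¹ * -((-1 - (k : ℤ) : ℤ) : ℂ) = 1 := by
      have : ((k : ℂ) + 1) ≠ 0 := by exact_mod_cast Nat.succ_ne_zero k
      push_cast
      field_simp
      ring
    rw [this, one_smul]
    congr 1
    push_cast; ring

/-- `V(R)` is spanned by the vectors `a¹_{(-1)} ⋯ aˢ_{(-1)} |0⟩`. -/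
theorem cyclic (S : Submodule ℂ L.Env) (h0 : vac L ∈ S)
    (hS : ∀ i, ∀ a ∈ L.part i, ∀ v ∈ S, gen L a (-1) v ∈ S) (v : L.Env) : v ∈ S := by
  have h1 : ∀ a, ∀ v ∈ S, gen L a (-1) v ∈ S := by
    intro a
    refine L.toSuperSpace.hom_induction (p := fun a => ∀ v ∈ S, gen L a (-1) v ∈ S) hS ?_ a
    intro a b ha hb v hv
    rw [gen_add]; exact S.add_mem (ha v hv) (hb v hv)
  have h2 : ∀ a (n : ℤ), n < 0 → ∀ v ∈ S, gen L a n v ∈ S := by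
    intro a n hn v hv
    obtain ⟨k, rfl⟩ : ∃ k : ℕ, n = -1 - k := ⟨(-1 - n).toNat, by omega⟩
    rw [gen_neg]
    exact S.smul_mem _ (h1 _ v hv)
  -- the smallest such subspace
  set Q : Submodule ℂ L.Env := sInf {Q | vac L ∈ Q ∧ ∀ a, ∀ n : ℤ, n < 0 → ∀ v ∈ Q,
    gen L a n v ∈ Q} with hQ
  have q0 : vac L ∈ Q := by
    rw [hQ, Submodule.mem_sInf]; exact fun P hP => hP.1
  have q1 : ∀ a, ∀ n : ℤ, n < 0 → ∀ v ∈ Q, gen L a n v ∈ Q := by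
    intro a n hn v hv
    rw [hQ, Submodule.mem_sInf] at *
    exact fun P hP => hP.2 a n hn v (hv P hP)
  have qS : Q ≤ S := sInf_le ⟨h0, h2⟩
  -- it is stable under all modes
  let P : Submodule ℂ L.Env :=
    { carrier := {v | v ∈ Q ∧ ∀ a (n : ℤ), gen L a n v ∈ Q}
      add_mem' := fun {v w} hv hw => ⟨Q.add_mem hv.1 hw.1, fun a n => by
        rw [map_add]; exact Q.add_mem (hv.2 a n) (hw.2 a n)⟩
      zero_mem' := ⟨Q.zero_mem, fun a n => by rw [map_zero]; exact Q.zero_mem⟩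
      smul_mem' := fun c v hv => ⟨Q.smul_mem c hv.1, fun a n => by
        rw [map_smul]; exact Q.smul_mem c (hv.2 a n)⟩ }
  have hP : Q ≤ P := by
    refine sInf_le ⟨⟨q0, fun a n => ?_⟩, fun b m hm v hv => ⟨q1 b m hm v hv.1, fun a n => ?_⟩⟩
    · rcases lt_or_ge n 0 with hn | hn
      · exact q1 a n hn _ q0
      · rw [gen_vac L a n hn]; exact Q.zero_mem
    · refine L.toSuperSpace.hom_induction (p := fun a => gen L a n (gen L b m v) ∈ Q) ?_ ?_ a
      · intro i a ha
        refine L.toSuperSpace.hom_induction (p := fun b => gen L a n (gen L b m v) ∈ Q) ?_ ?_ b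
        · intro j b hb
          obtain ⟨N, hN⟩ := L.bounded a b
          rw [gen_comm L ha hb hN]
          refine Q.add_mem (Q.smul_mem _ (q1 b m hm _ (hv.2 a n))) (Q.sum_mem fun s _ => ?_)
          exact Q.smul_mem _ (hv.2 _ _)
        · intro b b' hb hb'
          rw [gen_add, LinearMap.add_apply, map_add]; exact Q.add_mem hb hb'
      · intro a a' ha ha'
        rw [gen_add, LinearMap.add_apply]; exact Q.add_mem ha ha'
  have q2 : ∀ u : L.ModeAlg, ∀ v ∈ Q, act L u v ∈ Q := by
    intro u
    refine L.mode_induction (p := fun u => ∀ v ∈ Q, act L u v ∈ Q) ?_ ?_ ?_ ?_ u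
    · intro c v hv
      rw [Algebra.algebraMap_eq_smul_one, act_smul, LinearMap.smul_apply]
      obtain ⟨w, rfl⟩ := mk_surjective L v
      rw [act_mk, one_mul]
      exact Q.smul_mem c hv
    · exact fun a n v hv => (hP hv).2 a n
    · intro x y hx hy v hv
      rw [act_add]; exact Q.add_mem (hx v hv) (hy v hv)
    · intro x y hx hy v hv
      rw [act_mul]; exact hx _ (hy v hv)
  obtain ⟨u, rfl⟩ := mk_surjective L v
  have := q2 u _ q0
  rw [vac, act_mk, mul_one] at this
  exact qS this

theorem gen_isField (a : R) : IsField (gen L a) := by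
  intro v
  let S : Submodule ℂ L.Env :=
    { carrier := {v | ∀ a, ∃ N : ℤ, ∀ n ≥ N, gen L a n v = 0}
      add_mem' := fun {v w} hv hw a => by
        obtain ⟨N, hN⟩ := hv a
        obtain ⟨M, hM⟩ := hw a
        refine ⟨max N M, fun n hn => ?_⟩
        rw [map_add, hN n (by omega), hM n (by omega), add_zero]
      zero_mem' := fun a => ⟨0, fun n _ => map_zero _⟩
      smul_mem' := fun c v hv a => by
        obtain ⟨N, hN⟩ := hv a
        refine ⟨N, fun n hn => ?_⟩
        rw [map_smul, hN n hn, smul_zero] }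
  refine cyclic L S ?_ ?_ v a
  · exact fun a => ⟨0, fun n hn => gen_vac L a n hn⟩
  · intro j b hb v hv a
    refine L.toSuperSpace.hom_induction
      (p := fun a => ∃ N : ℤ, ∀ n ≥ N, gen L a n (gen L b (-1) v) = 0) ?_ ?_ a
    · intro i a ha
      obtain ⟨K, hK⟩ := L.bounded a b
      obtain ⟨N, hN⟩ := hv a
      choose B hB using fun s : ℕ => hv (L.prod s a b)
      refine ⟨max N (∑ s ∈ Finset.range K, (|B s| + 1 + s)), fun n hn => ?_⟩
      rw [gen_comm L ha hb hK, hN n (by omega), map_zero, smul_zero, zero_add]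
      refine Finset.sum_eq_zero fun s hs => ?_
      have h1 : |B s| + 1 + s ≤ ∑ s ∈ Finset.range K, (|B s| + 1 + (s : ℤ)) :=
        Finset.single_le_sum (f := fun s : ℕ => |B s| + 1 + (s : ℤ)) (fun i _ => by positivity) hs
      have h2 := le_trans (le_max_right _ _) hn
      have h3 := le_abs_self (B s)
      rw [hB s _ (by linarith), smul_zero]
    · rintro a a' ⟨N, hN⟩ ⟨M, hM⟩
      refine ⟨max N M, fun n hn => ?_⟩
      rw [gen_add, LinearMap.add_apply, hN n (by omega), hM n (by omega), add_zero]

theorem gen_isLocal {i j : ZMod 2} {a b : R} (ha : a ∈ L.part i) (hb : b ∈ L.part j) :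
    IsLocal (koszul i j) (gen L a) (gen L b) := by
  obtain ⟨N, hN⟩ := L.bounded a b
  refine ⟨N, fun v => ?_⟩
  have e : (fun m n => gen L a m (gen L b n v) - koszul i j • gen L b n (gen L a m v)) =
      ∑ s ∈ Finset.range N, fun m n : ℤ =>
        ((Ring.choose m s : ℤ) : ℂ) • gen L (L.prod s a b) (m + n - s) v := by
    funext m n
    rw [gen_comm L ha hb hN, add_sub_cancel_left, Finset.sum_apply, Finset.sum_apply]
  have key : ∀ (K s : ℕ), s < K → ∀ h : ℤ → L.Env, (mulSub ^ K) (fun m n : ℤ =>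
      ((Ring.choose m s : ℤ) : ℂ) • h (m + n - s)) = 0 := by
    intro K
    induction K with
    | zero => intro s hs; omega
    | succ K ih =>
      intro s hs h
      rw [pow_succ, Module.End.mul_apply]
      cases s with
      | zero =>
        have : mulSub (fun m n : ℤ => ((Ring.choose m 0 : ℤ) : ℂ) • h (m + n - (0 : ℕ))) = 0 := by
          funext m n
          rw [mulSub_apply, Ring.choose_zero_right, Ring.choose_zero_right,
            show m + 1 + n = m + (n + 1) by ring, sub_self]; rfl
        rw [this, map_zero]
      | succ s =>
        have : mulSub (fun m n : ℤ => ((Ring.choose m (s + 1) : ℤ) : ℂ) •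
            h (m + n - ((s + 1 : ℕ) : ℤ))) =
            fun m n : ℤ => ((Ring.choose m s : ℤ) : ℂ) • h (m + n - s) := by
          funext m n
          rw [mulSub_apply, Ring.choose_succ_succ]
          push_cast
          rw [show m + 1 + n - (s + 1 : ℤ) = m + n - s by ring,
            show m + (n + 1) - (s + 1 : ℤ) = m + n - s by ring]
          module
        rw [this]
        exact ih s (by omega) h
  rw [e, map_sum]
  exact Finset.sum_eq_zero fun s hs =>
    key N s (Finset.mem_range.1 hs) (fun k => gen L (L.prod s a b) k v)

/-- The automorphism `a_{(n)} ↦ p(a)_{(n)}` of the algebra of modes, with `p` the parity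
involution. -/
noncomputable def parAlg : L.ModeAlg →ₐ[ℂ] L.ModeAlg :=
  L.modeLift (fun a n => L.mode (L.par a) n)
    (fun a b n => by rw [map_add, mode_add]) (fun c a n => by rw [map_smul, mode_smul])
    (fun a n => by rw [L.par_T, mode_T])
    (fun i j a b ha hb N hN m n => by
      have ha' : L.par a ∈ L.part i := by
        rw [SuperSpace.mem_part] at *; rw [ha, map_smul, ha]
      have hb' : L.par b ∈ L.part j := by
        rw [SuperSpace.mem_part] at *; rw [hb, map_smul, hb]
      simp only [L.par_prod]
      exact L.mode_comm ha' hb' (fun s hs => by rw [← L.par_prod, hN s hs, map_zero]) m n)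

theorem parAlg_mode (a : R) (n : ℤ) : parAlg L (L.mode a n) = L.mode (L.par a) n :=
  modeLift_mode _ _ _ _ _ _ _ _

/-- The parity involution of `V(R)`. -/
noncomputable def par : L.Env →ₗ[ℂ] L.Env :=
  map L (parAlg L).toLinearMap (fun u a n hn => by
    rw [AlgHom.toLinearMap_apply, map_mul, parAlg_mode]
    exact mul_mode_mem L _ _ hn)

theorem par_gen (a : R) (n : ℤ) (v : L.Env) : par L (gen L a n v) = gen L (L.par a) n (par L v) := by
  obtain ⟨v, rfl⟩ := mk_surjective L v
  rw [gen, act_mk, par, map_mk, map_mk, gen, act_mk, AlgHom.toLinearMap_apply, map_mul,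
    parAlg_mode]
  rfl

theorem par_vac : par L (vac L) = vac L := by
  rw [vac, par, map_mk, AlgHom.toLinearMap_apply, map_one]

theorem par_par (v : L.Env) : par L (par L v) = v := by
  have h : v ∈ LinearMap.ker (par L ∘ₗ par L - LinearMap.id) := by
    refine cyclic L _ ?_ ?_ v
    · rw [LinearMap.mem_ker, LinearMap.sub_apply, LinearMap.comp_apply, par_vac, par_vac]
      exact sub_self _
    · intro i a ha v hv
      rw [LinearMap.mem_ker, LinearMap.sub_apply, sub_eq_zero, LinearMap.comp_apply] at *
      rw [par_gen, par_gen, L.par_par, hv]; rfl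
  rw [LinearMap.mem_ker, LinearMap.sub_apply, sub_eq_zero, LinearMap.comp_apply] at h
  exact h

/-- The superspace structure of `V(R)`. -/
noncomputable def superSpace : SuperSpace L.Env where
  par := par L
  par_par := par_par L

theorem T_comm (a b : R) {i j : ZMod 2} (ha : a ∈ L.part i) (hb : b ∈ L.part j) (N : ℕ)
    (hN : ∀ s ≥ N, L.prod s a b = 0) (m n : ℤ) :
    L.mode a m * (-(n : ℂ) • L.mode b (n - 1)) + (-(m : ℂ) • L.mode a (m - 1)) * L.mode b n =
      koszul i j • (L.mode b n * (-(m : ℂ) • L.mode a (m - 1)) +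
        (-(n : ℂ) • L.mode b (n - 1)) * L.mode a m) + ∑ s ∈ Finset.range N,
        ((Ring.choose m s : ℤ) : ℂ) • (-((m + n - s : ℤ) : ℂ) •
          L.mode (L.prod s a b) (m + n - s - 1)) := by
  have e : ∑ s ∈ Finset.range N, ((Ring.choose m s : ℤ) : ℂ) • (-((m + n - s : ℤ) : ℂ) •
      L.mode (L.prod s a b) (m + n - s - 1)) =
      -(n : ℂ) • (∑ s ∈ Finset.range N, ((Ring.choose m s : ℤ) : ℂ) •
        L.mode (L.prod s a b) (m + (n - 1) - s)) +
      -(m : ℂ) • (∑ s ∈ Finset.range N, ((Ring.choose (m - 1) s : ℤ) : ℂ) •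
        L.mode (L.prod s a b) (m - 1 + n - s)) := by
    rw [Finset.smul_sum, Finset.smul_sum, ← Finset.sum_add_distrib]
    refine Finset.sum_congr rfl fun s _ => ?_
    rw [show m + (n - 1) - (s : ℤ) = m + n - s - 1 by ring,
      show m - 1 + n - (s : ℤ) = m + n - s - 1 by ring, smul_smul, smul_smul, smul_smul, ← add_smul]
    congr 1
    have := congrArg (fun z : ℤ => (z : ℂ)) (choose_deriv m s)
    push_cast at this ⊢
    linear_combination this
  rw [e, mul_smul_comm, smul_mul_assoc, mul_smul_comm, smul_mul_assoc,
    L.mode_comm ha hb hN m (n - 1), L.mode_comm ha hb hN (m - 1) n]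
  module

/-- The algebra homomorphism `u ↦ u + ε T(u)` into the dual numbers which corresponds to the
derivation `T` of the algebra of modes with `T(a_{(n)}) = -n a_{(n-1)}`. -/
noncomputable def derAlg : L.ModeAlg →ₐ[ℂ] TrivSqZeroExt L.ModeAlg L.ModeAlg :=
  L.modeLift (fun a n => TrivSqZeroExt.inl (L.mode a n) +
      TrivSqZeroExt.inr (-(n : ℂ) • L.mode a (n - 1)))
    (fun a b n => by
      ext
      · simp [mode_add]
      · simp [mode_add])
    (fun c a n => by
      ext
      · simp [mode_smul]
      · simp [mode_smul, smul_comm c])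
    (fun a n => by
      ext
      · simp [mode_T]
      · simp [mode_T])
    (fun i j a b ha hb N hN m n => by
      ext
      · simp [TrivSqZeroExt.fst_sum, L.mode_comm ha hb hN]
      · have := T_comm L a b ha hb N hN m n
        simp only [TrivSqZeroExt.snd_mul, TrivSqZeroExt.snd_add, TrivSqZeroExt.snd_inl,
          TrivSqZeroExt.snd_inr, TrivSqZeroExt.fst_add, TrivSqZeroExt.fst_inl,
          TrivSqZeroExt.fst_inr, TrivSqZeroExt.snd_smul, TrivSqZeroExt.snd_sum, zero_add, add_zero,
          smul_eq_mul, MulOpposite.smul_eq_mul_unop, MulOpposite.unop_op]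
        exact this)

/-- The derivation `T` of the algebra of modes. -/
noncomputable def derT : L.ModeAlg →ₗ[ℂ] L.ModeAlg where
  toFun u := (derAlg L u).snd
  map_add' u v := by rw [map_add, TrivSqZeroExt.snd_add]
  map_smul' c u := by rw [map_smul, TrivSqZeroExt.snd_smul]; rfl

theorem derAlg_fst (u : L.ModeAlg) : (derAlg L u).fst = u := by
  refine L.mode_induction (p := fun u => (derAlg L u).fst = u) ?_ ?_ ?_ ?_ u
  · intro c; rw [AlgHom.commutes]; rfl
  · intro a n; rw [derAlg, modeLift_mode]; simp
  · intro x y hx hy; rw [map_add, TrivSqZeroExt.fst_add, hx, hy]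
  · intro x y hx hy; rw [map_mul, TrivSqZeroExt.fst_mul, hx, hy]

theorem derT_mul (u v : L.ModeAlg) : derT L (u * v) = u * derT L v + derT L u * v := by
  show (derAlg L (u * v)).snd = _
  rw [map_mul, TrivSqZeroExt.snd_mul, derAlg_fst, derAlg_fst]
  rfl

theorem derT_mode (a : R) (n : ℤ) : derT L (L.mode a n) = -(n : ℂ) • L.mode a (n - 1) := by
  show (derAlg L (L.mode a n)).snd = _
  rw [derAlg, modeLift_mode]; simp

/-- The translation operator of `V(R)`. -/
noncomputable def transl : L.Env →ₗ[ℂ] L.Env :=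
  map L (derT L) (fun u a n hn => by
    rw [derT_mul, derT_mode]
    refine L.annih.add_mem ?_ (mul_mode_mem L _ a hn)
    rw [mul_smul_comm]
    rcases hn.eq_or_lt with rfl | hn'
    · simp
    · exact L.annih.smul_mem _ (mul_mode_mem L _ a (by omega)))

theorem transl_vac : transl L (vac L) = 0 := by
  have h : derT L 1 = 0 := by
    have := derT_mul L 1 1
    simpa using this
  rw [transl, vac, map_mk, h, map_zero]

theorem gen_cov (a : R) : IsCov (transl L) (gen L a) := by
  intro n v
  obtain ⟨v, rfl⟩ := mk_surjective L v
  rw [gen, act_mk, transl, map_mk, map_mk, act_mk, derT_mul, derT_mode, map_add,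
    add_sub_cancel_left, gen, act_mk, smul_mul_assoc, map_smul]

/-- The fields obtained from the generating fields by taking linear combinations and normally
ordered products; the first index is the parity. -/
inductive Good : ZMod 2 → (ℤ → L.Env →ₗ[ℂ] L.Env) → Prop
  | one : Good 0 (fun n => if n = -1 then LinearMap.id else 0)
  | gen (i : ZMod 2) (a : R) (ha : a ∈ L.part i) : Good i (gen L a)
  | zero (i : ZMod 2) : Good i 0
  | add (i : ZMod 2) (f g : ℤ → L.Env →ₗ[ℂ] L.Env) : Good i f → Good i g → Good i (f + g)
  | smul (i : ZMod 2) (c : ℂ) (f : ℤ → L.Env →ₗ[ℂ] L.Env) : Good i f → Good i (c • f)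
  | nop (i j : ZMod 2) (a : R) (ha : a ∈ L.part i) (f : ℤ → L.Env →ₗ[ℂ] L.Env) (hf : IsField f) :
      Good j f → Good (i + j) (nop (koszul i j) (Env.gen L a) f (gen_isField L a) hf)

variable {L}

theorem Good.isField {i : ZMod 2} {f : ℤ → L.Env →ₗ[ℂ] L.Env} (h : Good L i f) : IsField f := by
  induction h with
  | one =>
    refine fun v => ⟨0, fun n hn => ?_⟩
    simp only [if_neg (show n ≠ -1 by omega)]; rfl
  | gen i a ha => exact gen_isField L a
  | zero i => exact fun v => ⟨0, fun n hn => rfl⟩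
  | add i f g _ _ hf hg =>
    intro v
    obtain ⟨N, hN⟩ := hf v
    obtain ⟨M, hM⟩ := hg v
    refine ⟨max N M, fun n hn => ?_⟩
    rw [Pi.add_apply, LinearMap.add_apply, hN n (by omega), hM n (by omega), add_zero]
  | smul i c f _ hf =>
    intro v
    obtain ⟨N, hN⟩ := hf v
    refine ⟨N, fun n hn => ?_⟩
    rw [Pi.smul_apply, LinearMap.smul_apply, hN n hn, smul_zero]
  | nop i j a ha f hf _ _ => exact IsField.nop _ hf

theorem Good.isCov {i : ZMod 2} {f : ℤ → L.Env →ₗ[ℂ] L.Env} (h : Good L i f) :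
    IsCov (transl L) f := by
  induction h with
  | one =>
    intro n v
    by_cases hn : n = -1
    · subst hn; simp
    · by_cases hn' : n = 0
      · subst hn'; simp
      · simp [hn, show n - 1 ≠ -1 by omega]
  | gen i a ha => exact gen_cov L a
  | zero i => intro n v; simp
  | add i f g _ _ hf hg =>
    intro n v
    have h1 := hf n v
    have h2 := hg n v
    simp only [Pi.add_apply, LinearMap.add_apply, map_add, smul_add, ← h1, ← h2]; abel
  | smul i c f _ hf =>
    intro n v
    have h1 := hf n v
    simp only [Pi.smul_apply, LinearMap.smul_apply, map_smul, smul_comm _ c, ← h1, smul_sub]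
  | nop i j a ha f hf _ h => exact IsCov.nop _ hf (gen_cov L a) h

theorem Good.vac {i : ZMod 2} {f : ℤ → L.Env →ₗ[ℂ] L.Env} (h : Good L i f) :
    ∀ n ≥ 0, f n (Env.vac L) = 0 := by
  induction h with
  | one => intro n hn; simp only [if_neg (show n ≠ -1 by omega)]; rfl
  | gen i a ha => exact gen_vac L a
  | zero i => exact fun n hn => rfl
  | add i f g _ _ hf hg =>
    intro n hn
    rw [Pi.add_apply, LinearMap.add_apply, hf n hn, hg n hn, add_zero]
  | smul i c f _ hf => intro n hn; rw [Pi.smul_apply, LinearMap.smul_apply, hf n hn, smul_zero]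
  | nop i j a ha f hf _ h => exact (nop_vac _ hf (gen_vac L a) h).1

theorem half_par {i j : ZMod 2} {f g : ℤ → L.Env →ₗ[ℂ] L.Env} (hg : IsField g)
    (hf' : ∀ n v, Env.par L (f n v) = sgn i • f n (Env.par L v))
    (hg' : ∀ n v, Env.par L (g n v) = sgn j • g n (Env.par L v)) (m n : ℤ) (v : L.Env) :
    Env.par L (half f g m n v) = sgn (i + j) • half f g m n (Env.par L v) := by
  obtain ⟨N, hN⟩ := hg v
  have hN' : ∀ k ≥ N, g k (Env.par L v) = 0 := by
    intro k hk
    have := hg' k v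
    rw [hN k hk, map_zero] at this
    have h2 := congrArg (fun x => sgn j • x) this.symm
    simpa only [smul_smul, sgn_mul_self, one_smul, smul_zero] using h2
  have hK : N ≤ n + ((N - n).toNat : ℤ) := by omega
  rw [half_eq_sum f m hN hK, half_eq_sum f m hN' hK, map_sum, Finset.smul_sum]
  refine Finset.sum_congr rfl fun k _ => ?_
  rw [hf', hg', map_smul, smul_smul, sgn_add]

theorem Good.par {i : ZMod 2} {f : ℤ → L.Env →ₗ[ℂ] L.Env} (h : Good L i f) :
    ∀ n v, Env.par L (f n v) = sgn i • f n (Env.par L v) := by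
  induction h with
  | one =>
    intro n v
    by_cases hn : n = -1
    · subst hn; simp [sgn]
    · simp [hn]
  | gen i a ha =>
    intro n v
    rw [par_gen, SuperSpace.mem_part.1 ha, gen_smul]; rfl
  | zero i => intro n v; simp
  | add i f g _ _ hf hg =>
    intro n v
    simp only [Pi.add_apply, LinearMap.add_apply, map_add, smul_add, hf, hg]
  | smul i c f _ hf =>
    intro n v
    simp only [Pi.smul_apply, LinearMap.smul_apply, map_smul, smul_comm _ c, hf]
  | nop i j a ha f hf _ h =>
    intro n v
    have hg : ∀ n v, Env.par L (Env.gen L a n v) = sgn i • Env.gen L a n (Env.par L v) := by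
      intro n v
      rw [par_gen, SuperSpace.mem_part.1 ha, gen_smul]; rfl
    rw [nop_apply, nop_apply, map_add, map_smul, half_par hf hg h,
      half_par (gen_isField L a) h hg, add_comm j i, smul_add, smul_comm (koszul i j)]

theorem isLocal_one_left (g : ℤ → L.Env →ₗ[ℂ] L.Env) :
    IsLocal 1 (fun n => if n = -1 then LinearMap.id else 0) g := by
  refine ⟨0, fun v => ?_⟩
  funext m n
  by_cases hm : m = -1
  · subst hm; simp
  · simp [hm]

theorem koszul_zero_left (j : ZMod 2) : koszul 0 j = 1 := by simp [koszul, sgn]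

theorem Good.isLocal_gen {i : ZMod 2} {f : ℤ → L.Env →ₗ[ℂ] L.Env} (h : Good L i f) :
    ∀ (j : ZMod 2) (b : R), b ∈ L.part j → IsLocal (koszul i j) f (Env.gen L b) := by
  induction h with
  | one => intro j b _; rw [koszul_zero_left]; exact isLocal_one_left _
  | gen i a ha => exact fun j b hb => gen_isLocal L ha hb
  | zero i => exact fun j b hb => IsLocal.zero_left _ _
  | add i f g _ _ hf hg => exact fun j b hb => (hf j b hb).add_left (hg j b hb)
  | smul i c f _ hf => exact fun j b hb => (hf j b hb).smul_left c
  | nop i k a ha f hf _ h =>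
    intro j b hb
    rw [koszul_add_left]
    refine IsLocal.nop _ hf ?_ (gen_isLocal L ha hb) (h j b hb)
    rw [koszul_comm]
    exact (h i a ha).symm (koszul_mul_self _ _)

theorem Good.isLocal {i j : ZMod 2} {f g : ℤ → L.Env →ₗ[ℂ] L.Env} (h : Good L i f)
    (hg : Good L j g) : IsLocal (koszul i j) f g := by
  induction h with
  | one => rw [koszul_zero_left]; exact isLocal_one_left _
  | gen i a ha =>
    rw [koszul_comm]; exact (hg.isLocal_gen i a ha).symm (koszul_mul_self _ _)
  | zero i => exact IsLocal.zero_left _ _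
  | add i f g _ _ hf hg => exact hf.add_left hg
  | smul i c f _ hf => exact hf.smul_left c
  | nop i k a ha f hf hG h =>
    rw [koszul_add_left]
    refine IsLocal.nop _ hf ?_ ?_ h
    · rw [koszul_comm]
      exact (hG.isLocal_gen i a ha).symm (koszul_mul_self _ _)
    · rw [koszul_comm]
      exact (hg.isLocal_gen i a ha).symm (koszul_mul_self _ _)

/-- Uniqueness of fields: a good field is determined by the state that it creates. -/
theorem Good.eq_zero {i : ZMod 2} {f : ℤ → L.Env →ₗ[ℂ] L.Env} (h : Good L i f)
    (h1 : f (-1) (Env.vac L) = 0) : f = 0 := by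
  have hneg : ∀ k : ℕ, f (-1 - k) (Env.vac L) = 0 := by
    intro k
    induction k with
    | zero => simpa using h1
    | succ k ih =>
      have := h.isCov (-1 - k) (Env.vac L)
      rw [ih, transl_vac, map_zero, map_zero, sub_zero] at this
      have hk : (-((-1 - k : ℤ) : ℂ)) ≠ 0 := by
        have : ((k : ℂ) + 1) ≠ 0 := by exact_mod_cast Nat.succ_ne_zero k
        push_cast
        intro h
        apply this
        linear_combination h
      rw [show (-1 - ((k + 1 : ℕ) : ℤ)) = -1 - k - 1 by push_cast; ring]
      exact (smul_eq_zero.1 this.symm).resolve_left hk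
  have hvac : ∀ n, f n (Env.vac L) = 0 := by
    intro n
    rcases lt_or_ge n 0 with hn | hn
    · obtain ⟨k, rfl⟩ : ∃ k : ℕ, n = -1 - k := ⟨(-1 - n).toNat, by omega⟩
      exact hneg k
    · exact h.vac n hn
  funext n
  refine LinearMap.ext fun v => ?_
  let S : Submodule ℂ L.Env := ⨅ n, LinearMap.ker (f n)
  have hS : v ∈ S := by
    refine cyclic L S ?_ ?_ v
    · rw [Submodule.mem_iInf]; exact hvac
    · intro j a ha v hv
      rw [Submodule.mem_iInf] at *
      intro n
      obtain ⟨N, hN⟩ := h.isLocal_gen j a ha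
      have h0 := hN v
      have e : (fun m n => f m (Env.gen L a n v) - koszul i j • Env.gen L a n (f m v)) =
          fun m n => f m (Env.gen L a n v) := by
        funext m n
        rw [LinearMap.mem_ker.1 (hv m), map_zero, smul_zero, sub_zero]
      rw [e] at h0
      obtain ⟨M, hM⟩ := gen_isField L a v
      have := eq_zero_of_mulSub_pow h0 (M := M) (fun n hn m => by rw [hM n hn, map_zero])
      exact congrFun (congrFun this n) (-1)
  rw [Submodule.mem_iInf] at hS
  exact hS n

/-- `f` is the field `Y(v, z)`: it is a combination of good fields and creates `v`. -/
def IsState (v : L.Env) (f : ℤ → L.Env →ₗ[ℂ] L.Env) : Prop :=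
  ∃ f₀ f₁, Good L 0 f₀ ∧ Good L 1 f₁ ∧ f = f₀ + f₁ ∧ f (-1) (Env.vac L) = v

theorem IsState.add {v w : L.Env} {f g : ℤ → L.Env →ₗ[ℂ] L.Env} (hf : IsState v f)
    (hg : IsState w g) : IsState (v + w) (f + g) := by
  obtain ⟨f₀, f₁, h0, h1, rfl, hv⟩ := hf
  obtain ⟨g₀, g₁, k0, k1, rfl, hw⟩ := hg
  refine ⟨f₀ + g₀, f₁ + g₁, h0.add _ _ _ k0, h1.add _ _ _ k1, by abel, ?_⟩
  rw [← hv, ← hw]; rfl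

theorem IsState.smul {v : L.Env} {f : ℤ → L.Env →ₗ[ℂ] L.Env} (c : ℂ) (hf : IsState v f) :
    IsState (c • v) (c • f) := by
  obtain ⟨f₀, f₁, h0, h1, rfl, hv⟩ := hf
  refine ⟨c • f₀, c • f₁, h0.smul _ c _, h1.smul _ c _, smul_add _ _ _, ?_⟩
  rw [← hv]; rfl

theorem Good.isState {i : ZMod 2} {f : ℤ → L.Env →ₗ[ℂ] L.Env} (h : Good L i f) :
    IsState (f (-1) (Env.vac L)) f := by
  have h2 : ∀ i : ZMod 2, i = 0 ∨ i = 1 := by decide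
  rcases h2 i with rfl | rfl
  · exact ⟨f, 0, h, Good.zero 1, (add_zero f).symm, rfl⟩
  · exact ⟨0, f, Good.zero 0, h, (zero_add f).symm, rfl⟩

theorem Good.state_mem {i : ZMod 2} {f : ℤ → L.Env →ₗ[ℂ] L.Env} (h : Good L i f) :
    f (-1) (Env.vac L) ∈ (superSpace L).part i := by
  rw [SuperSpace.mem_part]
  exact (h.par _ _).trans (by rw [par_vac])

theorem IsState.eq_zero {f : ℤ → L.Env →ₗ[ℂ] L.Env} (hf : IsState 0 f) : f = 0 := by
  obtain ⟨f₀, f₁, h0, h1, rfl, hv⟩ := hf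
  have hv' : f₀ (-1) (Env.vac L) + f₁ (-1) (Env.vac L) = 0 := hv
  have m0 := h0.state_mem
  have m1 := h1.state_mem
  have e : f₀ (-1) (Env.vac L) = 0 := by
    refine (Submodule.disjoint_def.1 (superSpace L).isCompl_part.disjoint) _ m0 ?_
    rw [eq_neg_of_add_eq_zero_left hv']
    exact Submodule.neg_mem _ m1
  have e' : f₁ (-1) (Env.vac L) = 0 := by rwa [e, zero_add] at hv'
  rw [h0.eq_zero e, h1.eq_zero e', add_zero]

theorem IsState.unique {v : L.Env} {f g : ℤ → L.Env →ₗ[ℂ] L.Env} (hf : IsState v f)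
    (hg : IsState v g) : f = g := by
  have h := hf.add (hg.smul (-1))
  rw [neg_one_smul, neg_one_smul, add_neg_cancel] at h
  exact add_neg_eq_zero.1 h.eq_zero

theorem exists_isState (v : L.Env) : ∃ f, IsState v f := by
  let S : Submodule ℂ L.Env :=
    { carrier := {v | ∃ f, IsState v f}
      add_mem' := fun {v w} ⟨f, hf⟩ ⟨g, hg⟩ => ⟨f + g, hf.add hg⟩
      zero_mem' := ⟨0, 0, 0, Good.zero 0, Good.zero 1, (add_zero _).symm, rfl⟩
      smul_mem' := fun c v ⟨f, hf⟩ => ⟨c • f, hf.smul c⟩ }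
  refine cyclic L S ?_ ?_ v
  · have := (Good.one (L := L)).isState
    rw [if_pos rfl] at this
    exact ⟨_, this⟩
  · rintro i a ha v ⟨f, f₀, f₁, h0, h1, rfl, hv⟩
    have k0 := Good.nop i 0 a ha f₀ h0.isField h0
    have k1 := Good.nop i 1 a ha f₁ h1.isField h1
    have := k0.isState.add k1.isState
    rw [(nop_vac _ h0.isField (gen_vac L a) h0.vac).2,
      (nop_vac _ h1.isField (gen_vac L a) h1.vac).2, ← map_add] at this
    rw [← hv]
    exact ⟨_, this⟩

variable (L)

/-- The state-field correspondence of `V(R)`: `field L v` is the family of modes of the unique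
good field that creates `v`. -/
noncomputable def field (v : L.Env) : ℤ → L.Env →ₗ[ℂ] L.Env := (exists_isState v).choose

theorem field_isState (v : L.Env) : IsState v (field L v) := (exists_isState v).choose_spec

theorem field_add (v w : L.Env) : field L (v + w) = field L v + field L w :=
  (field_isState L _).unique ((field_isState L v).add (field_isState L w))

theorem field_smul (c : ℂ) (v : L.Env) : field L (c • v) = c • field L v :=
  (field_isState L _).unique ((field_isState L v).smul c)

theorem field_good {i : ZMod 2} {v : L.Env} (hv : v ∈ (superSpace L).part i) :
    Good L i (field L v) := by
  obtain ⟨f₀, f₁, h0, h1, hf, h⟩ := field_isState L v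
  have m0 := h0.state_mem
  have m1 := h1.state_mem
  rw [hf] at h
  have h' : f₀ (-1) (Env.vac L) + f₁ (-1) (Env.vac L) = v := h
  have dis := Submodule.disjoint_def.1 (superSpace L).isCompl_part.disjoint
  have h2 : ∀ i : ZMod 2, i = 0 ∨ i = 1 := by decide
  rcases h2 i with rfl | rfl
  · have e : f₁ (-1) (Env.vac L) = 0 := by
      refine dis _ ?_ m1
      rw [eq_sub_of_add_eq' h']
      exact Submodule.sub_mem _ hv m0
    rw [hf, h1.eq_zero e, add_zero]; exact h0
  · have e : f₀ (-1) (Env.vac L) = 0 := by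
      refine dis _ m0 ?_
      rw [eq_sub_of_add_eq h']
      exact Submodule.sub_mem _ hv m1
    rw [hf, h0.eq_zero e, zero_add]; exact h1

theorem field_T (v : L.Env) : field L v (-2) (vac L) = transl L v := by
  obtain ⟨f₀, f₁, h0, h1, hf, h⟩ := field_isState L v
  have c0 := h0.isCov (-1) (vac L)
  have c1 := h1.isCov (-1) (vac L)
  rw [transl_vac, map_zero, sub_zero] at c0 c1
  simp only [Int.cast_neg, Int.cast_one, neg_neg, one_smul] at c0 c1
  rw [hf] at h ⊢
  rw [← h]
  show f₀ (-1 - 1) (vac L) + f₁ (-1 - 1) (vac L) = transl L (f₀ (-1) (vac L) + f₁ (-1) (vac L))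
  rw [map_add, c0, c1]

end Env

/-- The universal enveloping vertex algebra `V(R)` of a Lie conformal superalgebra. -/
noncomputable def envelope : VertexAlgebra L.Env where
  toSuperSpace := Env.superSpace L
  vac := Env.vac L
  prod n :=
    { toFun := fun v => Env.field L v n
      map_add' := fun v w => by rw [Env.field_add]; rfl
      map_smul' := fun c v => by rw [Env.field_smul]; rfl }
  par_vac := Env.par_vac L
  par_prod n a b := by
    obtain ⟨f₀, f₁, h0, h1, hf, h⟩ := Env.field_isState L a
    have hs : Env.IsState (Env.par L a) (f₀ + (-1 : ℂ) • f₁) := by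
      refine ⟨f₀, (-1 : ℂ) • f₁, h0, h1.smul _ _ _, rfl, ?_⟩
      rw [← h, hf]
      show f₀ (-1) (Env.vac L) + (-1 : ℂ) • f₁ (-1) (Env.vac L) =
        Env.par L (f₀ (-1) (Env.vac L) + f₁ (-1) (Env.vac L))
      rw [map_add, h0.par, h1.par, Env.par_vac]
      simp [sgn]
    show Env.par L (Env.field L a n b) = Env.field L (Env.par L a) n (Env.par L b)
    rw [(Env.field_isState L _).unique hs, hf]
    show Env.par L (f₀ n b + f₁ n b) = f₀ n (Env.par L b) + (-1 : ℂ) • f₁ n (Env.par L b)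
    rw [map_add, h0.par, h1.par]
    simp [sgn]
  isField a := by
    obtain ⟨f₀, f₁, h0, h1, hf, h⟩ := Env.field_isState L a
    show IsField (Env.field L a)
    rw [hf]
    intro v
    obtain ⟨N, hN⟩ := h0.isField v
    obtain ⟨M, hM⟩ := h1.isField v
    refine ⟨max N M, fun n hn => ?_⟩
    rw [Pi.add_apply, LinearMap.add_apply, hN n (by omega), hM n (by omega), add_zero]
  trans_vac := (Env.field_T L _).trans (Env.transl_vac L)
  creation a := by
    obtain ⟨f₀, f₁, h0, h1, hf, h⟩ := Env.field_isState L a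
    refine ⟨fun n hn => ?_, h⟩
    show Env.field L a n (Env.vac L) = 0
    rw [hf, Pi.add_apply, LinearMap.add_apply, h0.vac n hn, h1.vac n hn, add_zero]
  cov a := by
    obtain ⟨f₀, f₁, h0, h1, hf, h⟩ := Env.field_isState L a
    intro n v
    have e : ∀ w, Env.field L w (-2) (Env.vac L) = Env.transl L w := Env.field_T L
    show Env.field L (Env.field L a n v) (-2) (Env.vac L) -
      Env.field L a n (Env.field L v (-2) (Env.vac L)) = -(n : ℂ) • Env.field L a (n - 1) v
    rw [e, e, hf]
    have c0 := h0.isCov n v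
    have c1 := h1.isCov n v
    simp only [Pi.add_apply, LinearMap.add_apply, map_add, smul_add, ← c0, ← c1]
    abel
  locality i j a ha b hb := (Env.field_good L ha).isLocal (Env.field_good L hb)

/-- The canonical map `R → V(R)`, `a ↦ a_{(-1)} |0⟩`. -/
noncomputable def ι : R →ₗ[ℂ] L.Env where
  toFun a := Env.gen L a (-1) (Env.vac L)
  map_add' a b := by rw [Env.gen_add]; rfl
  map_smul' c a := by rw [Env.gen_smul]; rfl

/-- The modes of `Y(a, z)`, `a ∈ R`, act on `V(R)` by multiplication with the modes `a_{(n)}`. -/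
theorem envelope_prod_ι (a : R) (n : ℤ) : L.envelope.prod n (L.ι a) = Env.gen L a n := by
  have h : Env.IsState (L.ι a) (Env.gen L a) := by
    refine L.toSuperSpace.hom_induction (p := fun a => Env.IsState (L.ι a) (Env.gen L a)) ?_ ?_ a
    · exact fun i a ha => (Env.Good.gen i a ha).isState
    · intro a b ha hb
      rw [map_add, show Env.gen L (a + b) = Env.gen L a + Env.gen L b from
        funext fun n => Env.gen_add L a b n]
      exact ha.add hb
  exact congrFun ((Env.field_isState L _).unique h) n

end LieConformalSuperalgebra
end Envelope

/-! ### Lie conformal superalgebras of current type -/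

section Sesquilinear

variable {R : Type*} [AddCommGroup R] [Module ℂ R]

/-- Skewsymmetry of the `λ`-bracket of two elements, with the sum running up to any large bound. -/
def SkewAt (ε : ℂ) (T : R →ₗ[ℂ] R) (prod : ℕ → R →ₗ[ℂ] R →ₗ[ℂ] R) (a b : R) : Prop :=
  ∃ N₀, ∀ N ≥ N₀, ∀ n, prod n b a = -ε • ∑ s ∈ Finset.range N,
    ((-1 : ℂ) ^ (n + s) / (s.factorial : ℂ)) • (T ^ s) (prod (n + s) a b)

/-- The Jacobi identity for three elements. -/
def JacobiAt (ε : ℂ) (prod : ℕ → R →ₗ[ℂ] R →ₗ[ℂ] R) (a b c : R) : Prop :=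
  ∀ m n, prod m a (prod n b c) - ε • prod n b (prod m a c) =
    ∑ s ∈ Finset.range (m + 1), (m.choose s : ℂ) • prod (m + n - s) (prod s a b) c

theorem SkewAt.add_left {ε : ℂ} {T : R →ₗ[ℂ] R} {prod : ℕ → R →ₗ[ℂ] R →ₗ[ℂ] R} {a a' b : R}
    (h : SkewAt ε T prod a b) (h' : SkewAt ε T prod a' b) : SkewAt ε T prod (a + a') b := by
  obtain ⟨N, hN⟩ := h
  obtain ⟨M, hM⟩ := h'
  refine ⟨max N M, fun K hK n => ?_⟩
  rw [map_add, hN K (by omega), hM K (by omega), ← smul_add, ← Finset.sum_add_distrib]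
  simp only [map_add, LinearMap.add_apply, smul_add]

theorem SkewAt.add_right {ε : ℂ} {T : R →ₗ[ℂ] R} {prod : ℕ → R →ₗ[ℂ] R →ₗ[ℂ] R} {a b b' : R}
    (h : SkewAt ε T prod a b) (h' : SkewAt ε T prod a b') : SkewAt ε T prod a (b + b') := by
  obtain ⟨N, hN⟩ := h
  obtain ⟨M, hM⟩ := h'
  refine ⟨max N M, fun K hK n => ?_⟩
  rw [map_add, LinearMap.add_apply, hN K (by omega), hM K (by omega), ← smul_add,
    ← Finset.sum_add_distrib]
  simp only [map_add, smul_add]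

theorem JacobiAt.add₁ {ε : ℂ} {prod : ℕ → R →ₗ[ℂ] R →ₗ[ℂ] R} {a a' b c : R}
    (h : JacobiAt ε prod a b c) (h' : JacobiAt ε prod a' b c) : JacobiAt ε prod (a + a') b c := by
  intro m n
  simp only [map_add, LinearMap.add_apply, smul_add, Finset.sum_add_distrib, ← h m n, ← h' m n]
  abel

theorem JacobiAt.add₂ {ε : ℂ} {prod : ℕ → R →ₗ[ℂ] R →ₗ[ℂ] R} {a b b' c : R}
    (h : JacobiAt ε prod a b c) (h' : JacobiAt ε prod a b' c) : JacobiAt ε prod a (b + b') c := by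
  intro m n
  simp only [map_add, LinearMap.add_apply, smul_add, Finset.sum_add_distrib, ← h m n, ← h' m n]
  abel

theorem JacobiAt.add₃ {ε : ℂ} {prod : ℕ → R →ₗ[ℂ] R →ₗ[ℂ] R} {a b c c' : R}
    (h : JacobiAt ε prod a b c) (h' : JacobiAt ε prod a b c') : JacobiAt ε prod a b (c + c') := by
  intro m n
  simp only [map_add, smul_add, Finset.sum_add_distrib, ← h m n, ← h' m n]
  abel

variable {T : R →ₗ[ℂ] R} {prod : ℕ → R →ₗ[ℂ] R →ₗ[ℂ] R}

theorem SkewAt.T_left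
    (sl : ∀ n a b, prod n (T a) b = -(n : ℂ) • prod (n - 1) a b)
    (sr : ∀ n a b, prod n a (T b) = T (prod n a b) + (n : ℂ) • prod (n - 1) a b)
    {ε : ℂ} {a b : R} (h : SkewAt ε T prod a b)
    (hb : ∃ N, ∀ n ≥ N, prod n a b = 0) : SkewAt ε T prod (T a) b := by
  obtain ⟨N, hN⟩ := h
  obtain ⟨M, hM⟩ := hb
  refine ⟨max N M + 2, fun K hK n => ?_⟩
  obtain ⟨K, rfl⟩ : ∃ K', K = K' + 1 := ⟨K - 1, by omega⟩
  have e1 : (n : ℂ) • prod (n - 1) b a = -ε • ∑ s ∈ Finset.range (K + 1),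
      (-(n : ℂ) * ((-1 : ℂ) ^ (n + s) / (s.factorial : ℂ))) • (T ^ s) (prod (n + s - 1) a b) := by
    rcases Nat.eq_zero_or_pos n with rfl | hn
    · simp
    · rw [hN (K + 1) (by omega), smul_comm, Finset.smul_sum]
      congr 1
      refine Finset.sum_congr rfl fun s _ => ?_
      rw [smul_smul, show n - 1 + s = n + s - 1 by omega]
      congr 1
      obtain ⟨n, rfl⟩ : ∃ n', n = n' + 1 := ⟨n - 1, by omega⟩
      rw [show n + 1 + s - 1 = n + s by omega, show n + 1 + s = n + s + 1 by omega, pow_succ]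
      push_cast; ring
  have e2 : T (prod n b a) = -ε • ∑ s ∈ Finset.range (K + 1),
      (-(s : ℂ) * ((-1 : ℂ) ^ (n + s) / (s.factorial : ℂ))) • (T ^ s) (prod (n + s - 1) a b) := by
    rw [hN K (by omega), map_smul, map_sum, Finset.sum_range_succ']
    simp only [Nat.cast_zero, neg_zero, zero_mul, zero_smul, add_zero]
    congr 1
    refine Finset.sum_congr rfl fun s _ => ?_
    rw [map_smul, ← Module.End.mul_apply, ← pow_succ', show n + (s + 1) - 1 = n + s by omega]
    congr 1
    have h1 : ((s.factorial : ℕ) : ℂ) ≠ 0 := by exact_mod_cast s.factorial_ne_zero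
    have h2 : ((s : ℂ) + 1) ≠ 0 := by exact_mod_cast Nat.succ_ne_zero s
    rw [Nat.factorial_succ, ← add_assoc, pow_succ]
    push_cast
    field_simp
  rw [sr, e1, e2, ← smul_add, ← Finset.sum_add_distrib]
  congr 1
  refine Finset.sum_congr rfl fun s _ => ?_
  rw [sl, map_smul, smul_smul, ← add_smul]
  congr 1
  push_cast; ring

theorem SkewAt.T_right
    (sl : ∀ n a b, prod n (T a) b = -(n : ℂ) • prod (n - 1) a b)
    (sr : ∀ n a b, prod n a (T b) = T (prod n a b) + (n : ℂ) • prod (n - 1) a b)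
    {ε : ℂ} {a b : R} (h : SkewAt ε T prod a b)
    (hb : ∃ N, ∀ n ≥ N, prod n a b = 0) : SkewAt ε T prod a (T b) := by
  obtain ⟨N, hN⟩ := h
  obtain ⟨M, hM⟩ := hb
  refine ⟨max N M + 2, fun K hK n => ?_⟩
  obtain ⟨K, rfl⟩ : ∃ K', K = K' + 1 := ⟨K - 1, by omega⟩
  have e1 : -(n : ℂ) • prod (n - 1) b a = -ε • ∑ s ∈ Finset.range (K + 1),
      ((n : ℂ) * ((-1 : ℂ) ^ (n + s) / (s.factorial : ℂ))) • (T ^ s) (prod (n + s - 1) a b) := by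
    rcases Nat.eq_zero_or_pos n with rfl | hn
    · simp
    · rw [hN (K + 1) (by omega), smul_comm, Finset.smul_sum]
      congr 1
      refine Finset.sum_congr rfl fun s _ => ?_
      rw [smul_smul, show n - 1 + s = n + s - 1 by omega]
      congr 1
      obtain ⟨n, rfl⟩ : ∃ n', n = n' + 1 := ⟨n - 1, by omega⟩
      rw [show n + 1 + s - 1 = n + s by omega, show n + 1 + s = n + s + 1 by omega, pow_succ]
      push_cast; ring
  have e2 : ∑ s ∈ Finset.range (K + 1), ((-1 : ℂ) ^ (n + s) / (s.factorial : ℂ)) •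
      (T ^ s) (T (prod (n + s) a b)) = ∑ s ∈ Finset.range (K + 1),
      (-(s : ℂ) * ((-1 : ℂ) ^ (n + s) / (s.factorial : ℂ))) • (T ^ s) (prod (n + s - 1) a b) := by
    rw [Finset.sum_range_succ, hM (n + K) (by omega), map_zero, map_zero, smul_zero, add_zero,
      Finset.sum_range_succ']
    simp only [Nat.cast_zero, neg_zero, zero_mul, zero_smul, add_zero]
    refine Finset.sum_congr rfl fun s _ => ?_
    rw [← Module.End.mul_apply, ← pow_succ, show n + (s + 1) - 1 = n + s by omega]
    congr 1
    have h1 : ((s.factorial : ℕ) : ℂ) ≠ 0 := by exact_mod_cast s.factorial_ne_zero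
    have h2 : ((s : ℂ) + 1) ≠ 0 := by exact_mod_cast Nat.succ_ne_zero s
    rw [Nat.factorial_succ, ← add_assoc, pow_succ]
    push_cast
    field_simp
  rw [sl, e1]
  congr 1
  simp only [sr, map_add, smul_add, Finset.sum_add_distrib]
  rw [e2, ← Finset.sum_add_distrib]
  refine Finset.sum_congr rfl fun s _ => ?_
  rw [map_smul, smul_smul, ← add_smul]
  congr 1
  push_cast; ring

theorem JacobiAt.T₁
    (sl : ∀ n a b, prod n (T a) b = -(n : ℂ) • prod (n - 1) a b)
    {ε : ℂ} {a b c : R} (h : JacobiAt ε prod a b c) :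
    JacobiAt ε prod (T a) b c := by
  intro m n
  rcases Nat.eq_zero_or_pos m with rfl | hm
  · simp [sl]
  obtain ⟨m, rfl⟩ : ∃ m', m = m' + 1 := ⟨m - 1, by omega⟩
  have := h m n
  rw [Finset.sum_range_succ']
  simp only [sl, map_smul, LinearMap.smul_apply, Nat.cast_zero, neg_zero, zero_smul, smul_zero,
    add_zero, Nat.add_sub_cancel, map_zero, LinearMap.zero_apply]
  rw [smul_comm ε, ← smul_sub, this, Finset.smul_sum]
  refine Finset.sum_congr rfl fun s hs => ?_
  rw [smul_smul, smul_smul, show m + 1 + n - (s + 1) = m + n - s by omega]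
  congr 1
  have := congrArg (fun z : ℕ => (z : ℂ)) (Nat.add_one_mul_choose_eq m s)
  push_cast at this ⊢
  linear_combination -this

theorem JacobiAt.T₂
    (sl : ∀ n a b, prod n (T a) b = -(n : ℂ) • prod (n - 1) a b)
    (sr : ∀ n a b, prod n a (T b) = T (prod n a b) + (n : ℂ) • prod (n - 1) a b)
    {ε : ℂ} {a b c : R} (h : JacobiAt ε prod a b c) :
    JacobiAt ε prod a (T b) c := by
  intro m n
  have e : ∑ s ∈ Finset.range (m + 1), (m.choose s : ℂ) • prod (m + n - s) (prod s a (T b)) c =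
      -(n : ℂ) • ∑ s ∈ Finset.range (m + 1), (m.choose s : ℂ) •
        prod (m + n - 1 - s) (prod s a b) c := by
    simp only [sr, map_add, sl, LinearMap.add_apply, smul_add, Finset.sum_add_distrib, map_smul,
      LinearMap.smul_apply]
    have e1 : ∑ s ∈ Finset.range (m + 1), (m.choose s : ℂ) • (s : ℂ) •
        prod (m + n - s) (prod (s - 1) a b) c = ∑ s ∈ Finset.range (m + 1),
        ((m - s) * m.choose s : ℂ) • prod (m + n - 1 - s) (prod s a b) c := by
      rw [Finset.sum_range_succ', Finset.sum_range_succ]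
      simp only [Nat.cast_zero, zero_smul, smul_zero, add_zero, sub_self, zero_mul,
        Nat.add_sub_cancel]
      refine Finset.sum_congr rfl fun s hs => ?_
      have hs' := Finset.mem_range.1 hs
      rw [smul_smul, show m + n - (s + 1) = m + n - 1 - s by omega]
      congr 1
      have := congrArg (fun z : ℕ => (z : ℂ)) (Nat.choose_succ_right_eq m s)
      simp only [Nat.cast_mul, Nat.cast_sub hs'.le] at this
      rw [this]; ring
    rw [e1, ← Finset.sum_add_distrib, Finset.smul_sum]
    refine Finset.sum_congr rfl fun s hs => ?_
    have hs' := Finset.mem_range.1 hs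
    rw [smul_smul, smul_smul, show m + n - s - 1 = m + n - 1 - s by omega, ← add_smul]
    congr 1
    rw [Nat.cast_sub (by omega)]
    push_cast; ring
  rw [e]
  rcases Nat.eq_zero_or_pos n with rfl | hn
  · simp [sl]
  have := h m (n - 1)
  rw [show m + (n - 1) = m + n - 1 by omega] at this
  rw [← this]
  simp only [sl, map_smul, smul_sub, smul_comm ε]

theorem JacobiAt.T₃
    (sl : ∀ n a b, prod n (T a) b = -(n : ℂ) • prod (n - 1) a b)
    (sr : ∀ n a b, prod n a (T b) = T (prod n a b) + (n : ℂ) • prod (n - 1) a b)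
    {ε : ℂ} {a b c : R} (h : JacobiAt ε prod a b c) :
    JacobiAt ε prod a b (T c) := by
  intro m n
  have h1 := h m n
  have h2 := JacobiAt.T₁ sl h m n
  have h3 := JacobiAt.T₂ sl sr h m n
  have e : ∀ k x y, prod k x (T y) = T (prod k x y) - prod k (T x) y := by
    intro k x y
    rw [sr, sl]; module
  have e' : ∀ k, prod k (T a) b + prod k a (T b) = T (prod k a b) := by
    intro k
    rw [sr, sl]; module
  have h4 : ∑ s ∈ Finset.range (m + 1), (m.choose s : ℂ) • prod (m + n - s) (T (prod s a b)) c =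
      ∑ s ∈ Finset.range (m + 1), (m.choose s : ℂ) • prod (m + n - s) (prod s (T a) b) c +
      ∑ s ∈ Finset.range (m + 1), (m.choose s : ℂ) • prod (m + n - s) (prod s a (T b)) c := by
    rw [← Finset.sum_add_distrib]
    refine Finset.sum_congr rfl fun s _ => ?_
    rw [← smul_add, ← e', map_add, LinearMap.add_apply]
  have h5 : ∑ s ∈ Finset.range (m + 1), (m.choose s : ℂ) • prod (m + n - s) (prod s a b) (T c) =
      T (∑ s ∈ Finset.range (m + 1), (m.choose s : ℂ) • prod (m + n - s) (prod s a b) c) -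
      ∑ s ∈ Finset.range (m + 1), (m.choose s : ℂ) • prod (m + n - s) (T (prod s a b)) c := by
    rw [map_sum, ← Finset.sum_sub_distrib]
    refine Finset.sum_congr rfl fun s _ => ?_
    rw [e, map_smul, smul_sub]
  rw [h5, h4, ← h1, ← h2, ← h3, e n b c, e m a c, map_sub, map_sub, map_sub, map_smul, e m a, e n b]
  module

end Sesquilinear

section Current

/-- Data for a Lie conformal superalgebra `(ℂ[T] ⊗ A) ⊕ C` with `C` central and even, `T C = 0`,
and `[a_λ b] = [a,b] + ψ₀(a,b) + λ ψ₁(a,b)` for `a, b ∈ A`, where `[·,·] : A × A → A` and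
`ψ₀, ψ₁ : A × A → C` are bilinear. The conditions say that this satisfies the axioms of a Lie
conformal superalgebra. -/
structure CurrentData (A C : Type*) [AddCommGroup A] [Module ℂ A] [AddCommGroup C] [Module ℂ C]
    extends SuperSpace A where
  br : A →ₗ[ℂ] A →ₗ[ℂ] A
  ψ₀ : A →ₗ[ℂ] A →ₗ[ℂ] C
  ψ₁ : A →ₗ[ℂ] A →ₗ[ℂ] C
  br_par : ∀ a b, par (br a b) = br (par a) (par b)
  ψ₀_par : ∀ a b, ψ₀ (par a) (par b) = ψ₀ a b
  ψ₁_par : ∀ a b, ψ₁ (par a) (par b) = ψ₁ a b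
  br_skew : ∀ i j, ∀ a ∈ toSuperSpace.part i, ∀ b ∈ toSuperSpace.part j,
    br b a = -koszul i j • br a b
  br_jacobi : ∀ i j, ∀ a ∈ toSuperSpace.part i, ∀ b ∈ toSuperSpace.part j, ∀ c,
    br a (br b c) - koszul i j • br b (br a c) = br (br a b) c
  ψ₀_skew : ∀ i j, ∀ a ∈ toSuperSpace.part i, ∀ b ∈ toSuperSpace.part j,
    ψ₀ b a = -koszul i j • ψ₀ a b
  ψ₀_cocycle : ∀ i j, ∀ a ∈ toSuperSpace.part i, ∀ b ∈ toSuperSpace.part j, ∀ c,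
    ψ₀ a (br b c) - koszul i j • ψ₀ b (br a c) = ψ₀ (br a b) c
  ψ₁_symm : ∀ i j, ∀ a ∈ toSuperSpace.part i, ∀ b ∈ toSuperSpace.part j,
    ψ₁ b a = koszul i j • ψ₁ a b
  ψ₁_inv : ∀ a b c, ψ₁ (br a b) c = ψ₁ a (br b c)

variable {A C : Type*} [AddCommGroup A] [Module ℂ A] [AddCommGroup C] [Module ℂ C]

/-- The space `(ℂ[T] ⊗ A) ⊕ C`, where `∑ T^p ⊗ a_p` is represented by the finitely supported
function `p ↦ a_p`. -/
abbrev CurrentSpace (A C : Type*) [AddCommGroup A] [AddCommGroup C] : Type _ := (ℕ →₀ A) × C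

namespace CurrentData

/-- The element `T^p ⊗ a`. -/
noncomputable def el (p : ℕ) : A →ₗ[ℂ] CurrentSpace A C :=
  LinearMap.inl ℂ (ℕ →₀ A) C ∘ₗ Finsupp.lsingle p

/-- The operator `T`, equal to multiplication by `T` on `ℂ[T] ⊗ A` and to zero on `C`. -/
noncomputable def shift (A C : Type*) [AddCommGroup A] [Module ℂ A] [AddCommGroup C] [Module ℂ C] :
    CurrentSpace A C →ₗ[ℂ] CurrentSpace A C :=
  LinearMap.prodMap (Finsupp.lmapDomain A ℂ Nat.succ) 0

variable (D : CurrentData A C)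

/-- `a_{(r)} (T^q b)`, the coefficient of `λ^r / r!` in
`(λ + T)^q ([a,b] + ψ₀(a,b) + λ ψ₁(a,b))`. -/
noncomputable def base (r q : ℕ) : A →ₗ[ℂ] A →ₗ[ℂ] CurrentSpace A C :=
  (q.descFactorial r : ℂ) • D.br.compr₂ (el (q - r)) +
    (if r = q then (r.factorial : ℂ) else 0) • D.ψ₀.compr₂ (LinearMap.inr ℂ (ℕ →₀ A) C) +
    (if r = q + 1 then (r.factorial : ℂ) else 0) • D.ψ₁.compr₂ (LinearMap.inr ℂ (ℕ →₀ A) C)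

/-- The products on `(ℂ[T] ⊗ A) ⊕ C`: the element `C` is central and
`(T^p a)_{(n)} (T^q b) = (-1)^p n (n-1) ⋯ (n-p+1) a_{(n-p)} (T^q b)`. -/
noncomputable def prod (n : ℕ) :
    CurrentSpace A C →ₗ[ℂ] CurrentSpace A C →ₗ[ℂ] CurrentSpace A C :=
  LinearMap.compl₁₂
    (Finsupp.lsum ℂ fun p => LinearMap.flip (Finsupp.lsum ℂ fun q => LinearMap.flip
      (((-1 : ℂ) ^ p * (n.descFactorial p : ℂ)) • D.base (n - p) q)))
    (LinearMap.fst ℂ (ℕ →₀ A) C) (LinearMap.fst ℂ (ℕ →₀ A) C)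

theorem prod_el (n p q : ℕ) (a b : A) : D.prod n (el p a) (el q b) =
    ((-1 : ℂ) ^ p * (n.descFactorial p : ℂ)) • D.base (n - p) q a b := by
  simp [prod, el]

theorem prod_central_left (n : ℕ) (c : C) (y : CurrentSpace A C) : D.prod n (0, c) y = 0 := by
  simp [prod]

theorem prod_central_right (n : ℕ) (c : C) (y : CurrentSpace A C) : D.prod n y (0, c) = 0 := by
  simp [prod]

theorem base_apply (r q : ℕ) (a b : A) : D.base r q a b =
    (q.descFactorial r : ℂ) • el (q - r) (D.br a b) +
    (if r = q then (r.factorial : ℂ) else 0) • (0, D.ψ₀ a b) +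
    (if r = q + 1 then (r.factorial : ℂ) else 0) • (0, D.ψ₁ a b) := rfl

theorem base_eq_zero {r q : ℕ} (h : q + 2 ≤ r) (a b : A) : D.base r q a b = 0 := by
  rw [base_apply, Nat.descFactorial_of_lt (by omega), if_neg (by omega), if_neg (by omega)]
  simp

theorem shift_el (p : ℕ) (a : A) : shift A C (el p a) = el (p + 1) a := by
  simp [shift, el, Finsupp.lmapDomain_apply, Finsupp.mapDomain_single]

theorem shift_central (c : C) : shift A C (0, c) = 0 := by
  simp [shift]

@[elab_as_elim]
theorem el_induction {p : CurrentSpace A C → Prop} (h0 : p 0)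
    (hadd : ∀ x y, p x → p y → p (x + y)) (hel : ∀ q a, p (el q a)) (hc : ∀ c, p (0, c))
    (x : CurrentSpace A C) : p x := by
  obtain ⟨f, c⟩ := x
  rw [show ((f, c) : CurrentSpace A C) = (f, 0) + (0, c) by simp]
  refine hadd _ _ ?_ (hc c)
  induction f using Finsupp.induction_linear with
  | zero => exact h0
  | add f g hf hg =>
    rw [show ((f + g, 0) : CurrentSpace A C) = (f, 0) + (g, 0) by simp]
    exact hadd _ _ hf hg
  | single q a => exact hel q a

theorem sesq_left (n : ℕ) (x y : CurrentSpace A C) :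
    D.prod n (shift A C x) y = -(n : ℂ) • D.prod (n - 1) x y := by
  refine el_induction ?_ ?_ ?_ ?_ x
  · simp
  · intro x x' h h'
    simp only [map_add, LinearMap.add_apply, h, h', smul_add]
  · intro p a
    refine el_induction ?_ ?_ ?_ ?_ y
    · simp
    · intro y y' h h'
      simp only [map_add, h, h', smul_add]
    · intro q b
      rw [shift_el, prod_el, prod_el, smul_smul, Nat.sub_sub, add_comm 1 p]
      congr 1
      cases n with
      | zero => simp
      | succ n =>
        rw [Nat.succ_descFactorial_succ, Nat.add_sub_cancel, pow_succ]
        push_cast; ring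
    · intro c
      rw [prod_central_right, prod_central_right, smul_zero]
  · intro c
    rw [shift_central, prod_central_left, map_zero, LinearMap.zero_apply, smul_zero]

theorem base_succ (r q : ℕ) (a b : A) : D.base r (q + 1) a b =
    shift A C (D.base r q a b) + (r : ℂ) • D.base (r - 1) q a b := by
  simp only [base_apply, map_add, map_smul, shift_el, shift_central, smul_zero, add_zero, smul_add,
    smul_smul]
  cases r with
  | zero => simp
  | succ r =>
    have h1 : (r + 1 : ℕ) • (el (q - r) (D.br a b) : CurrentSpace A C) =
      (r + 1 : ℂ) • el (q - r) (D.br a b) := by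
      rw [← Nat.cast_smul_eq_nsmul ℂ]; push_cast; rfl
    have e0 : (if r + 1 = q + 1 then ((r + 1).factorial : ℂ) else 0) =
        ((r + 1 : ℕ) : ℂ) * (if r = q then (r.factorial : ℂ) else 0) := by
      by_cases h : r = q <;> simp [h, Nat.factorial_succ]
    have e1 : (if r + 1 = q + 1 + 1 then ((r + 1).factorial : ℂ) else 0) =
        ((r + 1 : ℕ) : ℂ) * (if r = q + 1 then (r.factorial : ℂ) else 0) := by
      by_cases h : r = q + 1 <;> simp [h, Nat.factorial_succ]
    rw [e0, e1, Nat.add_sub_cancel, Nat.add_sub_add_right, ← add_assoc, ← add_assoc]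
    congr 2
    have e2 : ((q + 1).descFactorial (r + 1) : ℂ) =
        (q.descFactorial (r + 1) : ℂ) + (r + 1) * (q.descFactorial r : ℂ) := by
      rw [Nat.succ_descFactorial_succ, Nat.descFactorial_succ]
      by_cases h : r ≤ q
      · push_cast [h]; ring
      · rw [Nat.descFactorial_of_lt (by omega)]; simp
    rw [e2, add_smul]
    congr 1
    · by_cases h : r + 1 ≤ q
      · rw [show q - (r + 1) + 1 = q - r by omega]
      · rw [Nat.descFactorial_of_lt (by omega)]; simp
    · push_cast; rfl

theorem sesq_right' (n : ℕ) (x y : CurrentSpace A C) : D.prod n x (shift A C y) =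
    shift A C (D.prod n x y) + (n : ℂ) • D.prod (n - 1) x y := by
  refine el_induction ?_ ?_ ?_ ?_ x
  · simp
  · intro x x' h h'
    simp only [map_add, LinearMap.add_apply, h, h', smul_add]; abel
  · intro p a
    refine el_induction ?_ ?_ ?_ ?_ y
    · simp
    · intro y y' h h'
      simp only [map_add, h, h', smul_add]; abel
    · intro q b
      rw [shift_el, prod_el, prod_el, prod_el, base_succ, map_smul, smul_add, smul_smul, smul_smul,
        Nat.sub_right_comm]
      congr 2
      have : (n.descFactorial p : ℂ) * ((n - p : ℕ) : ℂ) = n * ((n - 1).descFactorial p : ℂ) := by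
        cases n with
        | zero => simp
        | succ n =>
          rw [mul_comm]
          have := Nat.succ_descFactorial_succ n p
          rw [Nat.descFactorial_succ] at this
          exact_mod_cast this
      linear_combination (-1 : ℂ) ^ p * this
    · intro c
      simp only [shift_central, prod_central_right, map_zero, smul_zero, add_zero]
  · intro c
    simp only [prod_central_left, map_zero, smul_zero, add_zero]

theorem prod_bounded (x y : CurrentSpace A C) : ∃ N, ∀ n ≥ N, D.prod n x y = 0 := by
  refine el_induction ?_ ?_ ?_ ?_ x
  · exact ⟨0, fun n _ => by simp⟩
  · rintro x x' ⟨N, hN⟩ ⟨M, hM⟩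
    refine ⟨max N M, fun n hn => ?_⟩
    rw [map_add, LinearMap.add_apply, hN n (by omega), hM n (by omega), add_zero]
  · intro p a
    refine el_induction ?_ ?_ ?_ ?_ y
    · exact ⟨0, fun n _ => by simp⟩
    · rintro y y' ⟨N, hN⟩ ⟨M, hM⟩
      refine ⟨max N M, fun n hn => ?_⟩
      rw [map_add, hN n (by omega), hM n (by omega), add_zero]
    · intro q b
      refine ⟨p + q + 2, fun n hn => ?_⟩
      rw [prod_el, D.base_eq_zero (by omega), smul_zero]
    · exact fun c => ⟨0, fun n _ => by simp [prod_central_right]⟩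
  · exact fun c => ⟨0, fun n _ => by simp [prod_central_left]⟩

/-- The parity of `(ℂ[T] ⊗ A) ⊕ C`. -/
noncomputable def superSpace : SuperSpace (CurrentSpace A C) where
  par := LinearMap.prodMap (Finsupp.mapRange.linearMap D.par) LinearMap.id
  par_par x := by
    refine Prod.ext (Finsupp.ext fun q => ?_) rfl
    simp [D.par_par]

theorem par_el (p : ℕ) (a : A) : D.superSpace.par (el p a) = el p (D.par a) := by
  simp [superSpace, el]

theorem par_central (c : C) : D.superSpace.par (0, c) = (0, c) := by
  simp [superSpace]

theorem part_induction {i : ZMod 2} {p : CurrentSpace A C → Prop} (h0 : p 0)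
    (hadd : ∀ x y, p x → p y → p (x + y)) (hel : ∀ q, ∀ a ∈ D.part i, p (el q a))
    (hc : ∀ c, p (0, c)) {x : CurrentSpace A C} (hx : x ∈ D.superSpace.part i) : p x := by
  rw [← D.superSpace.proj_of_mem hx]
  refine el_induction (p := fun x => p (D.superSpace.proj i x)) ?_ ?_ ?_ ?_ x
  · simpa using h0
  · intro x y hx hy
    rw [map_add]; exact hadd _ _ hx hy
  · intro q a
    have : D.superSpace.proj i (el q a) = el q (D.proj i a) := by
      simp [SuperSpace.proj, par_el]
    rw [this]
    exact hel q _ (D.proj_mem i a)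
  · intro c
    have : D.superSpace.proj i (0, c) = (0, D.superSpace.proj i (0, c) |>.2) := by
      refine Prod.ext ?_ rfl
      simp [SuperSpace.proj, par_central]
    rw [this]
    exact hc _

theorem skewAt {i j : ZMod 2} {x y : CurrentSpace A C} (hx : x ∈ D.superSpace.part i)
    (hy : y ∈ D.superSpace.part j) : SkewAt (koszul i j) (shift A C) D.prod x y := by
  refine D.part_induction (p := fun x => SkewAt (koszul i j) (shift A C) D.prod x y) ?_ ?_ ?_ ?_ hx
  · exact ⟨0, fun N _ n => by simp⟩
  · exact fun x x' h h' => h.add_left h'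
  · intro p a ha
    refine D.part_induction (p := fun y => SkewAt (koszul i j) (shift A C) D.prod (el p a) y)
      ?_ ?_ ?_ ?_ hy
    · exact ⟨0, fun N _ n => by simp⟩
    · exact fun x x' h h' => h.add_right h'
    · intro q b hb
      induction p with
      | succ p ih =>
        rw [← shift_el]
        exact SkewAt.T_left D.sesq_left D.sesq_right' ih (D.prod_bounded _ _)
      | zero =>
        induction q with
        | succ q ih =>
          rw [← shift_el]
          exact SkewAt.T_right D.sesq_left D.sesq_right' ih (D.prod_bounded _ _)
        | zero =>
          refine ⟨2, fun N hN n => ?_⟩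
          obtain ⟨N, rfl⟩ : ∃ N', N = N' + 2 := ⟨N - 2, by omega⟩
          rw [Finset.sum_range_succ', Finset.sum_range_succ', Finset.sum_eq_zero]
          · simp only [prod_el, base_apply, D.br_skew i j a ha b hb, D.ψ₀_skew i j a ha b hb,
              D.ψ₁_symm i j a ha b hb]
            rcases n with _ | _ | n
            · simp [Nat.descFactorial, shift_central, el]
            · simp [Nat.descFactorial, el]
            · simp [Nat.descFactorial]
          · intro s _
            rw [prod_el, D.base_eq_zero (by omega), smul_zero, map_zero, smul_zero]
    · exact fun c => ⟨0, fun N _ n => by simp [prod_central_left, prod_central_right]⟩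
  · exact fun c => ⟨0, fun N _ n => by simp [prod_central_left, prod_central_right]⟩

theorem jacobiAt {i j : ZMod 2} {x y : CurrentSpace A C} (hx : x ∈ D.superSpace.part i)
    (hy : y ∈ D.superSpace.part j) (z : CurrentSpace A C) :
    JacobiAt (koszul i j) D.prod x y z := by
  refine D.part_induction (p := fun x => JacobiAt (koszul i j) D.prod x y z) ?_ ?_ ?_ ?_ hx
  · exact fun m n => by simp
  · exact fun x x' h h' => h.add₁ h'
  · intro p a ha
    refine D.part_induction (p := fun y => JacobiAt (koszul i j) D.prod (el p a) y z) ?_ ?_ ?_ ?_ hy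
    · exact fun m n => by simp
    · exact fun x x' h h' => h.add₂ h'
    · intro q b hb
      refine el_induction ?_ ?_ ?_ ?_ z
      · exact fun m n => by simp
      · exact fun x x' h h' => h.add₃ h'
      · intro r c
        induction p with
        | succ p ih =>
          rw [← shift_el]
          exact JacobiAt.T₁ D.sesq_left ih
        | zero =>
          induction q with
          | succ q ih =>
            rw [← shift_el]
            exact JacobiAt.T₂ D.sesq_left D.sesq_right' ih
          | zero =>
            induction r with
            | succ r ih =>
              rw [← shift_el]
              exact JacobiAt.T₃ D.sesq_left D.sesq_right' ih
            | zero =>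
              have p0 : ∀ a b, D.prod 0 (el 0 a) (el 0 b) = el 0 (D.br a b) + (0, D.ψ₀ a b) := by
                intro a b; simp [prod_el, base_apply]
              have p1 : ∀ a b, D.prod 1 (el 0 a) (el 0 b) = (0, D.ψ₁ a b) := by
                intro a b; simp [prod_el, base_apply]
              have p2 : ∀ n ≥ 2, ∀ a b, D.prod n (el 0 a) (el 0 b) = 0 := by
                intro n hn a b
                rw [prod_el, D.base_eq_zero (by omega), smul_zero]
              have p3 : ∀ n ≥ 1, ∀ a b, ∃ c, D.prod n (el 0 a) (el 0 b) = (0, c) := by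
                intro n hn a b
                rcases (show n = 1 ∨ 2 ≤ n by omega) with rfl | hn
                · exact ⟨_, p1 a b⟩
                · exact ⟨0, p2 n hn a b⟩
              have hsum : ∀ m n, ∑ s ∈ Finset.range (m + 1), (m.choose s : ℂ) •
                  D.prod (m + n - s) (D.prod s (el 0 a) (el 0 b)) (el 0 c) =
                  D.prod (m + n) (el 0 (D.br a b)) (el 0 c) := by
                intro m n
                rw [Finset.sum_range_succ', Finset.sum_eq_zero, p0]
                · simp [prod_central_left]
                · intro s _
                  obtain ⟨d, hd⟩ := p3 (s + 1) (by omega) a b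
                  rw [hd, prod_central_left, smul_zero]
              intro m n
              rw [hsum]
              have hinv : D.ψ₁ (D.br a b) c = -koszul i j • D.ψ₁ b (D.br a c) := by
                rw [← D.ψ₁_inv b a c, D.br_skew i j a ha b hb, map_smul, LinearMap.smul_apply,
                  smul_smul, neg_mul_neg, koszul_mul_self, one_smul]
              rcases Nat.eq_zero_or_pos m with rfl | hm
              · rcases Nat.eq_zero_or_pos n with rfl | hn
                · simp only [p0, map_add, prod_central_right, add_zero, ← D.br_jacobi i j a ha b hb,
                    ← D.ψ₀_cocycle i j a ha b hb, map_sub, map_smul]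
                  ext <;> simp [el]
                · obtain ⟨d, hd⟩ := p3 n hn b c
                  rw [hd, prod_central_right, p0, map_add, prod_central_right, add_zero, zero_add]
                  rcases (show n = 1 ∨ 2 ≤ n by omega) with rfl | hn
                  · rw [p1, p1, hinv]; simp
                  · rw [p2 n hn, p2 n hn]; simp
              · obtain ⟨d, hd⟩ := p3 m hm a c
                rw [hd, prod_central_right, smul_zero, sub_zero]
                rcases Nat.eq_zero_or_pos n with rfl | hn
                · rw [p0, map_add, prod_central_right, add_zero, add_zero]
                  rcases (show m = 1 ∨ 2 ≤ m by omega) with rfl | hm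
                  · rw [p1, p1, D.ψ₁_inv]
                  · rw [p2 m hm, p2 m hm]
                · obtain ⟨d, hd⟩ := p3 n hn b c
                  rw [hd, prod_central_right, p2 _ (by omega)]
      · exact fun c m n => by simp [prod_central_right]
    · exact fun c m n => by simp [prod_central_left, prod_central_right]
  · exact fun c m n => by simp [prod_central_left]

/-- The Lie conformal superalgebra `(ℂ[T] ⊗ A) ⊕ C`. -/
noncomputable def lca : LieConformalSuperalgebra (CurrentSpace A C) where
  toSuperSpace := D.superSpace
  T := shift A C
  prod := D.prod
  par_T x := by
    refine el_induction ?_ ?_ ?_ ?_ x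
    · simp
    · intro x y hx hy; simp only [map_add, hx, hy]
    · intro p a; rw [shift_el, par_el, par_el, shift_el]
    · intro c; rw [shift_central, par_central, shift_central, map_zero]
  par_prod n x y := by
    refine el_induction ?_ ?_ ?_ ?_ x
    · simp
    · intro x y hx hy; simp only [map_add, LinearMap.add_apply, hx, hy]
    · intro p a
      refine el_induction ?_ ?_ ?_ ?_ y
      · simp
      · intro x y hx hy; simp only [map_add, hx, hy]
      · intro q b
        rw [par_el, par_el, prod_el, prod_el, base_apply, base_apply]
        simp only [map_smul, map_add, par_el, par_central, D.br_par, D.ψ₀_par, D.ψ₁_par]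
      · intro c; rw [par_central, prod_central_right, prod_central_right, map_zero]
    · intro c; rw [par_central, prod_central_left, prod_central_left, map_zero]
  bounded := D.prod_bounded
  sesq_left := D.sesq_left
  sesq_right n a b := by rw [D.sesq_right', D.sesq_left]; module
  skew i j a ha b hb n N hN := by
    obtain ⟨M, hM⟩ := D.skewAt ha hb
    rw [hM (max N M) (le_max_right _ _) n]
    congr 1
    symm
    refine Finset.sum_subset (Finset.range_mono (le_max_left _ _)) fun s _ hs => ?_
    rw [hN _ (by rw [Finset.mem_range] at hs; omega), map_zero, smul_zero]
  jacobi i j a ha b hb c m n := D.jacobiAt ha hb c m n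

end CurrentData

end Current

/-! ### The affine, fermionic and super affine vertex algebras -/

section Examples

/-- A nondegenerate symmetric invariant bilinear form on a complex Lie algebra. -/
structure InvariantForm (𝔤 : Type*) [LieRing 𝔤] [LieAlgebra ℂ 𝔤] where
  form : LinearMap.BilinForm ℂ 𝔤
  symm : ∀ x y, form x y = form y x
  inv : ∀ x y z, form ⁅x, y⁆ z = form x ⁅y, z⁆
  nondegenerate : form.Nondegenerate

variable {𝔤 : Type*} [LieRing 𝔤] [LieAlgebra ℂ 𝔤]

/-- The bracket of `𝔤` as a bilinear map. -/
def lieBr (𝔤 : Type*) [LieRing 𝔤] [LieAlgebra ℂ 𝔤] : 𝔤 →ₗ[ℂ] 𝔤 →ₗ[ℂ] 𝔤 :=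
  LinearMap.mk₂ ℂ (fun x y => ⁅x, y⁆) add_lie smul_lie lie_add (fun c x y => lie_smul c x y)

theorem lieBr_apply (x y : 𝔤) : lieBr 𝔤 x y = ⁅x, y⁆ := rfl

theorem zmod_two_cases : ∀ i : ZMod 2, i = 0 ∨ i = 1 := by decide

theorem eq_zero_of_eq_neg {V : Type*} [AddCommGroup V] [Module ℂ V] {v : V} (h : v = -v) :
    v = 0 := by
  have h2 : (2 : ℂ) • v = 0 := by
    rw [two_smul]; nth_rewrite 2 [h]; exact add_neg_cancel v
  exact (smul_eq_zero.1 h2).resolve_left two_ne_zero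

theorem eq_zero_of_even {i : ZMod 2} {a : 𝔤} (h : a = sgn i • a) : i = 0 ∨ a = 0 := by
  rcases zmod_two_cases i with rfl | rfl
  · exact Or.inl rfl
  · exact Or.inr (eq_zero_of_eq_neg (by simpa [sgn] using h))

theorem eq_zero_of_odd {i : ZMod 2} {a : 𝔤} (h : -a = sgn i • a) : i = 1 ∨ a = 0 := by
  rcases zmod_two_cases i with rfl | rfl
  · exact Or.inr (eq_zero_of_eq_neg (by simpa [sgn] using h.symm))
  · exact Or.inl rfl

theorem super_part_cases {i : ZMod 2} {a a' : 𝔤} (h : ((a, -a') : 𝔤 × 𝔤) = sgn i • (a, a')) :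
    (i = 0 ∧ a' = 0) ∨ (i = 1 ∧ a = 0) := by
  rcases zmod_two_cases i with rfl | rfl
  · exact Or.inl ⟨rfl, eq_zero_of_eq_neg (by simpa [sgn] using (congrArg Prod.snd h).symm)⟩
  · exact Or.inr ⟨rfl, eq_zero_of_eq_neg (by simpa [sgn] using congrArg Prod.fst h)⟩

theorem koszul_zero_left (i : ZMod 2) : koszul 0 i = 1 := by simp [koszul, sgn]

theorem koszul_zero_right (i : ZMod 2) : koszul i 0 = 1 := by simp [koszul, sgn]

theorem koszul_one_one : koszul 1 1 = -1 := by simp [koszul, sgn]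

/-- The data of the current algebra: `𝔤` is even and `[a_λ b] = [a,b] + λ (a,b) K`. -/
noncomputable def curData (B : InvariantForm 𝔤) : CurrentData 𝔤 ℂ where
  par := LinearMap.id
  par_par _ := rfl
  br := lieBr 𝔤
  ψ₀ := 0
  ψ₁ := B.form
  br_par _ _ := rfl
  ψ₀_par _ _ := rfl
  ψ₁_par _ _ := rfl
  br_skew i j a ha b hb := by
    rcases eq_zero_of_even ha with rfl | rfl
    · rcases eq_zero_of_even hb with rfl | rfl
      · simp [koszul_zero_left, lieBr_apply]
      · simp
    · simp
  br_jacobi i j a ha b hb c := by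
    rcases eq_zero_of_even ha with rfl | rfl
    · rcases eq_zero_of_even hb with rfl | rfl
      · simp [koszul_zero_left, lieBr_apply]
      · simp
    · simp
  ψ₀_skew i j a ha b hb := by simp
  ψ₀_cocycle i j a ha b hb c := by simp
  ψ₁_symm i j a ha b hb := by
    rcases eq_zero_of_even ha with rfl | rfl
    · rcases eq_zero_of_even hb with rfl | rfl
      · rw [koszul_zero_left, one_smul, B.symm]
      · simp
    · simp
  ψ₁_inv := B.inv

/-- The data of the Clifford Lie conformal superalgebra of `𝔤` viewed as an odd superspace:
`[ā_λ b̄] = (a,b) K'`. -/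
noncomputable def cliffordData (B : InvariantForm 𝔤) : CurrentData 𝔤 ℂ where
  par := -LinearMap.id
  par_par v := by simp
  br := 0
  ψ₀ := B.form
  ψ₁ := 0
  br_par _ _ := by simp
  ψ₀_par _ _ := by simp
  ψ₁_par _ _ := rfl
  br_skew i j a ha b hb := by simp
  br_jacobi i j a ha b hb c := by simp
  ψ₀_skew i j a ha b hb := by
    rcases eq_zero_of_odd ha with rfl | rfl
    · rcases eq_zero_of_odd hb with rfl | rfl
      · rw [koszul_one_one, neg_neg, one_smul, B.symm]
      · simp
    · simp
  ψ₀_cocycle i j a ha b hb c := by simp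
  ψ₁_symm i j a ha b hb := by simp
  ψ₁_inv _ _ _ := by simp

/-- The data of the super affine Lie conformal superalgebra. An element `(a, b)` of `𝔤 × 𝔤` stands
for `a + b̄`, and an element `(s, t)` of `ℂ × ℂ` for `s 𝒦 + t 𝒦̄`. The brackets are
`[a_λ b] = [a,b] + λ (a,b) 𝒦`, `[a_λ b̄] = [ā_λ b] = [a,b]‾` and `[ā_λ b̄] = (a,b) 𝒦̄`. -/
noncomputable def superData (B : InvariantForm 𝔤) : CurrentData (𝔤 × 𝔤) (ℂ × ℂ) where
  par := LinearMap.prodMap LinearMap.id (-LinearMap.id)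
  par_par v := by simp
  br := LinearMap.mk₂ ℂ (fun a b => (⁅a.1, b.1⁆, ⁅a.1, b.2⁆ + ⁅a.2, b.1⁆))
    (fun a b c => by simp; abel) (fun c a b => by simp) (fun a b c => by simp; abel)
    (fun c a b => by simp)
  ψ₀ := LinearMap.mk₂ ℂ (fun a b => (0, B.form a.2 b.2))
    (fun a b c => by simp) (fun c a b => by simp) (fun a b c => by simp) (fun c a b => by simp)
  ψ₁ := LinearMap.mk₂ ℂ (fun a b => (B.form a.1 b.1, 0))
    (fun a b c => by simp) (fun c a b => by simp) (fun a b c => by simp) (fun c a b => by simp)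
  br_par a b := by simp; abel
  ψ₀_par a b := by simp
  ψ₁_par a b := by simp
  br_skew i j a ha b hb := by
    obtain ⟨a, a'⟩ := a
    obtain ⟨b, b'⟩ := b
    rcases super_part_cases (a := a) (a' := a') ha with ⟨rfl, rfl⟩ | ⟨rfl, rfl⟩ <;>
      rcases super_part_cases (a := b) (a' := b') hb with ⟨rfl, rfl⟩ | ⟨rfl, rfl⟩
    all_goals simp [koszul_zero_left, koszul_zero_right, koszul_one_one]
  br_jacobi i j a ha b hb c := by
    obtain ⟨a, a'⟩ := a
    obtain ⟨b, b'⟩ := b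
    rcases super_part_cases (a := a) (a' := a') ha with ⟨rfl, rfl⟩ | ⟨rfl, rfl⟩ <;>
      rcases super_part_cases (a := b) (a' := b') hb with ⟨rfl, rfl⟩ | ⟨rfl, rfl⟩
    all_goals simp [koszul_zero_left, koszul_zero_right, koszul_one_one]
    rfl
  ψ₀_skew i j a ha b hb := by
    obtain ⟨a, a'⟩ := a
    obtain ⟨b, b'⟩ := b
    rcases super_part_cases (a := a) (a' := a') ha with ⟨rfl, rfl⟩ | ⟨rfl, rfl⟩ <;>
      rcases super_part_cases (a := b) (a' := b') hb with ⟨rfl, rfl⟩ | ⟨rfl, rfl⟩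
    all_goals simp [koszul_zero_left, koszul_zero_right, koszul_one_one]
    exact B.symm _ _
  ψ₀_cocycle i j a ha b hb c := by
    obtain ⟨a, a'⟩ := a
    obtain ⟨b, b'⟩ := b
    rcases super_part_cases (a := a) (a' := a') ha with ⟨rfl, rfl⟩ | ⟨rfl, rfl⟩ <;>
      rcases super_part_cases (a := b) (a' := b') hb with ⟨rfl, rfl⟩ | ⟨rfl, rfl⟩
    all_goals simp [koszul_zero_left, koszul_zero_right, koszul_one_one]
    · rfl
    · rw [← B.inv b', ← lie_skew, map_neg, LinearMap.neg_apply, neg_neg]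
    · exact (B.inv _ _ _).symm
    · rw [← B.inv b', ← B.inv a', ← lie_skew, map_neg, LinearMap.neg_apply, neg_add_cancel]
  ψ₁_symm i j a ha b hb := by
    obtain ⟨a, a'⟩ := a
    obtain ⟨b, b'⟩ := b
    rcases super_part_cases (a := a) (a' := a') ha with ⟨rfl, rfl⟩ | ⟨rfl, rfl⟩ <;>
      rcases super_part_cases (a := b) (a' := b') hb with ⟨rfl, rfl⟩ | ⟨rfl, rfl⟩
    all_goals simp [koszul_zero_left, koszul_zero_right, koszul_one_one]
    exact B.symm _ _
  ψ₁_inv a b c := by simp [B.inv]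

/-- The current Lie conformal algebra `Cur(𝔤) = (ℂ[T] ⊗ 𝔤) ⊕ ℂ K`. -/
noncomputable def Cur (B : InvariantForm 𝔤) : LieConformalSuperalgebra (CurrentSpace 𝔤 ℂ) :=
  (curData B).lca

/-- The Clifford Lie conformal superalgebra `R^{Cl}(𝔤̄) = (ℂ[T] ⊗ 𝔤̄) ⊕ ℂ K'`. -/
noncomputable def RCl (B : InvariantForm 𝔤) : LieConformalSuperalgebra (CurrentSpace 𝔤 ℂ) :=
  (cliffordData B).lca

/-- The Lie conformal superalgebra
`R^{super} = (ℂ[T] ⊗ 𝔤) ⊕ (ℂ[T] ⊗ 𝔤̄) ⊕ ℂ 𝒦 ⊕ ℂ 𝒦̄`. -/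
noncomputable def RSuper (B : InvariantForm 𝔤) :
    LieConformalSuperalgebra (CurrentSpace (𝔤 × 𝔤) (ℂ × ℂ)) :=
  (superData B).lca

theorem Cur_bracket (B : InvariantForm 𝔤) (a b : 𝔤) :
    (Cur B).prod 0 (CurrentData.el 0 a) (CurrentData.el 0 b) = CurrentData.el 0 ⁅a, b⁆ ∧
    (Cur B).prod 1 (CurrentData.el 0 a) (CurrentData.el 0 b) = (0, B.form a b) := by
  constructor <;> simp [Cur, CurrentData.lca, CurrentData.prod_el, CurrentData.base_apply, curData,
    lieBr_apply]

theorem RCl_bracket (B : InvariantForm 𝔤) (a b : 𝔤) :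
    (RCl B).prod 0 (CurrentData.el 0 a) (CurrentData.el 0 b) = (0, B.form a b) ∧
    (RCl B).prod 1 (CurrentData.el 0 a) (CurrentData.el 0 b) = 0 := by
  constructor <;> simp [RCl, CurrentData.lca, CurrentData.prod_el, CurrentData.base_apply,
    cliffordData]

theorem RSuper_bracket (B : InvariantForm 𝔤) (a a' b b' : 𝔤) :
    (RSuper B).prod 0 (CurrentData.el 0 (a, a')) (CurrentData.el 0 (b, b')) =
      CurrentData.el 0 (⁅a, b⁆, ⁅a, b'⁆ + ⁅a', b⁆) + (0, (0, B.form a' b')) ∧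
    (RSuper B).prod 1 (CurrentData.el 0 (a, a')) (CurrentData.el 0 (b, b')) =
      (0, (B.form a b, 0)) := by
  constructor <;> simp [RSuper, CurrentData.lca, CurrentData.prod_el, CurrentData.base_apply,
    superData]

/-- The ideal of `V(Cur(𝔤))` generated by `K - k |0⟩`. -/
noncomputable def affineIdeal (B : InvariantForm 𝔤) (k : ℂ) : (Cur B).envelope.Ideal :=
  (Cur B).envelope.idealGen {(Cur B).ι (0, 1) - k • (Cur B).envelope.vac}

/-- The level `k` universal affine vertex algebra `V^k(𝔤)`. -/
noncomputable def affineVA (B : InvariantForm 𝔤) (k : ℂ) : VertexAlgebra (affineIdeal B k).Quot :=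
  (Cur B).envelope.quotient (affineIdeal B k)

/-- The canonical map `Cur(𝔤) → V^k(𝔤)`. -/
noncomputable def toAffine (B : InvariantForm 𝔤) (k : ℂ) :
    CurrentSpace 𝔤 ℂ →ₗ[ℂ] (affineIdeal B k).Quot :=
  (affineIdeal B k).toSubmodule.mkQ ∘ₗ (Cur B).ι

/-- The ideal of `V(R^{Cl}(𝔤̄))` generated by `K' - |0⟩`. -/
noncomputable def fermionicIdeal (B : InvariantForm 𝔤) : (RCl B).envelope.Ideal :=
  (RCl B).envelope.idealGen {(RCl B).ι (0, 1) - (RCl B).envelope.vac}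

/-- The fermionic vertex algebra `F(𝔤̄)`. -/
noncomputable def fermionicVA (B : InvariantForm 𝔤) : VertexAlgebra (fermionicIdeal B).Quot :=
  (RCl B).envelope.quotient (fermionicIdeal B)

/-- The canonical map `R^{Cl}(𝔤̄) → F(𝔤̄)`. -/
noncomputable def toFermionic (B : InvariantForm 𝔤) :
    CurrentSpace 𝔤 ℂ →ₗ[ℂ] (fermionicIdeal B).Quot :=
  (fermionicIdeal B).toSubmodule.mkQ ∘ₗ (RCl B).ι

/-- The ideal of `V(R^{super})` generated by `𝒦̄ - |0⟩`. -/
noncomputable def superIdeal₁ (B : InvariantForm 𝔤) : (RSuper B).envelope.Ideal :=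
  (RSuper B).envelope.idealGen {(RSuper B).ι (0, (0, 1)) - (RSuper B).envelope.vac}

/-- The vertex algebra `V^1(R^{super})`. -/
noncomputable def superVA₁ (B : InvariantForm 𝔤) : VertexAlgebra (superIdeal₁ B).Quot :=
  (RSuper B).envelope.quotient (superIdeal₁ B)

/-- The canonical map `R^{super} → V^1(R^{super})`. -/
noncomputable def toSuper₁ (B : InvariantForm 𝔤) :
    CurrentSpace (𝔤 × 𝔤) (ℂ × ℂ) →ₗ[ℂ] (superIdeal₁ B).Quot :=
  (superIdeal₁ B).toSubmodule.mkQ ∘ₗ (RSuper B).ι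

/-- The ideal of `V(R^{super})` generated by `𝒦 - k |0⟩` and `𝒦̄ - |0⟩`. -/
noncomputable def superIdeal (B : InvariantForm 𝔤) (k : ℂ) : (RSuper B).envelope.Ideal :=
  (RSuper B).envelope.idealGen {(RSuper B).ι (0, (1, 0)) - k • (RSuper B).envelope.vac,
    (RSuper B).ι (0, (0, 1)) - (RSuper B).envelope.vac}

/-- The vertex algebra `V^{k,1}(R^{super})`. -/
noncomputable def superVA (B : InvariantForm 𝔤) (k : ℂ) : VertexAlgebra (superIdeal B k).Quot :=
  (RSuper B).envelope.quotient (superIdeal B k)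

/-- The canonical projection `V^1(R^{super}) → V^{k,1}(R^{super})`. -/
noncomputable def superProj (B : InvariantForm 𝔤) (k : ℂ) :
    (superIdeal₁ B).Quot →ₗ[ℂ] (superIdeal B k).Quot :=
  Submodule.factor ((RSuper B).envelope.idealGen_mono (by simp))

/-- The image in `V^1(R^{super})` of `x ∈ 𝔤`. -/
noncomputable def evenEl (B : InvariantForm 𝔤) (x : 𝔤) : (superIdeal₁ B).Quot :=
  toSuper₁ B (CurrentData.el 0 (x, 0))

/-- The image in `V^1(R^{super})` of `x̄ ∈ 𝔤̄`. -/
noncomputable def oddEl (B : InvariantForm 𝔤) (x : 𝔤) : (superIdeal₁ B).Quot :=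
  toSuper₁ B (CurrentData.el 0 (0, x))

/-- The Casimir operator of `𝔤` in the adjoint representation, `∑ᵢ ad(xᵢ)²`, for an orthonormal
basis `x` of `𝔤`. -/
noncomputable def casimir {I : Type*} [Fintype I] (x : Module.Basis I ℂ 𝔤) : 𝔤 →ₗ[ℂ] 𝔤 :=
  ∑ i, lieBr 𝔤 (x i) ∘ₗ lieBr 𝔤 (x i)

/-- The element `ỹ = y - ½ ∑ᵢ :[y,xᵢ]‾ x̄ᵢ:` of `V^1(R^{super})`. -/
noncomputable def tilde (B : InvariantForm 𝔤) {I : Type*} [Fintype I] (x : Module.Basis I ℂ 𝔤)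
    (y : 𝔤) : (superIdeal₁ B).Quot :=
  evenEl B y - (1 / 2 : ℂ) • ∑ i, (superVA₁ B).prod (-1) (oddEl B ⁅y, x i⁆) (oddEl B (x i))

/-- The conditions `y ↦ ỹ`, `K ↦ 𝒦 - g |0⟩`, `ȳ ↦ ȳ`, `K' ↦ 𝒦̄ = |0⟩` on a homomorphism from
`Cur(𝔤) ⊕ R^{Cl}(𝔤̄)` to `V^1(R^{super})`. -/
structure IsTildeHom (B : InvariantForm 𝔤) {I : Type*} [Fintype I] (x : Module.Basis I ℂ 𝔤) (g : ℂ)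
    (φ : ((Cur B).directSum (RCl B)).HomToVA (superVA₁ B)) : Prop where
  map_even : ∀ y : 𝔤, φ.toLinearMap (CurrentData.el 0 y, 0) = tilde B x y
  map_K : φ.toLinearMap ((0, 1), 0) = toSuper₁ B (0, (1, 0)) - g • (superVA₁ B).vac
  map_odd : ∀ y : 𝔤, φ.toLinearMap (0, CurrentData.el 0 y) = oddEl B y
  map_K' : φ.toLinearMap (0, (0, 1)) = (superVA₁ B).vac

end Examples

end SuperAffine

open SuperAffine

/-!
The idea is the coset construction. The odd fields `x̄` are free fermions, and the quadratic fields
`J(x) = ½ ∑ᵢ :[x,xᵢ]‾ x̄ᵢ:` built from them act on the fermions by the adjoint representation,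
`[J(x)_λ ȳ] = [x,y]‾`, exactly as the even fields `x` do. Hence `x̃ = x - J(x)` commutes with all
fermions, and so with all `J(y)`. It follows that `[x̃_λ ỹ] = [x_λ y] - [J(x)_λ J(y)]`. The `J(x)`
are affine currents whose level is half the trace form of the adjoint representation, which by the
assumption on the Casimir operator is `g` times the invariant form. So the `x̃` are affine currents
of level `𝒦 - g |0⟩` that commute with the fermions; this gives `φ`, which is unique because its
values on generators are prescribed. (`IsFermion.actsAdjoint`, `IsFermion.isAffine_current`,
`IsAffine.sub`, `exists_isTildeHom`, `isTildeHom_unique`.)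

The isomorphism follows from universal properties, without any knowledge of bases of the algebras.
A homomorphism from `R` to a vertex algebra extends to `V(R)`
(`LieConformalSuperalgebra.HomToVA.lift`), descends to the quotient by an ideal whose generators it
kills, and two homomorphisms with commuting images define one on the tensor product
(`VertexAlgebra.tensorLift`). Thus `φ` induces `Φ : V^k(𝔤) ⊗ F(𝔤̄) → V^{k+g,1}(R^{super})`.
Conversely `x ↦ x ⊗ |0⟩ + |0⟩ ⊗ J(x)`, `x̄ ↦ |0⟩ ⊗ x̄` is a homomorphism from `R^{super}` with
`𝒦 ↦ (k + g) |0⟩`, and it induces a homomorphism in the other direction (`superToTensor`). The two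
are mutually inverse on generators, hence everywhere.

The universal properties rest on two facts about fields: Goddard's uniqueness theorem
(`VertexAlgebra.eq_of_isLocal`), which identifies the field of `a_{(-1)} b` with the normally
ordered product of the fields of `a` and `b` (`VertexAlgebra.prod_neg_one_eq_nop`), and Borcherds'
commutator formula (`VertexAlgebra.commutator`).
-/

namespace SuperAffine

/-! ### Locality of families of modes -/

section Locality

variable {V : Type*} [AddCommGroup V] [Module ℂ V]

theorem IsLocal.sub {ε : ℂ} {f f' g : ℤ → V →ₗ[ℂ] V} (h : IsLocal ε f g)
    (h' : IsLocal ε f' g) : IsLocal ε (f - f') g := by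
  rw [sub_eq_add_neg, ← neg_one_smul ℂ f']
  exact h.add_left (h'.smul_left _)

theorem IsCov.sub {T : V →ₗ[ℂ] V} {f g : ℤ → V →ₗ[ℂ] V} (hf : IsCov T f) (hg : IsCov T g) :
    IsCov T (f - g) := by
  intro n v
  have h1 := hf n v
  have h2 := hg n v
  simp only [Pi.sub_apply, LinearMap.sub_apply, map_sub, smul_sub, ← h1, ← h2]
  abel

theorem IsCov.id {T : V →ₗ[ℂ] V} : IsCov T (fun n => if n = -1 then LinearMap.id else 0) := by
  intro n v
  by_cases hn : n = -1
  · subst hn; simp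
  · by_cases hn' : n = 0
    · subst hn'; simp
    · simp [hn, show n - 1 ≠ -1 by omega]

/-- The field `Y(|0⟩, z) = id` is local to every field. -/
theorem isLocal_id_left (g : ℤ → V →ₗ[ℂ] V) :
    IsLocal 1 (fun n => if n = -1 then LinearMap.id else 0) g := by
  refine ⟨0, fun v => ?_⟩
  funext m n
  by_cases hm : m = -1
  · subst hm; simp
  · simp [hm]

/-- The derivative `∂_z f(z)` of a field local to `g` is local to `g`. -/
theorem IsLocal.deriv {ε : ℂ} {f g : ℤ → V →ₗ[ℂ] V} (h : IsLocal ε f g) :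
    IsLocal ε (fun n : ℤ => -(n : ℂ) • f (n - 1)) g := by
  obtain ⟨N, hN⟩ := h
  have key : ∀ (K : ℕ) (c : ℤ → ℤ → V), (mulSub ^ K) c = 0 →
      (mulSub ^ (K + 1)) (fun m n : ℤ => -(m : ℂ) • c (m - 1) n) = 0 := by
    intro K
    induction K with
    | zero =>
      intro c hc
      have hc : c = 0 := by simpa using hc
      subst hc
      simp only [Pi.zero_apply, smul_zero]
      exact map_zero _
    | succ K ih =>
      intro c hc
      rw [pow_succ, Module.End.mul_apply]
      have e : mulSub (fun m n : ℤ => -(m : ℂ) • c (m - 1) n) =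
          (fun m n : ℤ => -(m : ℂ) • mulSub c (m - 1) n) - c := by
        funext m n
        simp only [mulSub_apply, Pi.sub_apply, add_sub_cancel_right, sub_add_cancel]
        push_cast
        module
      rw [e, map_sub, hc, sub_zero]
      refine ih (mulSub c) ?_
      rw [← Module.End.mul_apply, ← pow_succ]
      exact hc
  refine ⟨N + 1, fun v => ?_⟩
  refine Eq.trans (congrArg _ ?_) (key N _ (hN v))
  funext m n
  simp only [LinearMap.smul_apply, map_smul, smul_sub, smul_comm ε]

/-- Iterated locality: a three-variable distribution killed by a product of powers of
`z - u` and `w - u`. -/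
def Local3 (c : ℤ → ℤ → ℤ → V) : Prop := ∃ M N : ℕ, (mul13 ^ M) ((mul23 ^ N) c) = 0

theorem mul13_pow_mul23_pow_mono {c : ℤ → ℤ → ℤ → V} {M N M' N' : ℕ} (hM : M ≤ M') (hN : N ≤ N')
    (h : (mul13 ^ M) ((mul23 ^ N) c) = 0) : (mul13 ^ M') ((mul23 ^ N') c) = 0 := by
  obtain ⟨p, rfl⟩ := Nat.exists_eq_add_of_le hM
  obtain ⟨q, rfl⟩ := Nat.exists_eq_add_of_le hN
  rw [add_comm M, add_comm N, pow_add, pow_add, Module.End.mul_apply, Module.End.mul_apply,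
    commute_apply ((commute_13_23 (V := V)).pow_pow M q), h, map_zero, map_zero]

theorem Local3.zero : Local3 (0 : ℤ → ℤ → ℤ → V) := ⟨0, 0, rfl⟩

theorem Local3.add {c d : ℤ → ℤ → ℤ → V} (hc : Local3 c) (hd : Local3 d) : Local3 (c + d) := by
  obtain ⟨M, N, h⟩ := hc
  obtain ⟨M', N', h'⟩ := hd
  refine ⟨max M M', max N N', ?_⟩
  rw [map_add, map_add, mul13_pow_mul23_pow_mono (le_max_left _ _) (le_max_left _ _) h,
    mul13_pow_mul23_pow_mono (le_max_right _ _) (le_max_right _ _) h', add_zero]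

theorem Local3.smul {c : ℤ → ℤ → ℤ → V} (r : ℂ) (hc : Local3 c) : Local3 (r • c) := by
  obtain ⟨M, N, h⟩ := hc
  exact ⟨M, N, by rw [map_smul, map_smul, h, smul_zero]⟩

theorem Local3.sum {ι : Type*} (s : Finset ι) {c : ι → ℤ → ℤ → ℤ → V}
    (h : ∀ i ∈ s, Local3 (c i)) : Local3 (∑ i ∈ s, c i) :=
  Finset.sum_induction _ Local3 (fun _ _ => Local3.add) Local3.zero h

/-- A distribution with the locality of `Local3` that has only nonnegative powers of `u`
vanishes. -/
theorem Local3.eq_zero {c : ℤ → ℤ → ℤ → V} (hc : Local3 c)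
    (h : ∀ l ≥ 0, ∀ m n, c m n l = 0) : c = 0 := by
  obtain ⟨M, N, hMN⟩ := hc
  have h' : ∀ l ≥ 0, ∀ m n, (mul23 ^ N) c m n l = 0 := by
    refine pow_induct (P := fun c : ℤ → ℤ → ℤ → V => ∀ l ≥ 0, ∀ m n, c m n l = 0) ?_ N c h
    intro d hd l hl m n
    show d _ _ _ - d _ _ _ = 0
    rw [hd l hl, hd (l + 1) (by omega), sub_zero]
  generalize hd : (mul23 ^ N) c = d at hMN h'
  have d0 : d = 0 := by
    funext m n l
    have e : (mulSub ^ M) (fun m l => d m n l) = 0 := by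
      funext m l
      rw [← mul13_pow, hMN]; rfl
    exact congrFun (congrFun (eq_zero_of_mulSub_pow e (M := 0) fun l hl m => h' l hl m n) m) l
  subst d0
  funext m n l
  have e : (mulSub ^ N) (fun n l => c m n l) = 0 := by
    funext n l
    rw [← mul23_pow, hd]; rfl
  exact congrFun (congrFun (eq_zero_of_mulSub_pow e (M := 0) fun l hl n => h l hl m n) n) l

/-- If `f` and `g` are local to `h`, then the composite `f(z) g(w)` has iterated locality
with `h(u)`. -/
theorem IsLocal.local3_comp {ε ε' : ℂ} {f g h : ℤ → V →ₗ[ℂ] V} (hf : IsLocal ε f h)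
    (hg : IsLocal ε' g h) (v : V) :
    Local3 (fun m n l => f m (g n (h l v)) - (ε * ε') • h l (f m (g n v))) := by
  obtain ⟨M, hM⟩ := hf
  obtain ⟨N, hN⟩ := hg
  have e : (fun m n l => f m (g n (h l v)) - (ε * ε') • h l (f m (g n v))) =
      (fun m n l => f m (g n (h l v) - ε' • h l (g n v))) +
        ε' • (fun m n l => f m (h l (g n v)) - ε • h l (f m (g n v))) := by
    funext m n l
    simp only [Pi.add_apply, Pi.smul_apply, map_sub, map_smul, smul_sub, smul_smul, mul_comm ε]
    abel
  rw [e]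
  refine Local3.add ⟨0, N, ?_⟩ (Local3.smul _ ⟨M, 0, ?_⟩)
  · funext m n l
    rw [pow_zero, Module.End.one_apply, mul23_pow, mulSub_pow_comp, hN v]; simp
  · funext m n l
    rw [pow_zero, Module.End.one_apply, mul13_pow, hM (g n v)]; rfl

/-- Iterated locality is symmetric in the variables `z` and `w`. -/
theorem Local3.swap {c : ℤ → ℤ → ℤ → V} (hc : Local3 c) : Local3 (fun m n l => c n m l) := by
  obtain ⟨M, N, h⟩ := hc
  refine ⟨N, M, ?_⟩
  have h13 : ∀ (K : ℕ) (d : ℤ → ℤ → ℤ → V) (m n l : ℤ),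
      (mul13 ^ K) (fun m n l => d n m l) m n l = (mul23 ^ K) d n m l := by
    intro K d m n l
    rw [mul13_pow, mul23_pow]
  have h23 : ∀ (K : ℕ) (d : ℤ → ℤ → ℤ → V),
      (mul23 ^ K) (fun m n l => d n m l) = fun m n l => (mul13 ^ K) d n m l := by
    intro K d
    funext m n l
    rw [mul23_pow, mul13_pow]
  funext m n l
  rw [h23, h13, commute_apply ((commute_13_23 (V := V)).symm.pow_pow N M), h]; rfl

/-- The distribution `∑ (m choose s) h_{m+n-s} z^{-m-1} w^{-n-1}`, that is
`h(w) ∂_w^s δ(z - w) / s!`, has iterated locality with any field local to `h`. -/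
theorem IsLocal.local3_delta {ε : ℂ} {f h : ℤ → V →ₗ[ℂ] V} (hf : IsLocal ε f h) (r : ℤ → ℂ)
    (s : ℤ) (v : V) : Local3 (fun m n l =>
      r m • (f (m + n - s) (h l v) - ε • h l (f (m + n - s) v))) := by
  obtain ⟨N, hN⟩ := hf
  have shift : ∀ (K : ℕ) (d : ℤ → ℤ → V) (t : ℤ) (n l : ℤ),
      (mulSub ^ K) (fun n l => d (n + t) l) n l = (mulSub ^ K) d (n + t) l := by
    intro K
    induction K with
    | zero => intro d t n l; rfl
    | succ K ih =>
      intro d t n l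
      rw [pow_succ', Module.End.mul_apply, Module.End.mul_apply, mulSub_apply, mulSub_apply,
        ih, ih, add_right_comm]
  refine ⟨0, N, ?_⟩
  funext m n l
  rw [pow_zero, Module.End.one_apply, mul23_pow]
  have e : (fun n l => r m • (f (m + n - s) (h l v) - ε • h l (f (m + n - s) v))) =
      r m • (fun n l => (fun n l => f n (h l v) - ε • h l (f n v)) (n + (m - s)) l) := by
    funext n l
    simp only [Pi.smul_apply, show n + (m - s) = m + n - s by ring]
  rw [e, map_smul, Pi.smul_apply, Pi.smul_apply,
    shift N (fun n l => f n (h l v) - ε • h l (f n v)) (m - s) n l, hN v]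
  simp

/-- `(z - w)^K` kills `∂_w^s δ(z - w)` for `s < K`. -/
theorem mulSub_pow_delta {K s : ℕ} (hs : s < K) (h : ℤ → V) : (mulSub ^ K) (fun m n : ℤ =>
    ((Ring.choose m s : ℤ) : ℂ) • h (m + n - s)) = 0 := by
  induction K generalizing s with
  | zero => omega
  | succ K ih =>
    rw [pow_succ, Module.End.mul_apply]
    cases s with
    | zero =>
      have : mulSub (fun m n : ℤ => ((Ring.choose m 0 : ℤ) : ℂ) • h (m + n - (0 : ℕ))) = 0 := by
        funext m n
        rw [mulSub_apply, Ring.choose_zero_right, Ring.choose_zero_right,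
          show m + 1 + n = m + (n + 1) by ring, sub_self]; rfl
      rw [this, map_zero]
    | succ s =>
      have : mulSub (fun m n : ℤ => ((Ring.choose m (s + 1) : ℤ) : ℂ) •
          h (m + n - ((s + 1 : ℕ) : ℤ))) =
          fun m n : ℤ => ((Ring.choose m s : ℤ) : ℂ) • h (m + n - s) := by
        funext m n
        rw [mulSub_apply, Ring.choose_succ_succ]
        push_cast
        rw [show m + 1 + n - (s + 1 : ℤ) = m + n - s by ring,
          show m + (n + 1) - (s + 1 : ℤ) = m + n - s by ring]
        module
      rw [this]
      exact ih (by omega)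

/-- A distribution killed by a power of `z - w` vanishes if it has only nonnegative powers of `z`:
what `z - w` kills depends only on the sum of the indices of the modes. -/
theorem eq_zero_of_mulSub_pow_left {N : ℕ} {c : ℤ → ℤ → V} (h : (mulSub ^ N) c = 0)
    (hc : ∀ m ≥ 0, ∀ n, c m n = 0) : c = 0 := by
  induction N generalizing c with
  | zero => simpa using h
  | succ N ih =>
    rw [pow_succ, Module.End.mul_apply] at h
    have h0 := ih h fun m hm n => by
      rw [mulSub_apply, hc m hm, hc (m + 1) (by omega), sub_zero]
    have key : ∀ k : ℕ, ∀ m n, c m n = c (m + k) (n - k) := by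
      intro k
      induction k with
      | zero => simp
      | succ k ih =>
        intro m n
        rw [ih m n]
        have := congrFun (congrFun h0 (m + k)) (n - k - 1)
        rw [mulSub_apply, Pi.zero_apply, Pi.zero_apply, sub_eq_zero, sub_add_cancel] at this
        push_cast
        rw [← this, add_assoc, sub_sub]
    funext m n
    rw [key (-m).toNat m n]
    exact hc _ (by omega) _

end Locality

/-! ### Borcherds' commutator formula and normally ordered products -/

namespace VertexAlgebra

section General

variable {V : Type*} [AddCommGroup V] [Module ℂ V] (A : VertexAlgebra V)

theorem T_vac : A.T A.vac = 0 := A.trans_vac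

theorem T_prod (n : ℤ) (a b : V) :
    A.T (A.prod n a b) = A.prod n a (A.T b) - (n : ℂ) • A.prod (n - 1) a b := by
  have h := A.cov a n b
  rw [neg_smul, sub_eq_iff_eq_add] at h
  rw [show A.T (A.prod n a b) = _ from h, VertexAlgebra.T]
  abel

theorem vac_mem : A.vac ∈ A.part 0 := by
  rw [SuperSpace.mem_part, A.par_vac]; simp [sgn]

theorem prod_mem {i j : ZMod 2} {a b : V} (ha : a ∈ A.part i) (hb : b ∈ A.part j) (n : ℤ) :
    A.prod n a b ∈ A.part (i + j) := by
  rw [SuperSpace.mem_part] at *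
  rw [A.par_prod, ha, hb, map_smul, map_smul, LinearMap.smul_apply, smul_smul, sgn_add]
  ring_nf

theorem T_mem {i : ZMod 2} {a : V} (ha : a ∈ A.part i) : A.T a ∈ A.part i := by
  have := A.prod_mem ha A.vac_mem (-2)
  rwa [add_zero] at this

/-- A family of modes local to all fields of a vertex algebra vanishes if it kills the vacuum. -/
theorem eq_zero_of_isLocal {f : ℤ → V →ₗ[ℂ] V}
    (hloc : ∀ j, ∀ b ∈ A.part j, ∃ ε, IsLocal ε f (fun n => A.prod n b))
    (hv : ∀ n, f n A.vac = 0) : f = 0 := by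
  funext n
  refine LinearMap.ext fun v => ?_
  refine A.hom_induction (p := fun v => f n v = 0) ?_ ?_ v
  · intro j b hb
    obtain ⟨ε, N, hN⟩ := hloc j b hb
    have h0 := hN A.vac
    have e : (fun m n => f m (A.prod n b A.vac) - ε • A.prod n b (f m A.vac)) =
        fun m n => f m (A.prod n b A.vac) := by
      funext m n
      rw [hv, map_zero, smul_zero, sub_zero]
    rw [e] at h0
    have := eq_zero_of_mulSub_pow h0 (M := 0)
      (fun n hn m => by rw [(A.creation b).1 n hn, map_zero])
    have h1 := congrFun (congrFun this n) (-1)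
    rwa [(A.creation b).2] at h1
  · intro v w hv hw
    rw [map_add, hv, hw, add_zero]

/-- A translation covariant field that maps the vacuum to a power series in `z` without negative
powers and without constant term kills the vacuum. -/
theorem modes_vac_eq_zero {f : ℤ → V →ₗ[ℂ] V} (hcov : IsCov A.T f)
    (h : ∀ n ≥ -1, f n A.vac = 0) (n : ℤ) : f n A.vac = 0 := by
  have hneg : ∀ k : ℕ, f (-1 - k) A.vac = 0 := by
    intro k
    induction k with
    | zero => exact h _ (by simp)
    | succ k ih =>
      have := hcov (-1 - k) A.vac
      rw [ih, A.T_vac, map_zero, map_zero, sub_zero] at this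
      have hk : (-((-1 - k : ℤ) : ℂ)) ≠ 0 := by
        have : ((k : ℂ) + 1) ≠ 0 := by exact_mod_cast Nat.succ_ne_zero k
        push_cast
        intro h
        apply this
        linear_combination h
      rw [show (-1 - ((k + 1 : ℕ) : ℤ)) = -1 - k - 1 by push_cast; ring]
      exact (smul_eq_zero.1 this.symm).resolve_left hk
  rcases lt_or_ge n 0 with hn | hn
  · obtain ⟨k, rfl⟩ : ∃ k : ℕ, n = -1 - k := ⟨(-1 - n).toNat, by omega⟩
    exact hneg k
  · exact h n (by omega)

/-- Goddard's uniqueness theorem: a translation covariant family of modes local to all fields is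
determined by the terms of its action on the vacuum with nonpositive powers of `z`. -/
theorem eq_of_isLocal {f g : ℤ → V →ₗ[ℂ] V} (ε : ZMod 2 → ℂ)
    (hf : ∀ j, ∀ b ∈ A.part j, IsLocal (ε j) f (fun n => A.prod n b))
    (hg : ∀ j, ∀ b ∈ A.part j, IsLocal (ε j) g (fun n => A.prod n b))
    (hfT : IsCov A.T f) (hgT : IsCov A.T g) (h : ∀ n ≥ -1, f n A.vac = g n A.vac) : f = g := by
  refine sub_eq_zero.1 (A.eq_zero_of_isLocal (fun j b hb => ⟨_, (hf j b hb).sub (hg j b hb)⟩) ?_)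
  refine A.modes_vac_eq_zero (hfT.sub hgT) fun n hn => ?_
  rw [Pi.sub_apply, LinearMap.sub_apply, h n hn, sub_self]

theorem prod_vac_left (n : ℤ) : A.prod n A.vac = if n = -1 then LinearMap.id else 0 := by
  refine congrFun (A.eq_of_isLocal (f := fun n => A.prod n A.vac) (fun _ => 1) ?_ ?_
    (A.cov A.vac) IsCov.id ?_) n
  · intro j b hb
    have := A.locality 0 j _ A.vac_mem b hb
    rwa [koszul_zero_left] at this
  · exact fun j b _ => isLocal_id_left _
  · intro n hn
    rcases hn.eq_or_lt with rfl | hn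
    · rw [(A.creation A.vac).2]; rfl
    · rw [(A.creation A.vac).1 n (by omega), if_neg (by omega)]; rfl

theorem prod_T (a : V) (n : ℤ) : A.prod n (A.T a) = -(n : ℂ) • A.prod (n - 1) a := by
  suffices h : ∀ i, ∀ a ∈ A.part i, A.prod n (A.T a) = -(n : ℂ) • A.prod (n - 1) a by
    refine A.hom_induction (p := fun a => A.prod n (A.T a) = -(n : ℂ) • A.prod (n - 1) a) h ?_ a
    intro a b ha hb
    rw [map_add, map_add, ha, hb, map_add, smul_add]
  intro i a ha
  refine congrFun (A.eq_of_isLocal (f := fun n => A.prod n (A.T a))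
    (g := fun n : ℤ => -(n : ℂ) • A.prod (n - 1) a) (fun j => koszul i j) ?_ ?_ (A.cov _) ?_ ?_) n
  · exact fun j b hb => A.locality i j _ (A.T_mem ha) b hb
  · exact fun j b hb => (A.locality i j a ha b hb).deriv
  · intro n v
    have h := A.T_prod (n - 1) a v
    simp only [LinearMap.smul_apply, map_smul, h]
    push_cast
    module
  · intro n hn
    rcases hn.eq_or_lt with rfl | hn
    · rw [(A.creation _).2]
      simp [VertexAlgebra.T]
    · rw [(A.creation _).1 n (by omega), LinearMap.smul_apply]
      rcases eq_or_ne n 0 with rfl | hn'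
      · simp
      · rw [(A.creation _).1 (n - 1) (by omega), smul_zero]

/-- The field of `a_{(-1)} b` is the normally ordered product of the fields of `a` and `b`. -/
theorem prod_neg_one_eq_nop {i j : ZMod 2} {a b : V} (ha : a ∈ A.part i) (hb : b ∈ A.part j) :
    (fun n => A.prod n (A.prod (-1) a b)) =
      nop (koszul i j) (fun n => A.prod n a) (fun n => A.prod n b) (A.isField a) (A.isField b) := by
  refine A.eq_of_isLocal (fun k => koszul (i + j) k) ?_ ?_ (A.cov _)
    (IsCov.nop _ _ (A.cov a) (A.cov b)) ?_
  · exact fun k c hc => A.locality _ _ _ (A.prod_mem ha hb _) c hc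
  · intro k c hc
    rw [koszul_add_left]
    exact IsLocal.nop _ _ (A.locality i j a ha b hb) (A.locality i k a ha c hc)
      (A.locality j k b hb c hc)
  · intro n hn
    have h := nop_vac (ε := koszul i j) (A.isField a) (A.isField b) (A.creation a).1
      (A.creation b).1
    rcases hn.eq_or_lt with rfl | hn
    · rw [h.2, (A.creation _).2, (A.creation b).2]
    · rw [h.1 n (by omega), (A.creation _).1 n (by omega)]

/-- The formula `(a_{(-1)} b)_{(n)} = ∑_{j ≥ 0} (a_{(-1-j)} b_{(n+j)} + p(a,b) b_{(n-1-j)} a_{(j)})`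
for `a` homogeneous. -/
theorem prod_prod_neg_one {i : ZMod 2} {a : V} (ha : a ∈ A.part i) (b : V) (n : ℤ) (v : V) :
    A.prod n (A.prod (-1) a b) v = half (fun n => A.prod n a) (fun n => A.prod n b) 0 n v +
      half (fun n => A.prod n (A.parPow i b)) (fun n => A.prod n a) n 0 v := by
  refine A.hom_induction (p := fun b => A.prod n (A.prod (-1) a b) v =
    half (fun n => A.prod n a) (fun n => A.prod n b) 0 n v +
      half (fun n => A.prod n (A.parPow i b)) (fun n => A.prod n a) n 0 v) ?_ ?_ b
  · intro j b hb
    have h := congrArg (fun f => f v) (congrFun (A.prod_neg_one_eq_nop ha hb) n)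
    rw [h, nop_apply]
    congr 1
    have e : A.parPow i b = koszul i j • b := by
      rcases zmod_two_cases i with rfl | rfl
      · simp [SuperSpace.parPow, koszul_zero_left]
      · simp only [SuperSpace.parPow, if_true, SuperSpace.mem_part.1 hb, koszul, one_mul]
    obtain ⟨N, hN⟩ := A.isField a v
    have hK : N ≤ (0 : ℤ) + (N.toNat : ℤ) := by omega
    rw [half_eq_sum _ n hN hK, half_eq_sum _ n hN hK, Finset.smul_sum, e]
    simp only [map_smul, LinearMap.smul_apply]
  · intro b c hb hc
    obtain ⟨N₁, h₁⟩ := A.isField a v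
    obtain ⟨N₂, h₂⟩ := A.isField b v
    obtain ⟨N₃, h₃⟩ := A.isField c v
    have h₂' : ∀ k ≥ max N₂ N₃, A.prod k b v = 0 := fun k hk => h₂ k (by omega)
    have h₃' : ∀ k ≥ max N₂ N₃, A.prod k c v = 0 := fun k hk => h₃ k (by omega)
    have h₄' : ∀ k ≥ max N₂ N₃, A.prod k (b + c) v = 0 := fun k hk => by
      rw [map_add, LinearMap.add_apply, h₂' k hk, h₃' k hk, add_zero]
    have hK : N₁ ≤ (0 : ℤ) + (N₁.toNat : ℤ) := by omega
    have hM : max N₂ N₃ ≤ n + ((max N₂ N₃ - n).toNat : ℤ) := by omega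
    rw [map_add, map_add, LinearMap.add_apply, hb, hc, half_eq_sum _ n h₁ hK, half_eq_sum _ n h₁ hK,
      half_eq_sum _ n h₁ hK, half_eq_sum _ 0 h₂' hM, half_eq_sum _ 0 h₃' hM,
      half_eq_sum _ 0 h₄' hM]
    simp only [map_add, LinearMap.add_apply, Finset.sum_add_distrib]
    abel

/-- The difference of the two sides of Borcherds' commutator formula for `a_{(m)}` and `b_{(n)}`,
its sum truncated at `N`. -/
noncomputable def commDefect (ε : ℂ) (a b : V) (N : ℕ) (m n : ℤ) : V →ₗ[ℂ] V :=
  A.prod m a ∘ₗ A.prod n b - ε • (A.prod n b ∘ₗ A.prod m a) -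
    ∑ s ∈ Finset.range N, ((Ring.choose m s : ℤ) : ℂ) • A.prod (m + n - s) (A.prod s a b)

theorem commDefect_apply (ε : ℂ) (a b : V) (N : ℕ) (m n : ℤ) (v : V) :
    A.commDefect ε a b N m n v = A.prod m a (A.prod n b v) - ε • A.prod n b (A.prod m a v) -
      ∑ s ∈ Finset.range N, ((Ring.choose m s : ℤ) : ℂ) •
        A.prod (m + n - s) (A.prod s a b) v := by
  simp [commDefect, LinearMap.sum_apply]

theorem T_commDefect (ε : ℂ) (a b : V) (N : ℕ) (m n : ℤ) (v : V) :
    A.T (A.commDefect ε a b N m n v) = A.commDefect ε a b N m n (A.T v) -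
      (m : ℂ) • A.commDefect ε a b N (m - 1) n v - (n : ℂ) • A.commDefect ε a b N m (n - 1) v := by
  have e : ∑ s ∈ Finset.range N, ((Ring.choose m s : ℤ) : ℂ) • (((m + n - s : ℤ) : ℂ) •
      A.prod (m + n - s - 1) (A.prod s a b) v) =
      (n : ℂ) • (∑ s ∈ Finset.range N, ((Ring.choose m s : ℤ) : ℂ) •
        A.prod (m + (n - 1) - s) (A.prod s a b) v) +
      (m : ℂ) • (∑ s ∈ Finset.range N, ((Ring.choose (m - 1) s : ℤ) : ℂ) •
        A.prod (m - 1 + n - s) (A.prod s a b) v) := by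
    rw [Finset.smul_sum, Finset.smul_sum, ← Finset.sum_add_distrib]
    refine Finset.sum_congr rfl fun s _ => ?_
    rw [show m + (n - 1) - (s : ℤ) = m + n - s - 1 by ring,
      show m - 1 + n - (s : ℤ) = m + n - s - 1 by ring, smul_smul, smul_smul, smul_smul, ← add_smul]
    congr 1
    have := congrArg (fun z : ℤ => (z : ℂ)) (LieConformalSuperalgebra.choose_deriv m s)
    push_cast at this ⊢
    linear_combination -this
  simp only [commDefect_apply, map_sub, map_smul, map_sum, T_prod, smul_sub,
    Finset.sum_sub_distrib, e]
  module

/-- The two sides of the commutator formula agree on the vacuum. For `m ≥ 0` and `n ≥ -1` this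
follows from the creation axiom, and translation covariance lowers `n`. -/
theorem commDefect_vac {i j : ZMod 2} {a b : V} (ha : a ∈ A.part i) (hb : b ∈ A.part j) {N : ℕ}
    (hN : ∀ s : ℕ, s ≥ N → A.prod s a b = 0) (m n : ℤ) :
    A.commDefect (koszul i j) a b N m n A.vac = 0 := by
  have hpos : ∀ m ≥ 0, ∀ n ≥ 0, A.commDefect (koszul i j) a b N m n A.vac = 0 := by
    intro m hm n hn
    rw [commDefect_apply, (A.creation a).1 m hm, (A.creation b).1 n hn, map_zero, map_zero,
      smul_zero, sub_zero, zero_sub, neg_eq_zero]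
    refine Finset.sum_eq_zero fun s _ => ?_
    rcases le_or_gt (s : ℤ) m with h | h
    · rw [(A.creation _).1 _ (by omega), smul_zero]
    · lift m to ℕ using hm
      rw [Ring.choose_natCast, Nat.choose_eq_zero_of_lt (by omega)]; simp
  have hone : ∀ m ≥ 0, A.commDefect (koszul i j) a b N m (-1) A.vac = 0 := by
    intro m hm
    lift m to ℕ using hm
    rw [commDefect_apply, (A.creation a).1 m (by omega), (A.creation b).2, map_zero,
      smul_zero, sub_zero, sub_eq_zero]
    by_cases hmN : m < N
    · rw [Finset.sum_eq_single m]
      · rw [Ring.choose_natCast, Nat.choose_self, show (m : ℤ) + -1 - m = -1 by ring,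
          (A.creation _).2]
        simp
      · intro s _ hs
        rcases lt_or_gt_of_ne hs with h | h
        · rw [(A.creation _).1 _ (by omega), smul_zero]
        · rw [Ring.choose_natCast, Nat.choose_eq_zero_of_lt h]; simp
      · intro h; exact absurd (Finset.mem_range.2 hmN) h
    · rw [hN m (by omega), Finset.sum_eq_zero]
      intro s hs
      have := Finset.mem_range.1 hs
      rw [(A.creation _).1 _ (by omega), smul_zero]
  have hneg : ∀ k : ℕ, ∀ m ≥ 0, A.commDefect (koszul i j) a b N m (-1 - k) A.vac = 0 := by
    intro k
    induction k with
    | zero => intro m hm; simpa using hone m hm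
    | succ k ih =>
      intro m hm
      have h := A.T_commDefect (koszul i j) a b N m (-1 - k) A.vac
      rw [ih m hm, A.T_vac, map_zero, map_zero, zero_sub] at h
      have h0 : (m : ℂ) • A.commDefect (koszul i j) a b N (m - 1) (-1 - k) A.vac = 0 := by
        rcases hm.eq_or_lt with rfl | hm'
        · simp
        · rw [ih (m - 1) (by omega), smul_zero]
      rw [h0, neg_zero, zero_sub, eq_comm, neg_eq_zero] at h
      have hk : ((-1 - k : ℤ) : ℂ) ≠ 0 := by
        exact_mod_cast (show (-1 - k : ℤ) ≠ 0 by omega)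
      rw [show (-1 - ((k + 1 : ℕ) : ℤ)) = -1 - k - 1 by push_cast; ring]
      exact (smul_eq_zero.1 h).resolve_left hk
  have hall : ∀ m ≥ 0, ∀ n, A.commDefect (koszul i j) a b N m n A.vac = 0 := by
    intro m hm n
    rcases lt_or_ge n 0 with hn | hn
    · obtain ⟨k, rfl⟩ : ∃ k : ℕ, n = -1 - k := ⟨(-1 - n).toNat, by omega⟩
      exact hneg k m hm
    · exact hpos m hm n hn
  -- locality extends the vanishing to `m < 0`
  obtain ⟨K, hK⟩ := A.locality i j a ha b hb
  have hloc : (mulSub ^ (max K N)) (fun m n => A.commDefect (koszul i j) a b N m n A.vac) = 0 := by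
    have e : (fun m n => A.commDefect (koszul i j) a b N m n A.vac) =
        (fun m n => A.prod m a (A.prod n b A.vac) - koszul i j • A.prod n b (A.prod m a A.vac)) -
        ∑ s ∈ Finset.range N, fun m n : ℤ => ((Ring.choose m s : ℤ) : ℂ) •
          A.prod (m + n - s) (A.prod s a b) A.vac := by
      funext m n
      rw [commDefect_apply, Pi.sub_apply, Pi.sub_apply, Finset.sum_apply, Finset.sum_apply]
    rw [e, map_sub, map_sum, mulSub_pow_mono (le_max_left _ _) (hK A.vac), zero_sub, neg_eq_zero]
    refine Finset.sum_eq_zero fun s hs => ?_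
    exact mulSub_pow_delta (lt_of_lt_of_le (Finset.mem_range.1 hs) (le_max_right _ _))
      (fun k => A.prod k (A.prod s a b) A.vac)
  exact congrFun (congrFun (eq_zero_of_mulSub_pow_left hloc hall) m) n

/-- Borcherds' commutator formula
`[a_{(m)}, b_{(n)}] = ∑_{s ≥ 0} (m choose s) (a_{(s)} b)_{(m+n-s)}`. The difference of the two sides
kills the vacuum and has iterated locality with every field, hence it vanishes. -/
theorem commutator {i j : ZMod 2} {a b : V} (ha : a ∈ A.part i) (hb : b ∈ A.part j) {N : ℕ}
    (hN : ∀ s : ℕ, s ≥ N → A.prod s a b = 0) (m n : ℤ) (v : V) :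
    A.prod m a (A.prod n b v) = koszul i j • A.prod n b (A.prod m a v) +
      ∑ s ∈ Finset.range N, ((Ring.choose m s : ℤ) : ℂ) •
        A.prod (m + n - s) (A.prod s a b) v := by
  have key : ∀ v, A.commDefect (koszul i j) a b N m n v = 0 := by
    intro v
    refine A.hom_induction (p := fun v => A.commDefect (koszul i j) a b N m n v = 0) ?_ ?_ v
    · intro k c hc
      have hL : Local3 (fun m n l =>
          A.commDefect (koszul i j) a b N m n (A.prod l c A.vac) -
          koszul (i + j) k • A.prod l c (A.commDefect (koszul i j) a b N m n A.vac)) := by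
        have h1 := (A.locality i k a ha c hc).local3_comp (A.locality j k b hb c hc) A.vac
        have h2 := ((A.locality j k b hb c hc).local3_comp (A.locality i k a ha c hc) A.vac).swap
        have h3 : ∀ s ∈ Finset.range N, Local3 (fun m n l => ((Ring.choose m s : ℤ) : ℂ) •
            (A.prod (m + n - s) (A.prod s a b) (A.prod l c A.vac) -
              koszul (i + j) k • A.prod l c (A.prod (m + n - s) (A.prod s a b) A.vac))) :=
          fun s _ => (A.locality (i + j) k _ (A.prod_mem ha hb s) c hc).local3_delta
            (fun m => ((Ring.choose m s : ℤ) : ℂ)) s A.vac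
        convert (h1.add (h2.smul (-koszul i j))).add ((Local3.sum _ h3).smul (-1)) using 1
        funext m n l
        simp only [commDefect_apply, Pi.add_apply, Pi.smul_apply, Finset.sum_apply, map_sub,
          map_smul, map_sum, smul_sub, Finset.sum_sub_distrib, Finset.smul_sum, koszul_add_left]
        have e : ∀ (x : ℕ) (y : V), (koszul i k * koszul j k) • ((Ring.choose m x : ℤ) : ℂ) • y =
            ((Ring.choose m x : ℤ) : ℂ) • (koszul i k * koszul j k) • y :=
          fun _ _ => smul_comm _ _ _
        simp only [e, neg_smul, one_smul, Finset.sum_neg_distrib, mul_comm (koszul j k)]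
        module
      have h0 := hL.eq_zero fun l hl m n => by
        rw [(A.creation c).1 l hl, A.commDefect_vac ha hb hN, map_zero, map_zero, smul_zero,
          sub_zero]
      have h1 := congrFun (congrFun (congrFun h0 m) n) (-1)
      rw [(A.creation c).2, A.commDefect_vac ha hb hN, map_zero, smul_zero, sub_zero] at h1
      exact h1
    · intro v w hv hw
      rw [map_add, hv, hw, add_zero]
  have h := key v
  rw [commDefect_apply, sub_eq_zero, sub_eq_iff_eq_add] at h
  rw [h, add_comm]

theorem exists_prod_eq_zero (a b : V) : ∃ N : ℕ, ∀ s : ℕ, s ≥ N → A.prod s a b = 0 := by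
  obtain ⟨N, hN⟩ := A.isField a b
  exact ⟨N.toNat, fun s hs => hN s (by omega)⟩

end General

end VertexAlgebra


/-! ### Commuting fields -/

section Commuting

variable {V : Type*} [AddCommGroup V] [Module ℂ V]

namespace VertexAlgebra

variable (A : VertexAlgebra V)

/-- If `[a_λ b] = 0`, all modes of `a` and `b` supercommute. -/
theorem super_comm {i j : ZMod 2} {a b : V} (ha : a ∈ A.part i) (hb : b ∈ A.part j)
    (h : ∀ s : ℕ, A.prod s a b = 0) (m n : ℤ) (v : V) :
    A.prod m a (A.prod n b v) = koszul i j • A.prod n b (A.prod m a v) := by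
  rw [A.commutator ha hb (N := 0) (fun s _ => h s)]
  simp

theorem prod_neg_one_comm {i j : ZMod 2} {a b : V} (ha : a ∈ A.part i) (hb : b ∈ A.part j)
    (h : ∀ s : ℕ, A.prod s a b = 0) :
    A.prod (-1) a b = koszul i j • A.prod (-1) b a := by
  have := A.super_comm ha hb h (-1) (-1) A.vac
  rwa [(A.creation a).2, (A.creation b).2] at this

theorem prod_eq_zero_symm {i j : ZMod 2} {a b : V} (ha : a ∈ A.part i) (hb : b ∈ A.part j)
    (h : ∀ s : ℕ, A.prod s a b = 0) (s : ℕ) : A.prod s b a = 0 := by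
  have := A.super_comm ha hb h (-1) s A.vac
  rw [(A.creation a).2, (A.creation b).1 _ (by omega), map_zero] at this
  have h2 := congrArg (fun x => koszul i j • x) this
  simpa only [smul_smul, koszul_mul_self, one_smul, smul_zero] using h2.symm

/-- Two graded subspaces, given as the images of `F` and `G`, whose fields commute in one order
commute in the other. -/
theorem prod_eq_zero_symm_of_graded {R R' : Type*} [AddCommGroup R] [Module ℂ R]
    [AddCommGroup R'] [Module ℂ R'] (S : SuperSpace R) (S' : SuperSpace R') {F : R →ₗ[ℂ] V}
    {G : R' →ₗ[ℂ] V} (hF : ∀ r, F (S.par r) = A.par (F r)) (hG : ∀ r, G (S'.par r) = A.par (G r))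
    (h : ∀ r s (n : ℕ), A.prod n (F r) (G s) = 0) (r : R) (s : R') (n : ℕ) :
    A.prod n (G s) (F r) = 0 := by
  refine S.hom_induction (p := fun r => A.prod n (G s) (F r) = 0) ?_ ?_ r
  · intro i r hr
    refine S'.hom_induction (p := fun s => A.prod n (G s) (F r) = 0) ?_ ?_ s
    · intro j s hs
      refine A.prod_eq_zero_symm (i := i) (j := j) ?_ ?_ (h r s) n
      · rw [SuperSpace.mem_part] at *; rw [← hF, hr, map_smul]
      · rw [SuperSpace.mem_part] at *; rw [← hG, hs, map_smul]
    · intro v w hv hw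
      rw [map_add, map_add, LinearMap.add_apply, hv, hw, add_zero]
  · intro v w hv hw
    rw [map_add, map_add, hv, hw, add_zero]

/-- The field of a translation invariant vector is constant. -/
theorem prod_of_T_eq_zero {c : V} (hc : A.T c = 0) (n : ℕ) : A.prod n c = 0 := by
  have h := A.prod_T c (n + 1)
  rw [hc, map_zero, add_sub_cancel_right, eq_comm, smul_eq_zero] at h
  refine h.resolve_left ?_
  push_cast
  rw [neg_eq_zero]
  exact_mod_cast Nat.succ_ne_zero n

/-- A translation invariant vector is killed by all `b_{(n)}` with `n ≥ 0`: translation covariance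
propagates the vanishing from large `n` downwards. -/
theorem prod_apply_of_T_eq_zero {c : V} (hc : A.T c = 0) (b : V) (n : ℕ) : A.prod n b c = 0 := by
  obtain ⟨N, hN⟩ := A.exists_prod_eq_zero b c
  have key : ∀ k : ℕ, A.prod ((N - k : ℕ) : ℤ) b c = 0 := by
    intro k
    induction k with
    | zero => exact hN _ le_rfl
    | succ k ih =>
      rcases Nat.eq_zero_or_pos (N - k) with h | h
      · rwa [show N - (k + 1) = N - k by omega]
      · have := A.T_prod ((N - k : ℕ) : ℤ) b c
        rw [ih, hc, map_zero, map_zero, zero_sub, eq_comm, neg_eq_zero, smul_eq_zero] at this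
        rw [show (((N - (k + 1) : ℕ)) : ℤ) = ((N - k : ℕ) : ℤ) - 1 by omega]
        refine this.resolve_left ?_
        exact_mod_cast h.ne'
  rcases le_or_gt N n with h | h
  · exact hN n h
  · have := key (N - n)
    rwa [show N - (N - n) = n by omega] at this

theorem prod_T_left_eq_zero {a b : V} (h : ∀ n : ℕ, A.prod n a b = 0) (n : ℕ) :
    A.prod n (A.T a) b = 0 := by
  rw [prod_T]
  cases n with
  | zero => simp
  | succ n =>
    rw [LinearMap.smul_apply, show ((n + 1 : ℕ) : ℤ) - 1 = n by push_cast; ring, h, smul_zero]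

theorem prod_T_right (n : ℕ) (a b : V) :
    A.prod n a (A.T b) = A.T (A.prod n a b) + (n : ℂ) • A.prod ((n : ℤ) - 1) a b := by
  rw [T_prod]; simp

theorem prod_T_right_eq_zero {a b : V} (h : ∀ n : ℕ, A.prod n a b = 0) (n : ℕ) :
    A.prod n a (A.T b) = 0 := by
  rw [prod_T_right, h, map_zero, zero_add]
  cases n with
  | zero => simp
  | succ n => rw [show ((n + 1 : ℕ) : ℤ) - 1 = n by push_cast; ring, h, smul_zero]

end VertexAlgebra

end Commuting

/-! ### Homomorphisms of vertex algebras -/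

section Hom

variable {V : Type*} [AddCommGroup V] [Module ℂ V] {W : Type*} [AddCommGroup W] [Module ℂ W]
  {U : Type*} [AddCommGroup U] [Module ℂ U]

/-- A homomorphism of vertex algebras: an even linear map that preserves the vacuum and all
`n`-th products. -/
structure VertexAlgebra.Hom (A : VertexAlgebra V) (B : VertexAlgebra W) extends V →ₗ[ℂ] W where
  map_par' : ∀ a, toFun (A.par a) = B.par (toFun a)
  map_vac' : toFun A.vac = B.vac
  map_prod' : ∀ n a b, toFun (A.prod n a b) = B.prod n (toFun a) (toFun b)

theorem half_map (F : V →ₗ[ℂ] W) {f g : ℤ → V →ₗ[ℂ] V} {f' g' : ℤ → W →ₗ[ℂ] W}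
    (hg : IsField g) (hf : ∀ n v, F (f n v) = f' n (F v)) (hg' : ∀ n v, F (g n v) = g' n (F v))
    (m n : ℤ) (v : V) : F (half f g m n v) = half f' g' m n (F v) := by
  obtain ⟨N, hN⟩ := hg v
  have hN' : ∀ k ≥ N, g' k (F v) = 0 := fun k hk => by rw [← hg', hN k hk, map_zero]
  have hK : N ≤ n + ((N - n).toNat : ℤ) := by omega
  rw [half_eq_sum f m hN hK, half_eq_sum f' m hN' hK, map_sum]
  exact Finset.sum_congr rfl fun k _ => by rw [hf, hg']

theorem nop_map (F : V →ₗ[ℂ] W) {f g : ℤ → V →ₗ[ℂ] V} {f' g' : ℤ → W →ₗ[ℂ] W} (ε : ℂ)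
    (hf : IsField f) (hg : IsField g) (hf' : IsField f') (hg' : IsField g')
    (hFf : ∀ n v, F (f n v) = f' n (F v)) (hFg : ∀ n v, F (g n v) = g' n (F v))
    (n : ℤ) (v : V) : F (nop ε f g hf hg n v) = nop ε f' g' hf' hg' n (F v) := by
  rw [nop_apply, nop_apply, map_add, map_smul, half_map F hg hFf hFg, half_map F hf hFg hFf]

namespace VertexAlgebra

variable {A : VertexAlgebra V} {B : VertexAlgebra W} {C : VertexAlgebra U}

namespace Hom

theorem map_par (F : Hom A B) (a : V) : F.toLinearMap (A.par a) = B.par (F.toLinearMap a) :=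
  F.map_par' a

theorem map_vac (F : Hom A B) : F.toLinearMap A.vac = B.vac := F.map_vac'

theorem map_prod (F : Hom A B) (n : ℤ) (a b : V) :
    F.toLinearMap (A.prod n a b) = B.prod n (F.toLinearMap a) (F.toLinearMap b) :=
  F.map_prod' n a b

theorem map_T (F : Hom A B) (a : V) : F.toLinearMap (A.T a) = B.T (F.toLinearMap a) := by
  simp only [VertexAlgebra.T, LinearMap.flip_apply, F.map_prod, F.map_vac]

theorem map_mem (F : Hom A B) {i : ZMod 2} {a : V} (ha : a ∈ A.part i) :
    F.toLinearMap a ∈ B.part i := by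
  rw [SuperSpace.mem_part] at *
  rw [← F.map_par, ha, map_smul]

/-- The composition of two homomorphisms. -/
def comp (G : Hom B C) (F : Hom A B) : Hom A C where
  toLinearMap := G.toLinearMap ∘ₗ F.toLinearMap
  map_par' a := (congrArg _ (F.map_par a)).trans (G.map_par _)
  map_vac' := (congrArg _ F.map_vac).trans G.map_vac
  map_prod' n a b := (congrArg _ (F.map_prod n a b)).trans (G.map_prod n _ _)

/-- The kernel of a homomorphism. -/
def ker (F : Hom A B) : A.Ideal where
  toSubmodule := LinearMap.ker F.toLinearMap
  par_mem v hv := by rw [LinearMap.mem_ker] at *; rw [F.map_par, hv, map_zero]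
  prod_mem_left n a v hv := by rw [LinearMap.mem_ker] at *; rw [F.map_prod, hv, map_zero]
  prod_mem_right n a v hv := by
    rw [LinearMap.mem_ker] at *; rw [F.map_prod, hv, map_zero, LinearMap.zero_apply]

theorem idealGen_le (F : Hom A B) {S : Set V} (h : ∀ s ∈ S, F.toLinearMap s = 0) :
    (A.idealGen S).toSubmodule ≤ LinearMap.ker F.toLinearMap := by
  intro v hv
  simp only [VertexAlgebra.idealGen, Submodule.mem_iInf] at hv
  exact hv ⟨F.ker, fun s hs => h s hs⟩

/-- The homomorphism induced on the quotient by an ideal whose generators are sent to zero. -/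
def quotientLift (F : Hom A B) {S : Set V} (h : ∀ s ∈ S, F.toLinearMap s = 0) :
    Hom (A.quotient (A.idealGen S)) B where
  toLinearMap := (A.idealGen S).toSubmodule.liftQ F.toLinearMap (F.idealGen_le h)
  map_par' a := by
    obtain ⟨a, rfl⟩ := Submodule.Quotient.mk_surjective _ a
    exact F.map_par a
  map_vac' := F.map_vac
  map_prod' n a b := by
    obtain ⟨a, rfl⟩ := Submodule.Quotient.mk_surjective _ a
    obtain ⟨b, rfl⟩ := Submodule.Quotient.mk_surjective _ b
    exact F.map_prod n a b

end Hom

/-- The projection of a vertex algebra onto its quotient by an ideal. -/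
def Ideal.mkHom (I : A.Ideal) : Hom A (A.quotient I) where
  toLinearMap := I.toSubmodule.mkQ
  map_par' _ := rfl
  map_vac' := rfl
  map_prod' _ _ _ := rfl

/-- The projection between the quotients by two ideals, one contained in the other. -/
def Ideal.factorHom {I J : A.Ideal} (h : I.toSubmodule ≤ J.toSubmodule) :
    Hom (A.quotient I) (A.quotient J) where
  toLinearMap := Submodule.factor h
  map_par' a := by
    obtain ⟨a, rfl⟩ := Submodule.Quotient.mk_surjective _ a
    rfl
  map_vac' := rfl
  map_prod' n a b := by
    obtain ⟨a, rfl⟩ := Submodule.Quotient.mk_surjective _ a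
    obtain ⟨b, rfl⟩ := Submodule.Quotient.mk_surjective _ b
    rfl

end VertexAlgebra

end Hom

/-! ### The universal property of the enveloping vertex algebra -/

section Lift

variable {R : Type*} [AddCommGroup R] [Module ℂ R] {L : LieConformalSuperalgebra R}
  {V : Type*} [AddCommGroup V] [Module ℂ V] {A : VertexAlgebra V}
  {W : Type*} [AddCommGroup W] [Module ℂ W] {B : VertexAlgebra W}

namespace LieConformalSuperalgebra

theorem ι_par (a : R) : L.ι (L.par a) = L.envelope.par (L.ι a) :=
  ((Env.par_gen L a (-1) (Env.vac L)).trans (by rw [Env.par_vac]; rfl)).symm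

theorem ι_mem {i : ZMod 2} {a : R} (ha : a ∈ L.part i) : L.ι a ∈ L.envelope.part i := by
  rw [SuperSpace.mem_part] at *
  rw [← ι_par, ha, map_smul]

namespace HomToVA

theorem coe_par (φ : L.HomToVA A) (a : R) : φ.toLinearMap (L.par a) = A.par (φ.toLinearMap a) :=
  φ.map_par a

theorem coe_T (φ : L.HomToVA A) (a : R) : φ.toLinearMap (L.T a) = A.T (φ.toLinearMap a) :=
  φ.map_T a

theorem coe_prod (φ : L.HomToVA A) (n : ℕ) (a b : R) :
    φ.toLinearMap (L.prod n a b) = A.prod n (φ.toLinearMap a) (φ.toLinearMap b) :=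
  φ.map_prod n a b

theorem map_mem (φ : L.HomToVA A) {i : ZMod 2} {a : R} (ha : a ∈ L.part i) :
    φ.toLinearMap a ∈ A.part i := by
  rw [SuperSpace.mem_part] at *
  rw [← φ.coe_par, ha, map_smul]

theorem ext_of_toLinearMap {φ ψ : L.HomToVA A} (h : φ.toLinearMap = ψ.toLinearMap) : φ = ψ := by
  cases φ; cases ψ; cases h; rfl

/-- The composition of a homomorphism from a Lie conformal superalgebra to a vertex algebra with
a homomorphism of vertex algebras. -/
def comp (F : VertexAlgebra.Hom A B) (φ : L.HomToVA A) : L.HomToVA B where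
  toLinearMap := F.toLinearMap ∘ₗ φ.toLinearMap
  map_par a := (congrArg _ (φ.coe_par a)).trans (F.map_par _)
  map_T a := (congrArg _ (φ.coe_T a)).trans (F.map_T _)
  map_prod n a b := (congrArg _ (φ.coe_prod n a b)).trans (F.map_prod n _ _)

theorem comp_apply (F : VertexAlgebra.Hom A B) (φ : L.HomToVA A) (a : R) :
    (φ.comp F).toLinearMap a = F.toLinearMap (φ.toLinearMap a) := rfl

/-- The representation of the algebra of modes on a vertex algebra defined by a homomorphism
of a Lie conformal superalgebra to it. -/
noncomputable def modeAct (φ : L.HomToVA A) : L.ModeAlg →ₐ[ℂ] Module.End ℂ V :=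
  L.modeLift (fun a n => A.prod n (φ.toLinearMap a))
    (fun a b n => by rw [map_add, map_add]) (fun c a n => by rw [map_smul, map_smul])
    (fun a n => by rw [φ.coe_T, A.prod_T])
    (fun i j a b ha hb N hN m n => by
      refine LinearMap.ext fun v => ?_
      have := A.commutator (φ.map_mem ha) (φ.map_mem hb) (N := N)
        (fun s hs => by rw [← φ.coe_prod, hN s hs, map_zero]) m n v
      simp only [Module.End.mul_apply, LinearMap.add_apply, LinearMap.smul_apply,
        LinearMap.sum_apply, φ.coe_prod]
      exact this)

theorem modeAct_mode (φ : L.HomToVA A) (a : R) (n : ℤ) :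
    φ.modeAct (L.mode a n) = A.prod n (φ.toLinearMap a) :=
  modeLift_mode _ _ _ _ _ _ _ _

/-- The linear map `V(R) → A` induced by a homomorphism `R → A`. -/
noncomputable def liftLinear (φ : L.HomToVA A) : L.Env →ₗ[ℂ] V :=
  L.annih.liftQ (LinearMap.applyₗ A.vac ∘ₗ φ.modeAct.toLinearMap) (by
    rw [annih, Submodule.span_le]
    rintro _ ⟨u, a, n, hn, rfl⟩
    show φ.modeAct (u * L.mode a n) A.vac = 0
    rw [map_mul, Module.End.mul_apply, modeAct_mode, (A.creation _).1 n hn, map_zero])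

theorem liftLinear_mk (φ : L.HomToVA A) (u : L.ModeAlg) :
    φ.liftLinear (Env.mk L u) = φ.modeAct u A.vac := rfl

theorem liftLinear_vac (φ : L.HomToVA A) : φ.liftLinear (Env.vac L) = A.vac := by
  rw [Env.vac, liftLinear_mk, map_one]; rfl

theorem liftLinear_gen (φ : L.HomToVA A) (a : R) (n : ℤ) (v : L.Env) :
    φ.liftLinear (Env.gen L a n v) = A.prod n (φ.toLinearMap a) (φ.liftLinear v) := by
  obtain ⟨u, rfl⟩ := Env.mk_surjective L v
  rw [Env.gen, Env.act_mk, liftLinear_mk, liftLinear_mk, map_mul, modeAct_mode]; rfl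

theorem liftLinear_par (φ : L.HomToVA A) (v : L.Env) :
    φ.liftLinear (Env.par L v) = A.par (φ.liftLinear v) := by
  have h : v ∈ LinearMap.eqLocus (φ.liftLinear ∘ₗ Env.par L) (A.par ∘ₗ φ.liftLinear) := by
    refine Env.cyclic L _ ?_ ?_ v
    · rw [LinearMap.mem_eqLocus, LinearMap.comp_apply, LinearMap.comp_apply, Env.par_vac,
        liftLinear_vac, A.par_vac]
    · intro i a _ v hv
      rw [LinearMap.mem_eqLocus, LinearMap.comp_apply, LinearMap.comp_apply] at *
      rw [Env.par_gen, liftLinear_gen, liftLinear_gen, hv, φ.coe_par, A.par_prod]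
  exact h

/-- The induced map preserves all products. As `V(R)` is generated from the vacuum by the operators
`a_{(-1)}`, one concludes by the formula for the field of a normally ordered product. It
involves the field of the parity image of `v`, so the induction treats `v` and `par v` together. -/
theorem liftLinear_prod (φ : L.HomToVA A) (v : L.Env) : ∀ n b,
    φ.liftLinear (L.envelope.prod n v b) = A.prod n (φ.liftLinear v) (φ.liftLinear b) := by
  have step : ∀ i, ∀ a ∈ L.part i, ∀ v : L.Env,
      (∀ n b, φ.liftLinear (L.envelope.prod n v b) =
        A.prod n (φ.liftLinear v) (φ.liftLinear b)) →
      (∀ n b, φ.liftLinear (L.envelope.prod n (Env.par L v) b) =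
        A.prod n (φ.liftLinear (Env.par L v)) (φ.liftLinear b)) →
      ∀ n b, φ.liftLinear (L.envelope.prod n (Env.gen L a (-1) v) b) =
        A.prod n (φ.liftLinear (Env.gen L a (-1) v)) (φ.liftLinear b) := by
    intro i a ha v hv hv' n b
    have hg : ∀ n b, φ.liftLinear (L.envelope.prod n (L.ι a) b) =
        A.prod n (φ.toLinearMap a) (φ.liftLinear b) := fun n b => by
      rw [L.envelope_prod_ι, liftLinear_gen]
    have hp : ∀ n b, φ.liftLinear (L.envelope.prod n (L.envelope.parPow i v) b) =
        A.prod n (A.parPow i (φ.liftLinear v)) (φ.liftLinear b) := by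
      intro n b
      rcases zmod_two_cases i with rfl | rfl
      · exact hv n b
      · refine (hv' n b).trans ?_
        rw [liftLinear_par]; rfl
    rw [liftLinear_gen, A.prod_prod_neg_one (φ.map_mem ha), ← L.envelope_prod_ι,
      L.envelope.prod_prod_neg_one (L.ι_mem ha), map_add,
      half_map φ.liftLinear (L.envelope.isField v) hg hv,
      half_map φ.liftLinear (L.envelope.isField (L.ι a)) hp hg]
  let S : Submodule ℂ L.Env :=
    { carrier := {v | (∀ n b, φ.liftLinear (L.envelope.prod n v b) =
          A.prod n (φ.liftLinear v) (φ.liftLinear b)) ∧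
        ∀ n b, φ.liftLinear (L.envelope.prod n (Env.par L v) b) =
          A.prod n (φ.liftLinear (Env.par L v)) (φ.liftLinear b)}
      add_mem' := fun {v w} hv hw => by
        constructor
        · intro n b
          simp only [map_add, LinearMap.add_apply, hv.1, hw.1]
        · intro n b
          simp only [map_add, LinearMap.add_apply, hv.2, hw.2]
      zero_mem' := by
        constructor <;> intro n b <;> simp only [map_zero, LinearMap.zero_apply]
      smul_mem' := fun c v hv => by
        constructor
        · intro n b
          simp only [map_smul, LinearMap.smul_apply, hv.1]
        · intro n b
          simp only [map_smul, LinearMap.smul_apply, hv.2] }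
  have h0 : ∀ n b, φ.liftLinear (L.envelope.prod n (Env.vac L) b) =
      A.prod n (φ.liftLinear (Env.vac L)) (φ.liftLinear b) := by
    intro n b
    have := L.envelope.prod_vac_left n
    rw [show Env.vac L = L.envelope.vac from rfl, this, show L.envelope.vac = Env.vac L from rfl,
      liftLinear_vac, A.prod_vac_left]
    split_ifs <;> simp
  have h : v ∈ S := by
    refine Env.cyclic L S ⟨h0, ?_⟩ ?_ v
    · rw [Env.par_vac]; exact h0
    · intro i a ha v hv
      refine ⟨step i a ha v hv.1 hv.2, ?_⟩
      rw [Env.par_gen]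
      refine step i _ ?_ _ hv.2 (by rw [Env.par_par]; exact hv.1)
      rw [SuperSpace.mem_part] at *; rw [ha, map_smul, ha]
  exact h.1

/-- The universal property of `V(R)`: a homomorphism from `R` to a vertex algebra extends to
`V(R)`. -/
noncomputable def lift (φ : L.HomToVA A) : VertexAlgebra.Hom L.envelope A where
  toLinearMap := φ.liftLinear
  map_par' := φ.liftLinear_par
  map_vac' := φ.liftLinear_vac
  map_prod' n a b := φ.liftLinear_prod a n b

theorem lift_ι (φ : L.HomToVA A) (a : R) : φ.lift.toLinearMap (L.ι a) = φ.toLinearMap a := by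
  refine (φ.liftLinear_gen a (-1) (Env.vac L)).trans ?_
  rw [liftLinear_vac, (A.creation _).2]

theorem lift_gen (φ : L.HomToVA A) (a : R) (n : ℤ) (v : L.Env) :
    φ.lift.toLinearMap (Env.gen L a n v) = A.prod n (φ.toLinearMap a) (φ.lift.toLinearMap v) :=
  φ.liftLinear_gen a n v

/-- A vector whose field commutes with the fields of the image of `R` commutes with the vertex
algebra that they generate. -/
theorem prod_lift_eq_zero (φ : L.HomToVA A) {j : ZMod 2} {b : V} (hb : b ∈ A.part j)
    (h : ∀ r (n : ℕ), A.prod n b (φ.toLinearMap r) = 0) (v : L.Env) (n : ℕ) :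
    A.prod n b (φ.lift.toLinearMap v) = 0 := by
  have hv : v ∈ ⨅ n : ℕ, LinearMap.ker (A.prod n b ∘ₗ φ.lift.toLinearMap) := by
    refine Env.cyclic L _ ?_ ?_ v
    · rw [Submodule.mem_iInf]
      intro n
      rw [LinearMap.mem_ker, LinearMap.comp_apply]
      exact (congrArg _ φ.lift.map_vac).trans ((A.creation b).1 n (by omega))
    · intro i a ha v hv
      rw [Submodule.mem_iInf] at *
      intro n
      have hn := hv n
      rw [LinearMap.mem_ker, LinearMap.comp_apply] at *
      rw [lift_gen, A.super_comm hb (φ.map_mem ha) (h a), hn, map_zero, smul_zero]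
  rw [Submodule.mem_iInf] at hv
  exact hv n

/-- If the images of two Lie conformal superalgebras commute, then so do the vertex algebras that
they generate. -/
theorem prod_lift_lift_eq_zero {R' : Type*} [AddCommGroup R'] [Module ℂ R']
    {L' : LieConformalSuperalgebra R'} (φ : L.HomToVA A) (ψ : L'.HomToVA A)
    (h : ∀ r s (n : ℕ), A.prod n (φ.toLinearMap r) (ψ.toLinearMap s) = 0) (v : L.Env)
    (w : L'.Env) (n : ℕ) : A.prod n (φ.lift.toLinearMap v) (ψ.lift.toLinearMap w) = 0 := by
  have h1 : ∀ r w (n : ℕ), A.prod n (φ.toLinearMap r) (ψ.lift.toLinearMap w) = 0 := by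
    intro r w n
    refine L.hom_induction (p := fun r =>
      A.prod n (φ.toLinearMap r) (ψ.lift.toLinearMap w) = 0) ?_ ?_ r
    · exact fun i r hr => ψ.prod_lift_eq_zero (φ.map_mem hr) (h r) w n
    · intro r s hr hs
      rw [map_add, map_add, LinearMap.add_apply, hr, hs, add_zero]
  have h2 := A.prod_eq_zero_symm_of_graded L.toSuperSpace L'.envelope.toSuperSpace φ.coe_par
    ψ.lift.map_par h1
  have h3 : ∀ w v (n : ℕ), A.prod n (ψ.lift.toLinearMap w) (φ.lift.toLinearMap v) = 0 := by
    intro w v n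
    refine L'.envelope.hom_induction (p := fun w =>
      A.prod n (ψ.lift.toLinearMap w) (φ.lift.toLinearMap v) = 0) ?_ ?_ w
    · exact fun i w hw => φ.prod_lift_eq_zero (ψ.lift.map_mem hw) (fun r => h2 r w) v n
    · intro r s hr hs
      rw [map_add, map_add, LinearMap.add_apply, hr, hs, add_zero]
  exact A.prod_eq_zero_symm_of_graded L'.envelope.toSuperSpace L.envelope.toSuperSpace
    ψ.lift.map_par φ.lift.map_par h3 w v n

/-- The homomorphism from a direct sum defined by two homomorphisms with commuting images. -/
def directSum {R' : Type*} [AddCommGroup R'] [Module ℂ R']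
    {L' : LieConformalSuperalgebra R'} (φ : L.HomToVA A) (ψ : L'.HomToVA A)
    (h : ∀ r s (n : ℕ), A.prod n (φ.toLinearMap r) (ψ.toLinearMap s) = 0) :
    (L.directSum L').HomToVA A where
  toLinearMap := φ.toLinearMap.coprod ψ.toLinearMap
  map_par a := by
    show φ.toLinearMap (L.par a.1) + ψ.toLinearMap (L'.par a.2) =
      A.par (φ.toLinearMap a.1 + ψ.toLinearMap a.2)
    rw [φ.coe_par, ψ.coe_par, map_add]
  map_T a := by
    show φ.toLinearMap (L.T a.1) + ψ.toLinearMap (L'.T a.2) =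
      A.T (φ.toLinearMap a.1 + ψ.toLinearMap a.2)
    rw [φ.coe_T, ψ.coe_T, map_add]
  map_prod n a b := by
    show φ.toLinearMap (L.prod n a.1 b.1) + ψ.toLinearMap (L'.prod n a.2 b.2) =
      A.prod n (φ.toLinearMap a.1 + ψ.toLinearMap a.2) (φ.toLinearMap b.1 + ψ.toLinearMap b.2)
    have h' := A.prod_eq_zero_symm_of_graded L.toSuperSpace L'.toSuperSpace φ.coe_par ψ.coe_par h
    simp only [φ.coe_prod, ψ.coe_prod, map_add, LinearMap.add_apply, h, h', add_zero, zero_add]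

end HomToVA

/-- Homomorphisms from `V(R)` are determined by their values on `R`. -/
theorem envelope_hom_ext {F G : VertexAlgebra.Hom L.envelope A}
    (h : ∀ a, F.toLinearMap (L.ι a) = G.toLinearMap (L.ι a)) : F.toLinearMap = G.toLinearMap := by
  refine LinearMap.ext fun v => ?_
  have hv : v ∈ LinearMap.eqLocus F.toLinearMap G.toLinearMap := by
    refine Env.cyclic L _ ?_ ?_ v
    · rw [LinearMap.mem_eqLocus]
      exact F.map_vac.trans G.map_vac.symm
    · intro i a _ v hv
      rw [LinearMap.mem_eqLocus] at *
      rw [← L.envelope_prod_ι, F.map_prod, G.map_prod, h, hv]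
  exact hv

/-- The canonical map `R → V(R)` is a homomorphism. -/
noncomputable def ιHom (L : LieConformalSuperalgebra R) : L.HomToVA L.envelope where
  toLinearMap := L.ι
  map_par := L.ι_par
  map_T a := by
    have h := L.envelope.cov (L.ι a) (-1) L.envelope.vac
    rw [show (L.envelope.prod (-2)).flip L.envelope.vac L.envelope.vac = 0 from
      L.envelope.trans_vac, map_zero, sub_zero, (L.envelope.creation _).2] at h
    refine Eq.trans ?_ h.symm
    show Env.gen L (L.T a) (-1) (Env.vac L) = _
    simp only [Env.gen_T, L.envelope_prod_ι]
    rfl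
  map_prod n a b := by
    show Env.gen L (L.prod n a b) (-1) (Env.vac L) =
      L.envelope.prod n (L.ι a) (Env.gen L b (-1) (Env.vac L))
    rw [L.envelope_prod_ι]
    refine L.hom_induction (p := fun a => Env.gen L (L.prod n a b) (-1) (Env.vac L) =
      Env.gen L a n (Env.gen L b (-1) (Env.vac L))) ?_ ?_ a
    · intro i a ha
      refine L.hom_induction (p := fun b => Env.gen L (L.prod n a b) (-1) (Env.vac L) =
        Env.gen L a n (Env.gen L b (-1) (Env.vac L))) ?_ ?_ b
      · intro j b hb
        obtain ⟨N, hN⟩ := L.bounded a b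
        have hM : ∀ s ≥ max N (n + 1), L.prod s a b = 0 := fun s hs => hN s (by omega)
        rw [Env.gen_comm L ha hb hM, Env.gen_vac L a n (by omega), map_zero, smul_zero, zero_add,
          Finset.sum_eq_single n]
        · rw [Ring.choose_natCast, Nat.choose_self, show (n : ℤ) + -1 - n = -1 by ring]
          simp
        · intro s _ hs
          rcases lt_or_gt_of_ne hs with h | h
          · rw [Env.gen_vac L _ _ (by omega), smul_zero]
          · rw [Ring.choose_natCast, Nat.choose_eq_zero_of_lt h]; simp
        · intro h; exact absurd (Finset.mem_range.2 (by omega)) h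
      · intro b c hb hc
        rw [map_add, Env.gen_add, LinearMap.add_apply, hb, hc, Env.gen_add, LinearMap.add_apply,
          map_add]
    · intro a c ha hc
      rw [map_add, LinearMap.add_apply, Env.gen_add, LinearMap.add_apply, ha, hc, Env.gen_add,
        LinearMap.add_apply]

end LieConformalSuperalgebra

end Lift


/-! ### Homomorphisms from tensor products -/

section TensorLift

variable {V : Type*} [AddCommGroup V] [Module ℂ V] {W : Type*} [AddCommGroup W] [Module ℂ W]
  {U : Type*} [AddCommGroup U] [Module ℂ U]

namespace VertexAlgebra

variable (A : VertexAlgebra V) (B : VertexAlgebra W)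

theorem parPow_vac (j : ZMod 2) : A.parPow j A.vac = A.vac := by
  unfold SuperSpace.parPow; split_ifs <;> simp [A.par_vac]

theorem parPow_of_mem {i : ZMod 2} {a : V} (ha : a ∈ A.part i) (j : ZMod 2) :
    A.parPow j a = koszul i j • a := by
  rcases zmod_two_cases j with rfl | rfl
  · simp [SuperSpace.parPow, koszul_zero_right]
  · simp only [SuperSpace.parPow, if_true, SuperSpace.mem_part.1 ha, koszul, mul_one]

theorem tensor_prod_left (n : ℤ) (a : V) :
    (A.tensor B).prod n (a ⊗ₜ B.vac) = leftField A a n := by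
  show tensorProd A B n (a ⊗ₜ B.vac) = _
  refine LinearMap.ext fun x => ?_
  rw [tensorProd_tmul, tensorMode_apply, finsum_eq_single _ n]
  · rw [tensorTerm_eq A B a B.vac_mem, show n - 1 - n = -1 by ring, rightField, prod_vac_left,
      if_pos rfl]
    simp [SuperSpace.parPow]
  · intro i hi
    rw [tensorTerm_eq A B a B.vac_mem, rightField, prod_vac_left, if_neg (by omega)]
    simp

theorem tensor_prod_right (n : ℤ) {j : ZMod 2} {b : W} (hb : b ∈ B.part j) :
    (A.tensor B).prod n (A.vac ⊗ₜ b) = rightField A B j b n := by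
  show tensorProd A B n (A.vac ⊗ₜ b) = _
  refine LinearMap.ext fun x => ?_
  rw [tensorProd_tmul, tensorMode_apply, finsum_eq_single _ (-1)]
  · rw [tensorTerm_eq A B _ hb, show n - 1 - -1 = n by ring, leftField, prod_vac_left,
      if_pos rfl, TensorProduct.map_id, LinearMap.id_apply]
  · intro i hi
    rw [tensorTerm_eq A B _ hb, leftField, prod_vac_left, if_neg (by omega)]
    simp

theorem tensor_par_tmul (a : V) (b : W) :
    (A.tensor B).par (a ⊗ₜ b) = A.par a ⊗ₜ B.par b := rfl

theorem tensor_prod_inl_inr (n : ℕ) (a : V) (b : W) :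
    (A.tensor B).prod n (a ⊗ₜ B.vac) (A.vac ⊗ₜ b) = 0 := by
  rw [tensor_prod_left, leftField, TensorProduct.map_tmul, (A.creation a).1 _ (by omega),
    TensorProduct.zero_tmul]

theorem tensor_prod_neg_one (a : V) (b : W) :
    (A.tensor B).prod (-1) (a ⊗ₜ B.vac) (A.vac ⊗ₜ b) = a ⊗ₜ b := by
  rw [tensor_prod_left, leftField, TensorProduct.map_tmul, (A.creation a).2]; rfl

/-- The inclusion `a ↦ a ⊗ |0⟩` of the first factor. -/
noncomputable def inl : Hom A (A.tensor B) where
  toLinearMap := (TensorProduct.mk ℂ V W).flip B.vac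
  map_par' a := by
    show A.par a ⊗ₜ B.vac = A.par a ⊗ₜ B.par B.vac
    rw [B.par_vac]
  map_vac' := rfl
  map_prod' n a b := by
    show A.prod n a b ⊗ₜ B.vac = (A.tensor B).prod n (a ⊗ₜ B.vac) (b ⊗ₜ B.vac)
    rw [tensor_prod_left]; rfl

/-- The inclusion `b ↦ |0⟩ ⊗ b` of the second factor. -/
noncomputable def inr : Hom B (A.tensor B) where
  toLinearMap := TensorProduct.mk ℂ V W A.vac
  map_par' b := by
    show A.vac ⊗ₜ B.par b = A.par A.vac ⊗ₜ B.par b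
    rw [A.par_vac]
  map_vac' := rfl
  map_prod' n a b := by
    show A.vac ⊗ₜ B.prod n a b = (A.tensor B).prod n (A.vac ⊗ₜ a) (A.vac ⊗ₜ b)
    refine B.hom_induction (p := fun a => A.vac ⊗ₜ B.prod n a b =
      (A.tensor B).prod n (A.vac ⊗ₜ a) (A.vac ⊗ₜ b)) ?_ ?_ a
    · intro j a ha
      rw [tensor_prod_right A B n ha, rightField, TensorProduct.map_tmul, parPow_vac]
    · intro a c ha hc
      rw [map_add, LinearMap.add_apply, TensorProduct.tmul_add, ha, hc, TensorProduct.tmul_add,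
        map_add, LinearMap.add_apply]

variable {A B} {C : VertexAlgebra U}

/-- The linear map `a ⊗ b ↦ F(a)_{(-1)} G(b)`. -/
noncomputable def tensorLiftLinear (F : Hom A C) (G : Hom B C) : V ⊗[ℂ] W →ₗ[ℂ] U :=
  TensorProduct.lift ((C.prod (-1)).compl₁₂ F.toLinearMap G.toLinearMap)

theorem tensorLiftLinear_tmul (F : Hom A C) (G : Hom B C) (a : V) (b : W) :
    tensorLiftLinear F G (a ⊗ₜ b) = C.prod (-1) (F.toLinearMap a) (G.toLinearMap b) := rfl

/-- The induced map intertwines the field of `a ⊗ |0⟩` with the field of `F(a)`. -/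
theorem tensorLiftLinear_leftField (F : Hom A C) (G : Hom B C)
    (h : ∀ a b (n : ℕ), C.prod n (F.toLinearMap a) (G.toLinearMap b) = 0) {i : ZMod 2} {a : V}
    (ha : a ∈ A.part i) (n : ℤ) (x : V ⊗[ℂ] W) : tensorLiftLinear F G (leftField A a n x) =
      C.prod n (F.toLinearMap a) (tensorLiftLinear F G x) := by
  induction x using tmul_induction A.toSuperSpace B.toSuperSpace
  · rename_i k l c hc d hd
    rw [leftField, TensorProduct.map_tmul, LinearMap.id_apply, tensorLiftLinear_tmul,
      tensorLiftLinear_tmul, C.prod_neg_one_comm (F.map_mem (A.prod_mem ha hc n)) (G.map_mem hd)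
        (h _ _), C.prod_neg_one_comm (F.map_mem hc) (G.map_mem hd) (h _ _), F.map_prod, map_smul,
      C.super_comm (F.map_mem ha) (G.map_mem hd) (h _ _), smul_smul, koszul_add_left,
      mul_comm (koszul i l)]
  · simp
  · rename_i x y hx hy
    rw [map_add, map_add, hx, hy, map_add, map_add]

/-- The induced map intertwines the field of `|0⟩ ⊗ b` with the field of `G(b)`. -/
theorem tensorLiftLinear_rightField (F : Hom A C) (G : Hom B C)
    (h : ∀ a b (n : ℕ), C.prod n (F.toLinearMap a) (G.toLinearMap b) = 0) {j : ZMod 2} {b : W}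
    (hb : b ∈ B.part j) (n : ℤ) (x : V ⊗[ℂ] W) : tensorLiftLinear F G (rightField A B j b n x) =
      C.prod n (G.toLinearMap b) (tensorLiftLinear F G x) := by
  induction x using tmul_induction A.toSuperSpace B.toSuperSpace
  · rename_i k l c hc d hd
    rw [rightField, TensorProduct.map_tmul, tensorLiftLinear_tmul, tensorLiftLinear_tmul,
      A.parPow_of_mem hc, map_smul, map_smul, LinearMap.smul_apply, G.map_prod,
      C.super_comm (F.map_mem hc) (G.map_mem hb) (h _ _), smul_smul, koszul_mul_self, one_smul]
  · simp
  · rename_i x y hx hy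
    rw [map_add, map_add, hx, hy, map_add, map_add]

/-- The universal property of the tensor product: two homomorphisms with commuting images define a
homomorphism `a ⊗ b ↦ F(a)_{(-1)} G(b)`. -/
noncomputable def tensorLift (F : Hom A C) (G : Hom B C)
    (h : ∀ a b (n : ℕ), C.prod n (F.toLinearMap a) (G.toLinearMap b) = 0) :
    Hom (A.tensor B) C where
  toLinearMap := tensorLiftLinear F G
  map_par' x := by
    show tensorLiftLinear F G _ = C.par (tensorLiftLinear F G x)
    induction x with
    | zero => simp
    | tmul a b =>
      rw [tensor_par_tmul, tensorLiftLinear_tmul, tensorLiftLinear_tmul, C.par_prod, F.map_par,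
        G.map_par]
    | add x y hx hy => simp only [map_add, hx, hy]
  map_vac' := by
    show tensorLiftLinear F G (A.vac ⊗ₜ B.vac) = C.vac
    rw [tensorLiftLinear_tmul, F.map_vac, G.map_vac, (C.creation _).2]
  map_prod' n x y := by
    show tensorLiftLinear F G (tensorProd A B n x y) =
      C.prod n (tensorLiftLinear F G x) (tensorLiftLinear F G y)
    induction x using tmul_induction A.toSuperSpace B.toSuperSpace
    · rename_i i j a ha b hb
      rw [tensorProd_tmul, tensorLiftLinear_tmul]
      have h1 := congrFun (tensorMode_eq_nop A B ha hb) n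
      have h2 := congrFun (C.prod_neg_one_eq_nop (F.map_mem ha) (G.map_mem hb)) n
      rw [h1, h2]
      exact nop_map _ _ _ _ _ _ (tensorLiftLinear_leftField F G h ha)
        (tensorLiftLinear_rightField F G h hb) n y
    · simp
    · rename_i x y hx hy
      simp only [map_add, LinearMap.add_apply, hx, hy]

theorem tensorLift_inl (F : Hom A C) (G : Hom B C) (h) (a : V) :
    (tensorLift F G h).toLinearMap (a ⊗ₜ B.vac) = F.toLinearMap a := by
  refine (tensorLiftLinear_tmul F G a B.vac).trans ?_
  rw [G.map_vac, (C.creation _).2]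

theorem tensorLift_inr (F : Hom A C) (G : Hom B C) (h) (b : W) :
    (tensorLift F G h).toLinearMap (A.vac ⊗ₜ b) = G.toLinearMap b := by
  refine (tensorLiftLinear_tmul F G A.vac b).trans ?_
  rw [F.map_vac, prod_vac_left]; rfl

theorem tensor_hom_ext {F G : Hom (A.tensor B) C}
    (hl : ∀ a, F.toLinearMap (a ⊗ₜ B.vac) = G.toLinearMap (a ⊗ₜ B.vac))
    (hr : ∀ b, F.toLinearMap (A.vac ⊗ₜ b) = G.toLinearMap (A.vac ⊗ₜ b)) :
    F.toLinearMap = G.toLinearMap := by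
  refine TensorProduct.ext' fun a b => ?_
  rw [← tensor_prod_neg_one A B a b, F.map_prod, G.map_prod, hl, hr]

/-- Mutually inverse homomorphisms define an isomorphism. -/
def Hom.toIso {A : VertexAlgebra V} {B : VertexAlgebra W} (F : Hom A B) (G : Hom B A)
    (h₁ : F.toLinearMap ∘ₗ G.toLinearMap = LinearMap.id)
    (h₂ : G.toLinearMap ∘ₗ F.toLinearMap = LinearMap.id) : Iso A B where
  toLinearEquiv := LinearEquiv.ofLinearMap F.toLinearMap G.toLinearMap h₁ h₂
  map_par := F.map_par
  map_vac := F.map_vac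
  map_prod := F.map_prod

end VertexAlgebra

end TensorLift

/-! ### Homomorphisms from Lie conformal superalgebras of current type -/

section CurrentHom

variable {𝔞 𝔠 : Type*} [AddCommGroup 𝔞] [Module ℂ 𝔞] [AddCommGroup 𝔠] [Module ℂ 𝔠]
  {V : Type*} [AddCommGroup V] [Module ℂ V]

namespace CurrentData

/-- The linear map `T^p ⊗ a ↦ T^p f(a)`, `c ↦ h(c)`. -/
noncomputable def extend (A : VertexAlgebra V) (f : 𝔞 →ₗ[ℂ] V) (h : 𝔠 →ₗ[ℂ] V) :
    CurrentSpace 𝔞 𝔠 →ₗ[ℂ] V :=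
  LinearMap.coprod (Finsupp.lsum ℂ fun p => (A.T ^ p) ∘ₗ f) h

theorem extend_el (A : VertexAlgebra V) (f : 𝔞 →ₗ[ℂ] V) (h : 𝔠 →ₗ[ℂ] V) (p : ℕ) (a : 𝔞) :
    extend A f h (el p a) = (A.T ^ p) (f a) := by
  simp [extend, el]

theorem extend_central (A : VertexAlgebra V) (f : 𝔞 →ₗ[ℂ] V) (h : 𝔠 →ₗ[ℂ] V) (c : 𝔠) :
    extend A f h (0, c) = h c := by
  simp [extend]

theorem extend_shift {A : VertexAlgebra V} {f : 𝔞 →ₗ[ℂ] V} {h : 𝔠 →ₗ[ℂ] V}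
    (h_T : ∀ c, A.T (h c) = 0) (x : CurrentSpace 𝔞 𝔠) :
    extend A f h (shift 𝔞 𝔠 x) = A.T (extend A f h x) := by
  refine el_induction ?_ ?_ ?_ ?_ x
  · simp
  · intro x y hx hy; simp only [map_add, hx, hy]
  · intro p a; rw [shift_el, extend_el, extend_el, pow_succ']; rfl
  · intro c; rw [shift_central, extend_central, h_T, map_zero]

variable (D : CurrentData 𝔞 𝔠)

theorem extend_prod {A : VertexAlgebra V} {f : 𝔞 →ₗ[ℂ] V} {h : 𝔠 →ₗ[ℂ] V}
    (h_T : ∀ c, A.T (h c) = 0)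
    (h₀ : ∀ a b, A.prod 0 (f a) (f b) = f (D.br a b) + h (D.ψ₀ a b))
    (h₁ : ∀ a b, A.prod 1 (f a) (f b) = h (D.ψ₁ a b))
    (h₂ : ∀ n : ℕ, 2 ≤ n → ∀ a b, A.prod n (f a) (f b) = 0) (x y : CurrentSpace 𝔞 𝔠) :
    ∀ n : ℕ, extend A f h (D.prod n x y) = A.prod n (extend A f h x) (extend A f h y) := by
  have hl : ∀ x y, (∀ n : ℕ, extend A f h (D.prod n x y) =
      A.prod n (extend A f h x) (extend A f h y)) → ∀ n : ℕ,
      extend A f h (D.prod n (shift 𝔞 𝔠 x) y) =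
        A.prod n (extend A f h (shift 𝔞 𝔠 x)) (extend A f h y) := by
    intro x y hxy n
    rw [D.sesq_left, extend_shift h_T, A.prod_T, map_smul, hxy, LinearMap.smul_apply]
    cases n with
    | zero => simp
    | succ n => simp
  have hr : ∀ x y, (∀ n : ℕ, extend A f h (D.prod n x y) =
      A.prod n (extend A f h x) (extend A f h y)) → ∀ n : ℕ,
      extend A f h (D.prod n x (shift 𝔞 𝔠 y)) =
        A.prod n (extend A f h x) (extend A f h (shift 𝔞 𝔠 y)) := by
    intro x y hxy n
    rw [D.sesq_right', extend_shift h_T, A.prod_T_right, map_add, map_smul, extend_shift h_T,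
      hxy, hxy]
    cases n with
    | zero => simp
    | succ n => simp
  refine el_induction ?_ ?_ ?_ ?_ x
  · simp
  · intro x x' hx hx' n; simp only [map_add, LinearMap.add_apply, hx, hx']
  · intro p a
    refine el_induction ?_ ?_ ?_ ?_ y
    · simp
    · intro y y' hy hy' n; simp only [map_add, hy, hy']
    · intro q b
      induction p with
      | zero =>
        induction q with
        | zero =>
          intro n
          rw [prod_el, base_apply, extend_el, extend_el]
          simp only [pow_zero, Nat.descFactorial_zero, Nat.cast_one, one_mul, one_smul, map_add,
            map_smul, extend_el, extend_central, Module.End.one_apply, Nat.sub_zero, zero_add]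
          rcases n with _ | _ | n
          · simp [h₀]
          · simp [h₁]
          · rw [h₂ (n + 1 + 1) (by omega), Nat.descFactorial_of_lt (by omega), if_neg (by omega),
              if_neg (by omega)]
            simp
        | succ q ih => rw [← shift_el]; exact hr _ _ ih
      | succ p ih => rw [← shift_el]; exact hl _ _ ih
    · intro c n
      rw [prod_central_right, extend_central, A.prod_apply_of_T_eq_zero (h_T c), map_zero]
  · intro c n
    rw [prod_central_left, extend_central, A.prod_of_T_eq_zero (h_T c), map_zero,
      LinearMap.zero_apply]

/-- A homomorphism from a Lie conformal superalgebra of current type to a vertex algebra,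
defined by its values on the generators. -/
noncomputable def homToVA (A : VertexAlgebra V) (f : 𝔞 →ₗ[ℂ] V) (h : 𝔠 →ₗ[ℂ] V)
    (f_par : ∀ a, f (D.par a) = A.par (f a)) (h_par : ∀ c, A.par (h c) = h c)
    (h_T : ∀ c, A.T (h c) = 0)
    (h₀ : ∀ a b, A.prod 0 (f a) (f b) = f (D.br a b) + h (D.ψ₀ a b))
    (h₁ : ∀ a b, A.prod 1 (f a) (f b) = h (D.ψ₁ a b))
    (h₂ : ∀ n : ℕ, 2 ≤ n → ∀ a b, A.prod n (f a) (f b) = 0) : D.lca.HomToVA A where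
  toLinearMap := extend A f h
  map_par x := by
    have hp : ∀ p a, A.par ((A.T ^ p) a) = (A.T ^ p) (A.par a) := by
      intro p
      induction p with
      | zero => intro a; rfl
      | succ p ih =>
        intro a
        rw [pow_succ, Module.End.mul_apply, Module.End.mul_apply, ih, A.T_par]
    show extend A f h (D.superSpace.par x) = A.par (extend A f h x)
    refine el_induction ?_ ?_ ?_ ?_ x
    · simp
    · intro x y hx hy; simp only [map_add, hx, hy]
    · intro p a; rw [par_el, extend_el, extend_el, f_par, hp]
    · intro c; rw [par_central, extend_central, h_par]
  map_T x := extend_shift h_T x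
  map_prod n x y := D.extend_prod h_T h₀ h₁ h₂ x y n

variable {D}

theorem homToVA_el (A : VertexAlgebra V) (f : 𝔞 →ₗ[ℂ] V) (h : 𝔠 →ₗ[ℂ] V) (h₁ h₂ h₃ h₄ h₅ h₆)
    (a : 𝔞) : (D.homToVA A f h h₁ h₂ h₃ h₄ h₅ h₆).toLinearMap (el 0 a) = f a :=
  extend_el A f h 0 a

theorem homToVA_central (A : VertexAlgebra V) (f : 𝔞 →ₗ[ℂ] V) (h : 𝔠 →ₗ[ℂ] V)
    (h₁ h₂ h₃ h₄ h₅ h₆) (c : 𝔠) :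
    (D.homToVA A f h h₁ h₂ h₃ h₄ h₅ h₆).toLinearMap (0, c) = h c :=
  extend_central A f h c

variable {A : VertexAlgebra V}

/-- A translation equivariant linear map is determined by its values on the generators. -/
theorem linearMap_ext {F G : CurrentSpace 𝔞 𝔠 →ₗ[ℂ] V}
    (hF : ∀ x, F (shift 𝔞 𝔠 x) = A.T (F x)) (hG : ∀ x, G (shift 𝔞 𝔠 x) = A.T (G x))
    (hel : ∀ a, F (el 0 a) = G (el 0 a)) (hc : ∀ c, F (0, c) = G (0, c)) : F = G := by
  refine LinearMap.ext fun x => ?_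
  refine el_induction ?_ ?_ ?_ ?_ x
  · simp
  · intro x y hx hy; rw [map_add, map_add, hx, hy]
  · intro p a
    induction p with
    | zero => exact hel a
    | succ p ih => rw [← shift_el, hF, hG, ih]
  · exact hc

theorem homToVA_T_central (φ : D.lca.HomToVA A) (c : 𝔠) : A.T (φ.toLinearMap (0, c)) = 0 := by
  rw [← φ.coe_T]
  show φ.toLinearMap (shift 𝔞 𝔠 (0, c)) = 0
  rw [shift_central, map_zero]

/-- Homomorphisms from Lie conformal superalgebras of current type have commuting images if the
images of the generators commute. -/
theorem prod_eq_zero_of_el {𝔞' 𝔠' : Type*} [AddCommGroup 𝔞'] [Module ℂ 𝔞'] [AddCommGroup 𝔠']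
    [Module ℂ 𝔠'] {D' : CurrentData 𝔞' 𝔠'} (φ : D.lca.HomToVA A) (ψ : D'.lca.HomToVA A)
    (h : ∀ a b (n : ℕ), A.prod n (φ.toLinearMap (el 0 a)) (ψ.toLinearMap (el 0 b)) = 0)
    (x : CurrentSpace 𝔞 𝔠) (y : CurrentSpace 𝔞' 𝔠') :
    ∀ n : ℕ, A.prod n (φ.toLinearMap x) (ψ.toLinearMap y) = 0 := by
  have hφ : ∀ x, φ.toLinearMap (shift 𝔞 𝔠 x) = A.T (φ.toLinearMap x) := φ.coe_T
  have hψ : ∀ x, ψ.toLinearMap (shift 𝔞' 𝔠' x) = A.T (ψ.toLinearMap x) := ψ.coe_T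
  refine el_induction ?_ ?_ ?_ ?_ x
  · simp
  · intro x x' hx hx' n; rw [map_add, map_add, LinearMap.add_apply, hx, hx', add_zero]
  · intro p a
    refine el_induction ?_ ?_ ?_ ?_ y
    · simp
    · intro y y' hy hy' n; rw [map_add, map_add, hy, hy', add_zero]
    · intro q b
      induction p with
      | zero =>
        induction q with
        | zero => exact h a b
        | succ q ih => rw [← shift_el, hψ]; exact A.prod_T_right_eq_zero ih
      | succ p ih => rw [← shift_el, hφ]; exact A.prod_T_left_eq_zero ih
    · exact fun c n => A.prod_apply_of_T_eq_zero (homToVA_T_central ψ c) _ n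
  · intro c n
    rw [A.prod_of_T_eq_zero (homToVA_T_central φ c)]; rfl

end CurrentData

end CurrentHom


/-! ### Free fermions and their currents -/

section Fermion

variable {𝔤 : Type*} [LieRing 𝔤] [LieAlgebra ℂ 𝔤] (B : InvariantForm 𝔤)
  {V : Type*} [AddCommGroup V] [Module ℂ V] (A : VertexAlgebra V)

/-- A family of free fermions: odd vectors `ψ(a)` with `[ψ(a)_λ ψ(b)] = (a,b) |0⟩`. -/
structure IsFermion (ψ : 𝔤 →ₗ[ℂ] V) : Prop where
  mem : ∀ a, ψ a ∈ A.part 1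
  prod_zero : ∀ a b, A.prod 0 (ψ a) (ψ b) = B.form a b • A.vac
  prod_pos : ∀ n : ℕ, 1 ≤ n → ∀ a b, A.prod n (ψ a) (ψ b) = 0

/-- A family of affine currents of level `K`: even vectors `e(a)` with
`[e(a)_λ e(b)] = e([a,b]) + λ (a,b) K`. -/
structure IsAffine (e : 𝔤 →ₗ[ℂ] V) (K : V) : Prop where
  mem : ∀ a, e a ∈ A.part 0
  prod_zero : ∀ a b, A.prod 0 (e a) (e b) = e ⁅a, b⁆
  prod_one : ∀ a b, A.prod 1 (e a) (e b) = B.form a b • K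
  prod_two_le : ∀ n : ℕ, 2 ≤ n → ∀ a b, A.prod n (e a) (e b) = 0

/-- The currents `e` act on the vectors `ψ` by the adjoint representation:
`[e(a)_λ ψ(b)] = ψ([a,b])`. -/
structure ActsAdjoint (e ψ : 𝔤 →ₗ[ℂ] V) : Prop where
  prod_zero : ∀ a b, A.prod 0 (e a) (ψ b) = ψ ⁅a, b⁆
  prod_pos : ∀ n : ℕ, 1 ≤ n → ∀ a b, A.prod n (e a) (ψ b) = 0

variable {I : Type*} [Fintype I] (x : Module.Basis I ℂ 𝔤)

/-- The currents `½ ∑ᵢ :ψ([y,xᵢ]) ψ(xᵢ):` of a family of free fermions. -/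
noncomputable def fermionCurrent (ψ : 𝔤 →ₗ[ℂ] V) : 𝔤 →ₗ[ℂ] V :=
  (1 / 2 : ℂ) • ∑ i, (A.prod (-1)).flip (ψ (x i)) ∘ₗ ψ ∘ₗ (lieBr 𝔤).flip (x i)

theorem fermionCurrent_apply (ψ : 𝔤 →ₗ[ℂ] V) (y : 𝔤) : fermionCurrent A x ψ y =
    (1 / 2 : ℂ) • ∑ i, A.prod (-1) (ψ ⁅y, x i⁆) (ψ (x i)) := by
  simp [fermionCurrent, LinearMap.sum_apply, lieBr_apply]

theorem fermionCurrent_map {W : Type*} [AddCommGroup W] [Module ℂ W] {A' : VertexAlgebra W}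
    (F : VertexAlgebra.Hom A A') {ψ : 𝔤 →ₗ[ℂ] V} {ψ' : 𝔤 →ₗ[ℂ] W}
    (h : ∀ a, F.toLinearMap (ψ a) = ψ' a) (y : 𝔤) :
    F.toLinearMap (fermionCurrent A x ψ y) = fermionCurrent A' x ψ' y := by
  simp only [fermionCurrent_apply, map_smul, map_sum, F.map_prod, h]

variable {A B x}

theorem sum_form_smul [DecidableEq I] (hx : ∀ i j, B.form (x i) (x j) = if i = j then 1 else 0)
    (u : 𝔤) : ∑ i, B.form u (x i) • x i = u := by
  conv_rhs => rw [← x.sum_repr u]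
  refine Finset.sum_congr rfl fun i _ => ?_
  congr 1
  conv_lhs => rw [← x.sum_repr u]
  simp only [map_sum, map_smul, LinearMap.sum_apply, LinearMap.smul_apply, hx, smul_eq_mul,
    mul_ite, mul_one, mul_zero, Finset.sum_ite_eq', Finset.mem_univ, if_true]

/-- Invariance of the tensor `∑ᵢ xᵢ ⊗ xᵢ` under the adjoint action. -/
theorem sum_lie_left [DecidableEq I] (hx : ∀ i j, B.form (x i) (x j) = if i = j then 1 else 0)
    (β : 𝔤 →ₗ[ℂ] 𝔤 →ₗ[ℂ] V) (y : 𝔤) :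
    ∑ i, β ⁅y, x i⁆ (x i) = -∑ i, β (x i) ⁅y, x i⁆ := by
  have h1 : ∀ i, β ⁅y, x i⁆ (x i) = ∑ j, B.form ⁅y, x i⁆ (x j) • β (x j) (x i) := by
    intro i
    conv_lhs => rw [← sum_form_smul hx ⁅y, x i⁆]
    simp [LinearMap.sum_apply]
  have h2 : ∀ i, β (x i) ⁅y, x i⁆ = ∑ j, B.form ⁅y, x i⁆ (x j) • β (x i) (x j) := by
    intro i
    conv_lhs => rw [← sum_form_smul hx ⁅y, x i⁆]
    simp
  have h3 : ∀ i j, B.form ⁅y, x i⁆ (x j) = -B.form ⁅y, x j⁆ (x i) := by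
    intro i j
    rw [← lie_skew, map_neg, LinearMap.neg_apply, B.inv, B.symm]
  simp only [h1, h2]
  rw [Finset.sum_comm, ← Finset.sum_neg_distrib]
  refine Finset.sum_congr rfl fun i _ => ?_
  rw [← Finset.sum_neg_distrib]
  refine Finset.sum_congr rfl fun j _ => ?_
  rw [h3, neg_smul]

/-- The trace form of the adjoint representation is `2g` times the invariant form. -/
theorem sum_form_lie_lie {g : ℂ} (hg : casimir x = (2 * g) • LinearMap.id) (y z : 𝔤) :
    ∑ i, B.form ⁅y, ⁅z, x i⁆⁆ (x i) = 2 * g * B.form y z := by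
  have h := congrArg (fun f => B.form z (f y)) hg
  simp only [casimir, LinearMap.sum_apply, LinearMap.comp_apply, lieBr_apply, map_sum,
    LinearMap.smul_apply, LinearMap.id_apply, map_smul, smul_eq_mul] at h
  rw [B.symm y z, ← h]
  refine Finset.sum_congr rfl fun i _ => ?_
  rw [← B.inv z (x i), ← lie_skew y, map_neg, LinearMap.neg_apply, B.inv ⁅z, x i⁆ y,
    ← lie_skew y (x i), map_neg, neg_neg]

namespace IsFermion

variable {ψ : 𝔤 →ₗ[ℂ] V}

theorem even_mem (hψ : IsFermion B A ψ) (a b : 𝔤) : A.prod (-1) (ψ a) (ψ b) ∈ A.part 0 :=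
  A.prod_mem (hψ.mem a) (hψ.mem b) (-1)

theorem prod_quadratic_zero (hψ : IsFermion B A ψ) (c a b : 𝔤) :
    A.prod 0 (ψ c) (A.prod (-1) (ψ a) (ψ b)) = B.form c a • ψ b - B.form c b • ψ a := by
  have h := A.commutator (hψ.mem c) (hψ.mem a) (N := 1) (fun s hs => hψ.prod_pos s hs c a) 0 (-1)
    (ψ b)
  rw [h, Finset.sum_range_one, hψ.prod_zero, koszul_one_one, map_smul, (A.creation _).2,
    Nat.cast_zero, hψ.prod_zero, map_smul, LinearMap.smul_apply, A.prod_vac_left]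
  simp
  abel

theorem prod_quadratic_pos (hψ : IsFermion B A ψ) {n : ℕ} (hn : 1 ≤ n) (c a b : 𝔤) :
    A.prod n (ψ c) (A.prod (-1) (ψ a) (ψ b)) = 0 := by
  have h := A.commutator (hψ.mem c) (hψ.mem a) (N := 1) (fun s hs => hψ.prod_pos s hs c a) n (-1)
    (ψ b)
  rw [h, Finset.sum_range_one, hψ.prod_pos n hn, map_zero, smul_zero, Nat.cast_zero,
    hψ.prod_zero, map_smul, LinearMap.smul_apply, A.prod_vac_left, if_neg (by omega)]
  simp

theorem prod_current_zero [DecidableEq I]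
    (hx : ∀ i j, B.form (x i) (x j) = if i = j then 1 else 0) (hψ : IsFermion B A ψ) (c y : 𝔤) :
    A.prod 0 (ψ c) (fermionCurrent A x ψ y) = ψ ⁅c, y⁆ := by
  have h1 : ∑ i, B.form c ⁅y, x i⁆ • ψ (x i) = ψ ⁅c, y⁆ := by
    conv_rhs => rw [← sum_form_smul hx ⁅c, y⁆, map_sum]
    exact Finset.sum_congr rfl fun i _ => by rw [map_smul, B.inv]
  have h2 : ∑ i, B.form c (x i) • ψ ⁅y, x i⁆ = ψ ⁅y, c⁆ := by
    conv_rhs => rw [← sum_form_smul hx c]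
    rw [lie_sum, map_sum]
    exact Finset.sum_congr rfl fun i _ => by rw [lie_smul, map_smul]
  rw [fermionCurrent_apply, map_smul, map_sum]
  simp only [hψ.prod_quadratic_zero, Finset.sum_sub_distrib, h1, h2]
  rw [← lie_skew y c, map_neg]
  module

theorem prod_current_pos (hψ : IsFermion B A ψ) {n : ℕ} (hn : 1 ≤ n) (c y : 𝔤) :
    A.prod n (ψ c) (fermionCurrent A x ψ y) = 0 := by
  rw [fermionCurrent_apply, map_smul, map_sum]
  simp only [hψ.prod_quadratic_pos hn, Finset.sum_const_zero, smul_zero]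

theorem current_mem (hψ : IsFermion B A ψ) (y : 𝔤) : fermionCurrent A x ψ y ∈ A.part 0 := by
  rw [fermionCurrent_apply]
  exact Submodule.smul_mem _ _ (Submodule.sum_mem _ fun i _ => hψ.even_mem _ _)

/-- The currents of the fermions act on them by the adjoint representation. This is
skewsymmetry: one commutes `ψ(c)_{(-1)}` with the modes of the current on the vacuum. -/
theorem actsAdjoint [DecidableEq I]
    (hx : ∀ i j, B.form (x i) (x j) = if i = j then 1 else 0) (hψ : IsFermion B A ψ) :
    ActsAdjoint A (fermionCurrent A x ψ) ψ := by
  have key : ∀ (n : ℕ) y c, A.prod n (fermionCurrent A x ψ y) (ψ c) =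
      A.prod ((n : ℤ) - 1) (ψ ⁅y, c⁆) A.vac := by
    intro n y c
    have h := A.commutator (hψ.mem c) (hψ.current_mem (x := x) y) (N := 1)
      (fun s hs => hψ.prod_current_pos hs c y) (-1) n A.vac
    rw [(A.creation _).1 n (by omega), map_zero, koszul_zero_right, one_smul, (A.creation _).2,
      Finset.sum_range_one, Nat.cast_zero, hψ.prod_current_zero hx, Ring.choose_zero_right,
      Int.cast_one, one_smul, sub_zero, eq_comm] at h
    rw [eq_neg_of_add_eq_zero_left h, ← lie_skew y c, map_neg, map_neg, LinearMap.neg_apply,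
      show -1 + (n : ℤ) = n - 1 by ring]
  constructor
  · intro y c
    have := key 0 y c
    rwa [Nat.cast_zero, zero_sub, (A.creation _).2] at this
  · intro n hn y c
    rw [key, (A.creation _).1 _ (by omega)]

/-- The fermionic currents act on `:ψ(a) ψ(b):` by the noncommutative Wick formula; the last
summand is a normally ordered product for `n = 0` and the integral term for `n ≥ 1`. -/
theorem current_prod_quadratic [DecidableEq I]
    (hx : ∀ i j, B.form (x i) (x j) = if i = j then 1 else 0) (hψ : IsFermion B A ψ) (y a b : 𝔤)
    (n : ℕ) :
    A.prod n (fermionCurrent A x ψ y) (A.prod (-1) (ψ a) (ψ b)) =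
      A.prod (-1) (ψ a) (A.prod n (fermionCurrent A x ψ y) (ψ b)) +
        A.prod ((n : ℤ) - 1) (ψ ⁅y, a⁆) (ψ b) := by
  have hJ := hψ.actsAdjoint hx
  rw [A.commutator (hψ.current_mem (x := x) y) (hψ.mem a) (N := 1)
    (fun s hs => hJ.prod_pos s hs y a) n (-1), koszul_zero_left, one_smul, Finset.sum_range_one,
    Nat.cast_zero, hJ.prod_zero, Ring.choose_zero_right, Int.cast_one, one_smul, sub_zero]
  rfl

/-- The currents of the fermions are affine currents of level `g`. The bracket comes from the
invariance of `∑ᵢ xᵢ ⊗ xᵢ`, and the level is half the trace form of the adjoint representation. -/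
theorem isAffine_current [DecidableEq I]
    (hx : ∀ i j, B.form (x i) (x j) = if i = j then 1 else 0) (hψ : IsFermion B A ψ) {g : ℂ}
    (hg : casimir x = (2 * g) • LinearMap.id) :
    IsAffine B A (fermionCurrent A x ψ) (g • A.vac) := by
  have hJ := hψ.actsAdjoint hx
  refine ⟨fun y => hψ.current_mem y, ?_, ?_, ?_⟩
  · intro y z
    have h : ∀ a b, A.prod 0 (fermionCurrent A x ψ y) (A.prod (-1) (ψ a) (ψ b)) =
        A.prod (-1) (ψ a) (ψ ⁅y, b⁆) + A.prod (-1) (ψ ⁅y, a⁆) (ψ b) := by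
      intro a b
      have := hψ.current_prod_quadratic hx y a b 0
      rwa [Nat.cast_zero, hJ.prod_zero, zero_sub] at this
    have h2 := sum_lie_left hx ((A.prod (-1)).compl₁₂ (ψ ∘ₗ lieBr 𝔤 z) ψ) y
    simp only [LinearMap.compl₁₂_apply, LinearMap.comp_apply, lieBr_apply] at h2
    rw [fermionCurrent_apply A x ψ z, fermionCurrent_apply A x ψ ⁅y, z⁆, map_smul, map_sum]
    simp only [h, lie_lie, map_sub, LinearMap.sub_apply, Finset.sum_add_distrib,
      Finset.sum_sub_distrib, h2]
    congr 1
    abel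
  · intro y z
    have h : ∀ a b, A.prod 1 (fermionCurrent A x ψ y) (A.prod (-1) (ψ a) (ψ b)) =
        B.form ⁅y, a⁆ b • A.vac := by
      intro a b
      have h1 := hJ.prod_pos 1 le_rfl y b
      have h2 := hψ.current_prod_quadratic hx y a b 1
      rw [Nat.cast_one] at h1 h2
      rw [h2, h1, map_zero, zero_add, sub_self, hψ.prod_zero]
    rw [fermionCurrent_apply A x ψ z, map_smul, map_sum]
    simp only [h]
    rw [← Finset.sum_smul, sum_form_lie_lie hg, smul_smul, smul_smul]
    congr 1
    ring
  · intro n hn y z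
    rw [fermionCurrent_apply A x ψ z, map_smul, map_sum, Finset.sum_eq_zero, smul_zero]
    intro i _
    rw [hψ.current_prod_quadratic hx, hJ.prod_pos n (by omega), map_zero, zero_add]
    have := hψ.prod_pos (n - 1) (by omega) ⁅y, ⁅z, x i⁆⁆ (x i)
    rwa [Nat.cast_sub (by omega), Nat.cast_one] at this

/-- An even vector whose field commutes with the fermions commutes with their currents. -/
theorem prod_current_eq_zero (hψ : IsFermion B A ψ) {a : V} (ha : a ∈ A.part 0)
    (h : ∀ b (n : ℕ), A.prod n a (ψ b) = 0) (y : 𝔤) (n : ℕ) :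
    A.prod n a (fermionCurrent A x ψ y) = 0 := by
  rw [fermionCurrent_apply, map_smul, map_sum, Finset.sum_eq_zero, smul_zero]
  intro i _
  rw [A.super_comm ha (hψ.mem _) (h _), h, map_zero, smul_zero]

end IsFermion

namespace IsAffine

/-- The sum of two commuting families of affine currents is a family of affine currents, whose
level is the sum of the levels. -/
theorem add {e e' : 𝔤 →ₗ[ℂ] V} {K K' : V} (he : IsAffine B A e K) (he' : IsAffine B A e' K')
    (h : ∀ a b (n : ℕ), A.prod n (e a) (e' b) = 0) : IsAffine B A (e + e') (K + K') := by
  have h' : ∀ a b (n : ℕ), A.prod n (e' a) (e b) = 0 := fun a b n =>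
    A.prod_eq_zero_symm (he.mem b) (he'.mem a) (h b a) n
  have key : ∀ (n : ℕ) a b, A.prod n ((e + e') a) ((e + e') b) =
      A.prod n (e a) (e b) + A.prod n (e' a) (e' b) := by
    intro n a b
    simp only [LinearMap.add_apply, map_add, h, h', add_zero, zero_add]
  refine ⟨fun a => Submodule.add_mem _ (he.mem a) (he'.mem a), ?_, ?_, ?_⟩
  · intro a b
    have := key 0 a b
    rw [Nat.cast_zero] at this
    rw [this, he.prod_zero, he'.prod_zero]; rfl
  · intro a b
    have := key 1 a b
    rw [Nat.cast_one] at this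
    rw [this, he.prod_one, he'.prod_one, smul_add]
  · intro n hn a b
    rw [key, he.prod_two_le n hn, he'.prod_two_le n hn, add_zero]

/-- The coset construction: the difference of two families of affine currents, if it commutes with
the second one, is a family of affine currents, whose level is the difference of the levels. -/
theorem sub {e e' : 𝔤 →ₗ[ℂ] V} {K K' : V} (he : IsAffine B A e K) (he' : IsAffine B A e' K')
    (h : ∀ a b (n : ℕ), A.prod n (e a - e' a) (e' b) = 0) : IsAffine B A (e - e') (K - K') := by
  have hm : ∀ a, e a - e' a ∈ A.part 0 := fun a => Submodule.sub_mem _ (he.mem a) (he'.mem a)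
  have h' : ∀ a b (n : ℕ), A.prod n (e' a) (e b - e' b) = 0 := fun a b n =>
    A.prod_eq_zero_symm (hm b) (he'.mem a) (h b a) n
  have key : ∀ (n : ℕ) a b, A.prod n ((e - e') a) ((e - e') b) =
      A.prod n (e a) (e b) - A.prod n (e' a) (e' b) := by
    intro n a b
    have h1 := h a b n
    have h2 := h' a b n
    simp only [map_sub, LinearMap.sub_apply] at h1 h2 ⊢
    linear_combination (norm := module) -h1 - h2
  refine ⟨hm, ?_, ?_, ?_⟩
  · intro a b
    have := key 0 a b
    rw [Nat.cast_zero] at this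
    rw [this, he.prod_zero, he'.prod_zero]; rfl
  · intro a b
    have := key 1 a b
    rw [Nat.cast_one] at this
    rw [this, he.prod_one, he'.prod_one, smul_sub]
  · intro n hn a b
    rw [key, he.prod_two_le n hn, he'.prod_two_le n hn, sub_zero]

end IsAffine

/-- Affine currents acting on fermions by the adjoint representation commute with the fermions after
subtraction of the fermionic currents. -/
theorem ActsAdjoint.sub_prod_eq_zero {e e' ψ : 𝔤 →ₗ[ℂ] V} (h : ActsAdjoint A e ψ)
    (h' : ActsAdjoint A e' ψ) (a b : 𝔤) (n : ℕ) : A.prod n (e a - e' a) (ψ b) = 0 := by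
  rw [map_sub, LinearMap.sub_apply, sub_eq_zero]
  rcases Nat.eq_zero_or_pos n with rfl | hn
  · rw [Nat.cast_zero, h.prod_zero, h'.prod_zero]
  · rw [h.prod_pos n hn, h'.prod_pos n hn]

/-! ### Homomorphisms from the affine, fermionic and super affine algebras -/

/-- The homomorphism `Cur(𝔤) → A` defined by a family of affine currents. -/
noncomputable def IsAffine.hom {e : 𝔤 →ₗ[ℂ] V} {K : V} (he : IsAffine B A e K)
    (hp : A.par K = K) (hT : A.T K = 0) : (Cur B).HomToVA A :=
  (curData B).homToVA A e (LinearMap.toSpanSingleton ℂ V K)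
    (fun a => by
      rw [SuperSpace.mem_part.1 (he.mem a)]
      simp [curData, sgn])
    (fun c => by simp [hp]) (fun c => by simp [hT])
    (fun a b => by
      rw [he.prod_zero]
      simp [curData, lieBr_apply])
    (fun a b => by
      rw [he.prod_one]
      simp [curData])
    he.prod_two_le

/-- The homomorphism `R^{Cl}(𝔤̄) → A` defined by a family of fermions. -/
noncomputable def IsFermion.hom {ψ : 𝔤 →ₗ[ℂ] V} (hψ : IsFermion B A ψ) : (RCl B).HomToVA A :=
  (cliffordData B).homToVA A ψ (LinearMap.toSpanSingleton ℂ V A.vac)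
    (fun a => by
      rw [SuperSpace.mem_part.1 (hψ.mem a)]
      simp [cliffordData, sgn])
    (fun c => by simp [A.par_vac]) (fun c => by simp [A.T_vac])
    (fun a b => by
      rw [hψ.prod_zero]
      simp [cliffordData])
    (fun a b => by
      have := hψ.prod_pos 1 le_rfl a b
      rw [Nat.cast_one] at this
      rw [this]
      simp [cliffordData])
    (fun n hn => hψ.prod_pos n (by omega))

/-- The homomorphism `R^{super} → A` defined by a family of fermions and a family of affine currents
of scalar level that acts on it. -/
noncomputable def superHom {e ψ : 𝔤 →ₗ[ℂ] V} {k : ℂ} (he : IsAffine B A e (k • A.vac))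
    (hψ : IsFermion B A ψ) (h : ActsAdjoint A e ψ) (h' : ∀ a b, A.prod 0 (ψ a) (e b) = ψ ⁅a, b⁆)
    (h'' : ∀ n : ℕ, 1 ≤ n → ∀ a b, A.prod n (ψ a) (e b) = 0) : (RSuper B).HomToVA A :=
  (superData B).homToVA A (e.coprod ψ)
    ((LinearMap.toSpanSingleton ℂ V (k • A.vac)).coprod (LinearMap.toSpanSingleton ℂ V A.vac))
    (fun a => by
      have h1 := SuperSpace.mem_part.1 (he.mem a.1)
      have h2 := SuperSpace.mem_part.1 (hψ.mem a.2)
      simp only [LinearMap.coprod_apply, map_add, h1, h2]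
      simp [superData, sgn])
    (fun c => by simp [A.par_vac]) (fun c => by simp [A.T_vac])
    (fun a b => by
      simp only [LinearMap.coprod_apply, map_add, LinearMap.add_apply, he.prod_zero,
        hψ.prod_zero, h.prod_zero, h']
      simp [superData]
      abel)
    (fun a b => by
      have h1 := hψ.prod_pos 1 le_rfl
      have h2 := h.prod_pos 1 le_rfl
      have h3 := h'' 1 le_rfl
      rw [Nat.cast_one] at h1 h2 h3
      simp only [LinearMap.coprod_apply, map_add, LinearMap.add_apply, he.prod_one, h1, h2, h3]
      simp [superData])
    (fun n hn a b => by
      simp only [LinearMap.coprod_apply, map_add, LinearMap.add_apply, he.prod_two_le n hn,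
        hψ.prod_pos n (by omega), h.prod_pos n (by omega), h'' n (by omega), add_zero])

end Fermion


/-! ### The affine currents and fermions of the enveloping algebras -/

section SuperAffineVA

variable {𝔤 : Type*} [LieRing 𝔤] [LieAlgebra ℂ 𝔤] (B : InvariantForm 𝔤)

open CurrentData

/-- The canonical homomorphism `Cur(𝔤) → V^k(𝔤)`. -/
noncomputable def affineHom (k : ℂ) : (Cur B).HomToVA (affineVA B k) :=
  (Cur B).ιHom.comp (affineIdeal B k).mkHom

/-- The canonical homomorphism `R^{Cl}(𝔤̄) → F(𝔤̄)`. -/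
noncomputable def fermionicHom : (RCl B).HomToVA (fermionicVA B) :=
  (RCl B).ιHom.comp (fermionicIdeal B).mkHom

/-- The canonical homomorphism `R^{super} → V^1(R^{super})`. -/
noncomputable def superHom₁ : (RSuper B).HomToVA (superVA₁ B) :=
  (RSuper B).ιHom.comp (superIdeal₁ B).mkHom

/-- The canonical projection `V^1(R^{super}) → V^{k,1}(R^{super})` as a homomorphism of vertex
algebras. -/
noncomputable def superProjHom (k : ℂ) : VertexAlgebra.Hom (superVA₁ B) (superVA B k) :=
  VertexAlgebra.Ideal.factorHom ((RSuper B).envelope.idealGen_mono (by simp))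

theorem idealGen_mkQ_eq {V : Type*} [AddCommGroup V] [Module ℂ V] (A : VertexAlgebra V)
    {S : Set V} {u v : V} (h : u - v ∈ S) :
    (A.idealGen S).toSubmodule.mkQ u = (A.idealGen S).toSubmodule.mkQ v := by
  refine (Submodule.Quotient.eq _).2 ?_
  simp only [VertexAlgebra.idealGen, Submodule.mem_iInf]
  exact fun I => I.2 h

theorem toAffine_K (k : ℂ) : toAffine B k (0, 1) = k • (affineVA B k).vac :=
  idealGen_mkQ_eq _ rfl

theorem toFermionic_K : toFermionic B (0, 1) = (fermionicVA B).vac :=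
  idealGen_mkQ_eq _ rfl

theorem toSuper₁_K : toSuper₁ B (0, (0, 1)) = (superVA₁ B).vac :=
  idealGen_mkQ_eq _ rfl

theorem superProj_K (k : ℂ) :
    superProj B k (toSuper₁ B (0, (1, 0))) = k • (superVA B k).vac :=
  idealGen_mkQ_eq (RSuper B).envelope (Or.inl rfl)

theorem central_eq_smul {𝔞 : Type*} [AddCommGroup 𝔞] [Module ℂ 𝔞] (c : ℂ) :
    ((0, c) : CurrentSpace 𝔞 ℂ) = c • ((0, 1) : CurrentSpace 𝔞 ℂ) := by
  simp

theorem isAffine_toAffine (k : ℂ) :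
    IsAffine B (affineVA B k) (toAffine B k ∘ₗ el 0) (k • (affineVA B k).vac) := by
  have h : ∀ (n : ℕ) a b, (affineVA B k).prod n (toAffine B k (el 0 a)) (toAffine B k (el 0 b)) =
      toAffine B k ((Cur B).prod n (el 0 a) (el 0 b)) :=
    fun n a b => ((affineHom B k).coe_prod n _ _).symm
  refine ⟨fun a => (affineHom B k).map_mem (i := 0) ?_, ?_, ?_, ?_⟩
  · rw [SuperSpace.mem_part]
    refine ((curData B).par_el 0 a).trans ?_
    simp [curData, sgn]
  · intro a b
    refine (h 0 a b).trans ?_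
    rw [(Cur_bracket B a b).1]; rfl
  · intro a b
    refine (h 1 a b).trans ?_
    rw [(Cur_bracket B a b).2, central_eq_smul, map_smul, toAffine_K]
  · intro n hn a b
    refine (h n a b).trans ?_
    rw [show (Cur B).prod n (el 0 a) (el 0 b) = 0 from ?_, map_zero]
    refine ((curData B).prod_el n 0 0 a b).trans ?_
    rw [(curData B).base_eq_zero (by omega), smul_zero]

theorem isFermion_toFermionic :
    IsFermion B (fermionicVA B) (toFermionic B ∘ₗ el 0) := by
  have h : ∀ (n : ℕ) a b, (fermionicVA B).prod n (toFermionic B (el 0 a)) (toFermionic B (el 0 b)) =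
      toFermionic B ((RCl B).prod n (el 0 a) (el 0 b)) :=
    fun n a b => ((fermionicHom B).coe_prod n _ _).symm
  refine ⟨fun a => (fermionicHom B).map_mem (i := 1) ?_, ?_, ?_⟩
  · rw [SuperSpace.mem_part]
    refine ((cliffordData B).par_el 0 a).trans ?_
    simp [cliffordData, sgn]
  · intro a b
    refine (h 0 a b).trans ?_
    rw [(RCl_bracket B a b).1, central_eq_smul, map_smul, toFermionic_K]
  · intro n hn a b
    refine (h n a b).trans ?_
    rw [show (RCl B).prod n (el 0 a) (el 0 b) = 0 from ?_, map_zero]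
    rcases hn.eq_or_lt with rfl | hn
    · exact (RCl_bracket B a b).2
    · refine ((cliffordData B).prod_el n 0 0 a b).trans ?_
      rw [(cliffordData B).base_eq_zero (by omega), smul_zero]

/-- The map `x ↦ x` from `𝔤` to `V^1(R^{super})`. -/
noncomputable def evenMap : 𝔤 →ₗ[ℂ] (superIdeal₁ B).Quot :=
  toSuper₁ B ∘ₗ el 0 ∘ₗ LinearMap.inl ℂ 𝔤 𝔤

/-- The map `x ↦ x̄` from `𝔤` to `V^1(R^{super})`. -/
noncomputable def oddMap : 𝔤 →ₗ[ℂ] (superIdeal₁ B).Quot :=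
  toSuper₁ B ∘ₗ el 0 ∘ₗ LinearMap.inr ℂ 𝔤 𝔤

theorem toSuper₁_prod (n : ℕ) (a b : 𝔤 × 𝔤) :
    (superVA₁ B).prod n (toSuper₁ B (el 0 a)) (toSuper₁ B (el 0 b)) =
      toSuper₁ B ((RSuper B).prod n (el 0 a) (el 0 b)) :=
  ((superHom₁ B).coe_prod n _ _).symm

theorem RSuper_prod_eq_zero {n : ℕ} (hn : 2 ≤ n) (a b : 𝔤 × 𝔤) :
    (RSuper B).prod n (el 0 a) (el 0 b) = 0 := by
  refine ((superData B).prod_el n 0 0 a b).trans ?_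
  rw [(superData B).base_eq_zero (by omega), smul_zero]

theorem toSuper₁_prod_zero (a b : 𝔤 × 𝔤) :
    (superVA₁ B).prod 0 (toSuper₁ B (el 0 a)) (toSuper₁ B (el 0 b)) =
      toSuper₁ B (el 0 (⁅a.1, b.1⁆, ⁅a.1, b.2⁆ + ⁅a.2, b.1⁆)) +
        B.form a.2 b.2 • (superVA₁ B).vac := by
  refine (toSuper₁_prod B 0 a b).trans ?_
  obtain ⟨a, a'⟩ := a
  obtain ⟨b, b'⟩ := b
  rw [(RSuper_bracket B a a' b b').1, map_add]
  congr 1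
  rw [show ((0, (0, B.form a' b')) : CurrentSpace (𝔤 × 𝔤) (ℂ × ℂ)) =
    B.form a' b' • (0, (0, 1)) by simp, map_smul, toSuper₁_K]

theorem toSuper₁_prod_one (a b : 𝔤 × 𝔤) :
    (superVA₁ B).prod 1 (toSuper₁ B (el 0 a)) (toSuper₁ B (el 0 b)) =
      B.form a.1 b.1 • toSuper₁ B (0, (1, 0)) := by
  refine (toSuper₁_prod B 1 a b).trans ?_
  obtain ⟨a, a'⟩ := a
  obtain ⟨b, b'⟩ := b
  rw [(RSuper_bracket B a a' b b').2, ← map_smul]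
  simp

theorem isAffine_evenMap :
    IsAffine B (superVA₁ B) (evenMap B) (toSuper₁ B (0, (1, 0))) := by
  refine ⟨fun a => (superHom₁ B).map_mem (i := 0) ?_, ?_, ?_, ?_⟩
  · rw [SuperSpace.mem_part]
    refine ((superData B).par_el 0 _).trans ?_
    simp [superData, sgn]
  · intro a b
    refine (toSuper₁_prod_zero B (a, 0) (b, 0)).trans ?_
    simp [evenMap]
  · exact fun a b => toSuper₁_prod_one B (a, 0) (b, 0)
  · intro n hn a b
    refine (toSuper₁_prod B n (a, 0) (b, 0)).trans ?_
    rw [RSuper_prod_eq_zero B hn, map_zero]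

theorem isFermion_oddMap : IsFermion B (superVA₁ B) (oddMap B) := by
  refine ⟨fun a => (superHom₁ B).map_mem (i := 1) ?_, ?_, ?_⟩
  · rw [SuperSpace.mem_part]
    refine ((superData B).par_el 0 _).trans ?_
    simp [superData, sgn, ← map_neg]
  · intro a b
    refine (toSuper₁_prod_zero B (0, a) (0, b)).trans ?_
    simp only [zero_lie, lie_zero, add_zero, add_eq_right]
    exact map_zero (toSuper₁ B ∘ₗ el 0)
  · intro n hn a b
    rcases hn.eq_or_lt with rfl | hn
    · refine (toSuper₁_prod_one B (0, a) (0, b)).trans ?_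
      simp
    · refine (toSuper₁_prod B n (0, a) (0, b)).trans ?_
      rw [RSuper_prod_eq_zero B hn, map_zero]

theorem actsAdjoint_evenMap_oddMap : ActsAdjoint (superVA₁ B) (evenMap B) (oddMap B) := by
  refine ⟨?_, ?_⟩
  · intro a b
    refine (toSuper₁_prod_zero B (a, 0) (0, b)).trans ?_
    simp [oddMap]
  · intro n hn a b
    rcases hn.eq_or_lt with rfl | hn
    · refine (toSuper₁_prod_one B (a, 0) (0, b)).trans ?_
      simp
    · refine (toSuper₁_prod B n (a, 0) (0, b)).trans ?_
      rw [RSuper_prod_eq_zero B hn, map_zero]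

variable {I : Type*} [Fintype I] (x : Module.Basis I ℂ 𝔤)

theorem tilde_eq (y : 𝔤) :
    tilde B x y = evenMap B y - fermionCurrent (superVA₁ B) x (oddMap B) y := by
  rw [fermionCurrent_apply]; rfl

variable {B x}

theorem T_toSuper₁_central (c : ℂ × ℂ) : (superVA₁ B).T (toSuper₁ B (0, c)) = 0 :=
  homToVA_T_central (D := superData B) (superHom₁ B) c

theorem par_toSuper₁_central (c : ℂ × ℂ) :
    (superVA₁ B).par (toSuper₁ B (0, c)) = toSuper₁ B (0, c) := by
  refine ((superHom₁ B).coe_par (0, c)).symm.trans ?_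
  exact congrArg (toSuper₁ B) ((superData B).par_central c)

/-- A homomorphism with the prescribed values on the generators exists because `x̃` is the
difference of the affine current `x` of level `𝒦` and of the fermionic current of level `g`, which
both act on the fermions by the adjoint representation. -/
theorem exists_isTildeHom [DecidableEq I]
    (hx : ∀ i j, B.form (x i) (x j) = if i = j then 1 else 0)
    {g : ℂ} (hg : casimir x = (2 * g) • LinearMap.id) :
    ∃ φ : ((Cur B).directSum (RCl B)).HomToVA (superVA₁ B), IsTildeHom B x g φ := by
  have hψ := isFermion_oddMap B
  have hJ := hψ.isAffine_current hx hg
  have he := isAffine_evenMap B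
  have hcomm := (actsAdjoint_evenMap_oddMap B).sub_prod_eq_zero (hψ.actsAdjoint hx)
  have ht := he.sub hJ fun a b n =>
    hψ.prod_current_eq_zero (Submodule.sub_mem _ (he.mem a) (hJ.mem a)) (hcomm a) b n
  have hp : (superVA₁ B).par (toSuper₁ B (0, (1, 0)) - g • (superVA₁ B).vac) =
      toSuper₁ B (0, (1, 0)) - g • (superVA₁ B).vac := by
    rw [map_sub, map_smul, (superVA₁ B).par_vac, par_toSuper₁_central]
  have hT : (superVA₁ B).T (toSuper₁ B (0, (1, 0)) - g • (superVA₁ B).vac) = 0 := by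
    rw [map_sub, map_smul, (superVA₁ B).T_vac, T_toSuper₁_central, smul_zero, sub_zero]
  have hα : ∀ a, (ht.hom hp hT).toLinearMap (el 0 a) = _ := homToVA_el _ _ _ _ _ _ _ _ _
  have hβ : ∀ a, hψ.hom.toLinearMap (el 0 a) = oddMap B a := homToVA_el _ _ _ _ _ _ _ _ _
  have hαβ : ∀ r s (n : ℕ), (superVA₁ B).prod n ((ht.hom hp hT).toLinearMap r)
      (hψ.hom.toLinearMap s) = 0 := by
    refine prod_eq_zero_of_el (D := curData B) (D' := cliffordData B) _ _ fun a b n => ?_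
    rw [hα, hβ]
    exact hcomm a b n
  have hαK : (ht.hom hp hT).toLinearMap (0, 1) = toSuper₁ B (0, (1, 0)) - g • (superVA₁ B).vac :=
    (homToVA_central _ _ _ _ _ _ _ _ _ _).trans (by simp)
  have hβK : hψ.hom.toLinearMap (0, 1) = (superVA₁ B).vac :=
    (homToVA_central _ _ _ _ _ _ _ _ _ _).trans (by simp)
  refine ⟨(ht.hom hp hT).directSum hψ.hom hαβ, ?_, ?_, ?_, ?_⟩
  · intro y
    show (ht.hom hp hT).toLinearMap (el 0 y) + hψ.hom.toLinearMap 0 = _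
    rw [hα, map_zero, add_zero, tilde_eq]; rfl
  · show (ht.hom hp hT).toLinearMap (0, 1) + hψ.hom.toLinearMap 0 = _
    rw [hαK, map_zero, add_zero]
  · intro y
    show (ht.hom hp hT).toLinearMap 0 + hψ.hom.toLinearMap (el 0 y) = _
    rw [hβ, map_zero, zero_add]; rfl
  · show (ht.hom hp hT).toLinearMap 0 + hψ.hom.toLinearMap (0, 1) = _
    rw [hβK, map_zero, zero_add]

section Restrict

variable {R R' : Type*} [AddCommGroup R] [Module ℂ R] [AddCommGroup R'] [Module ℂ R']
  {L : LieConformalSuperalgebra R} {L' : LieConformalSuperalgebra R'}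
  {V : Type*} [AddCommGroup V] [Module ℂ V] {A : VertexAlgebra V}

/-- The restriction of a homomorphism to the first summand. -/
def LieConformalSuperalgebra.HomToVA.fst
    (φ : (L.directSum L').HomToVA A) : L.HomToVA A where
  toLinearMap := φ.toLinearMap ∘ₗ LinearMap.inl ℂ R R'
  map_par a := by
    refine Eq.trans (congrArg φ.toLinearMap ?_) (φ.coe_par (a, 0))
    exact Prod.ext rfl (map_zero L'.par).symm
  map_T a := by
    refine Eq.trans (congrArg φ.toLinearMap ?_) (φ.coe_T (a, 0))
    exact Prod.ext rfl (map_zero L'.T).symm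
  map_prod n a b := by
    refine Eq.trans (congrArg φ.toLinearMap ?_) (φ.coe_prod n (a, 0) (b, 0))
    exact Prod.ext rfl (map_zero (L'.prod n 0)).symm

/-- The restriction of a homomorphism to the second summand. -/
def LieConformalSuperalgebra.HomToVA.snd
    (φ : (L.directSum L').HomToVA A) : L'.HomToVA A where
  toLinearMap := φ.toLinearMap ∘ₗ LinearMap.inr ℂ R R'
  map_par a := by
    refine Eq.trans (congrArg φ.toLinearMap ?_) (φ.coe_par (0, a))
    exact Prod.ext (map_zero L.par).symm rfl
  map_T a := by
    refine Eq.trans (congrArg φ.toLinearMap ?_) (φ.coe_T (0, a))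
    exact Prod.ext (map_zero L.T).symm rfl
  map_prod n a b := by
    refine Eq.trans (congrArg φ.toLinearMap ?_) (φ.coe_prod n (0, a) (0, b))
    exact Prod.ext (map_zero (L.prod n 0)).symm rfl

theorem LieConformalSuperalgebra.HomToVA.fst_prod_snd
    (φ : (L.directSum L').HomToVA A) (r : R) (s : R') (n : ℕ) :
    A.prod n (φ.fst.toLinearMap r) (φ.snd.toLinearMap s) = 0 := by
  refine (φ.coe_prod n (r, 0) (0, s)).symm.trans ?_
  rw [show (L.directSum L').prod n (r, 0) (0, s) = 0 from
    Prod.ext (map_zero (L.prod n r)) (by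
      show L'.prod n 0 s = 0
      rw [map_zero, LinearMap.zero_apply]), map_zero]

end Restrict

theorem isTildeHom_unique {g : ℂ} {φ φ' : ((Cur B).directSum (RCl B)).HomToVA (superVA₁ B)}
    (h : IsTildeHom B x g φ) (h' : IsTildeHom B x g φ') : φ = φ' := by
  refine LieConformalSuperalgebra.HomToVA.ext_of_toLinearMap (LinearMap.prod_ext ?_ ?_)
  · refine linearMap_ext (A := superVA₁ B) φ.fst.coe_T φ'.fst.coe_T ?_ ?_
    · exact fun a => (h.map_even a).trans (h'.map_even a).symm
    · intro c
      rw [central_eq_smul, map_smul, map_smul]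
      exact congrArg _ (h.map_K.trans h'.map_K.symm)
  · refine linearMap_ext (A := superVA₁ B) φ.snd.coe_T φ'.snd.coe_T ?_ ?_
    · exact fun a => (h.map_odd a).trans (h'.map_odd a).symm
    · intro c
      rw [central_eq_smul, map_smul, map_smul]
      exact congrArg _ (h.map_K'.trans h'.map_K'.symm)

end SuperAffineVA


/-! ### The isomorphism -/

section Isomorphism

open CurrentData

variable {𝔤 : Type*} [LieRing 𝔤] [LieAlgebra ℂ 𝔤] {B : InvariantForm 𝔤}

section Map

variable {V : Type*} [AddCommGroup V] [Module ℂ V] {A : VertexAlgebra V}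
  {W : Type*} [AddCommGroup W] [Module ℂ W] {A' : VertexAlgebra W}

theorem IsAffine.map {e : 𝔤 →ₗ[ℂ] V} {K : V} (he : IsAffine B A e K)
    (F : VertexAlgebra.Hom A A') : IsAffine B A' (F.toLinearMap ∘ₗ e) (F.toLinearMap K) where
  mem a := F.map_mem (he.mem a)
  prod_zero a b := (F.map_prod 0 _ _).symm.trans (congrArg _ (he.prod_zero a b))
  prod_one a b := (F.map_prod 1 _ _).symm.trans (by rw [he.prod_one, map_smul])
  prod_two_le n hn a b := (F.map_prod n _ _).symm.trans (by rw [he.prod_two_le n hn, map_zero])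

theorem IsFermion.map {ψ : 𝔤 →ₗ[ℂ] V} (hψ : IsFermion B A ψ) (F : VertexAlgebra.Hom A A') :
    IsFermion B A' (F.toLinearMap ∘ₗ ψ) where
  mem a := F.map_mem (hψ.mem a)
  prod_zero a b := (F.map_prod 0 _ _).symm.trans (by rw [hψ.prod_zero, map_smul, F.map_vac])
  prod_pos n hn a b := (F.map_prod n _ _).symm.trans (by rw [hψ.prod_pos n hn, map_zero])

/-- The identity homomorphism. -/
def VertexAlgebra.Hom.id (A : VertexAlgebra V) : VertexAlgebra.Hom A A where
  toLinearMap := LinearMap.id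
  map_par' _ := rfl
  map_vac' := rfl
  map_prod' _ _ _ := rfl

theorem VertexAlgebra.Hom.eq_of_smul_vac {F G : VertexAlgebra.Hom A A'} {v : V} {c : ℂ}
    (h : v = c • A.vac) : F.toLinearMap v = G.toLinearMap v := by
  rw [h, map_smul, map_smul, F.map_vac, G.map_vac]

/-- Homomorphisms from a quotient of the enveloping vertex algebra of a Lie conformal superalgebra
of current type are determined by their values on the generators. -/
theorem CurrentData.quotient_hom_ext {𝔞 𝔠 : Type*} [AddCommGroup 𝔞] [Module ℂ 𝔞] [AddCommGroup 𝔠]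
    [Module ℂ 𝔠] {D : CurrentData 𝔞 𝔠} {J : D.lca.envelope.Ideal}
    {F G : VertexAlgebra.Hom (D.lca.envelope.quotient J) A}
    (hel : ∀ a, F.toLinearMap (J.toSubmodule.mkQ (D.lca.ι (el 0 a))) =
      G.toLinearMap (J.toSubmodule.mkQ (D.lca.ι (el 0 a))))
    (hc : ∀ c, F.toLinearMap (J.toSubmodule.mkQ (D.lca.ι (0, c))) =
      G.toLinearMap (J.toSubmodule.mkQ (D.lca.ι (0, c)))) : F.toLinearMap = G.toLinearMap := by
  have h1 := linearMap_ext (A := A) (D.lca.ιHom.comp (F.comp J.mkHom)).coe_T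
    (D.lca.ιHom.comp (G.comp J.mkHom)).coe_T hel hc
  have h2 : (F.comp J.mkHom).toLinearMap = (G.comp J.mkHom).toLinearMap :=
    LieConformalSuperalgebra.envelope_hom_ext fun a => congrArg (fun f => f a) h1
  exact Submodule.linearMap_qext _ h2

end Map

variable {I : Type*} [Fintype I] {x : Module.Basis I ℂ 𝔤} {g : ℂ}

section ToSuper

variable {φ : ((Cur B).directSum (RCl B)).HomToVA (superVA₁ B)}

/-- The level is `k`: the generator `K - k |0⟩` is sent to the image of `𝒦 - (k + g) |0⟩`. -/
theorem affineToSuper_generator (hφ : IsTildeHom B x g φ) (k : ℂ) :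
    ∀ s ∈ ({(Cur B).ι (0, 1) - k • (Cur B).envelope.vac} : Set _),
    (φ.fst.comp (superProjHom B (k + g))).lift.toLinearMap s = 0 := by
  rintro _ rfl
  rw [map_sub, map_smul, LieConformalSuperalgebra.HomToVA.lift_ι, VertexAlgebra.Hom.map_vac,
    LieConformalSuperalgebra.HomToVA.comp_apply,
    show φ.fst.toLinearMap (0, 1) = _ from hφ.map_K, map_sub, map_smul,
    VertexAlgebra.Hom.map_vac, show (superProjHom B (k + g)).toLinearMap _ = _ from
      superProj_K B (k + g)]
  module

theorem fermionicToSuper_generator (hφ : IsTildeHom B x g φ) (k : ℂ) :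
    ∀ s ∈ ({(RCl B).ι (0, 1) - (RCl B).envelope.vac} : Set _),
    (φ.snd.comp (superProjHom B (k + g))).lift.toLinearMap s = 0 := by
  rintro _ rfl
  rw [map_sub, LieConformalSuperalgebra.HomToVA.lift_ι, VertexAlgebra.Hom.map_vac,
    LieConformalSuperalgebra.HomToVA.comp_apply,
    show φ.snd.toLinearMap (0, 1) = _ from hφ.map_K', VertexAlgebra.Hom.map_vac, sub_self]

variable (hφ : IsTildeHom B x g φ) (k : ℂ)

/-- The homomorphism `V^k(𝔤) → V^{k+g,1}(R^{super})` induced by `φ`. -/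
noncomputable def affineToSuper :
    VertexAlgebra.Hom (affineVA B k) (superVA B (k + g)) :=
  (φ.fst.comp (superProjHom B (k + g))).lift.quotientLift (affineToSuper_generator hφ k)

/-- The homomorphism `F(𝔤̄) → V^{k+g,1}(R^{super})` induced by `φ`. -/
noncomputable def fermionicToSuper :
    VertexAlgebra.Hom (fermionicVA B) (superVA B (k + g)) :=
  (φ.snd.comp (superProjHom B (k + g))).lift.quotientLift (fermionicToSuper_generator hφ k)

theorem affineToSuper_apply (r : CurrentSpace 𝔤 ℂ) :
    (affineToSuper hφ k).toLinearMap (toAffine B k r) =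
      superProj B (k + g) (φ.toLinearMap (r, 0)) :=
  (φ.fst.comp (superProjHom B (k + g))).lift_ι r

theorem fermionicToSuper_apply (s : CurrentSpace 𝔤 ℂ) :
    (fermionicToSuper hφ k).toLinearMap (toFermionic B s) =
      superProj B (k + g) (φ.toLinearMap (0, s)) :=
  (φ.snd.comp (superProjHom B (k + g))).lift_ι s

theorem affineToSuper_comm_fermionicToSuper (a : (affineIdeal B k).Quot)
    (b : (fermionicIdeal B).Quot) (n : ℕ) :
    (superVA B (k + g)).prod n ((affineToSuper hφ k).toLinearMap a)
      ((fermionicToSuper hφ k).toLinearMap b) = 0 := by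
  obtain ⟨a, rfl⟩ := Submodule.Quotient.mk_surjective _ a
  obtain ⟨b, rfl⟩ := Submodule.Quotient.mk_surjective _ b
  refine (φ.fst.comp (superProjHom B (k + g))).prod_lift_lift_eq_zero
    (φ.snd.comp (superProjHom B (k + g))) (fun r s n => ?_) a b n
  rw [LieConformalSuperalgebra.HomToVA.comp_apply, LieConformalSuperalgebra.HomToVA.comp_apply,
    ← VertexAlgebra.Hom.map_prod, φ.fst_prod_snd, map_zero]

/-- The homomorphism `V^k(𝔤) ⊗ F(𝔤̄) → V^{k+g,1}(R^{super})` induced by `φ`. -/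
noncomputable def tensorToSuper :
    VertexAlgebra.Hom ((affineVA B k).tensor (fermionicVA B)) (superVA B (k + g)) :=
  VertexAlgebra.tensorLift (affineToSuper hφ k) (fermionicToSuper hφ k)
    (affineToSuper_comm_fermionicToSuper hφ k)

theorem tensorToSuper_inl (r : CurrentSpace 𝔤 ℂ) :
    (tensorToSuper hφ k).toLinearMap (toAffine B k r ⊗ₜ (fermionicVA B).vac) =
      superProj B (k + g) (φ.toLinearMap (r, 0)) :=
  (VertexAlgebra.tensorLift_inl _ _ _ _).trans (affineToSuper_apply hφ k r)

theorem tensorToSuper_inr (s : CurrentSpace 𝔤 ℂ) :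
    (tensorToSuper hφ k).toLinearMap ((affineVA B k).vac ⊗ₜ toFermionic B s) =
      superProj B (k + g) (φ.toLinearMap (0, s)) :=
  (VertexAlgebra.tensorLift_inr _ _ _ _).trans (fermionicToSuper_apply hφ k s)

end ToSuper

section FromSuper

variable (B) in
/-- The currents `x ⊗ |0⟩` of `V^k(𝔤) ⊗ F(𝔤̄)`. -/
noncomputable def tensorEven (k : ℂ) :
    𝔤 →ₗ[ℂ] (affineIdeal B k).Quot ⊗[ℂ] (fermionicIdeal B).Quot :=
  (VertexAlgebra.inl (affineVA B k) (fermionicVA B)).toLinearMap ∘ₗ toAffine B k ∘ₗ el 0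

variable (B) in
/-- The fermions `|0⟩ ⊗ x̄` of `V^k(𝔤) ⊗ F(𝔤̄)`. -/
noncomputable def tensorOdd (k : ℂ) :
    𝔤 →ₗ[ℂ] (affineIdeal B k).Quot ⊗[ℂ] (fermionicIdeal B).Quot :=
  (VertexAlgebra.inr (affineVA B k) (fermionicVA B)).toLinearMap ∘ₗ toFermionic B ∘ₗ el 0

theorem isAffine_tensorEven (k : ℂ) :
    IsAffine B ((affineVA B k).tensor (fermionicVA B)) (tensorEven B k)
      (k • ((affineVA B k).tensor (fermionicVA B)).vac) := by
  have h := (isAffine_toAffine B k).map (VertexAlgebra.inl _ (fermionicVA B))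
  rwa [map_smul, VertexAlgebra.Hom.map_vac] at h

theorem isFermion_tensorOdd (k : ℂ) :
    IsFermion B ((affineVA B k).tensor (fermionicVA B)) (tensorOdd B k) :=
  (isFermion_toFermionic B).map (VertexAlgebra.inr (affineVA B k) _)

theorem tensorEven_comm_tensorOdd (k : ℂ) (a b : 𝔤) (n : ℕ) :
    ((affineVA B k).tensor (fermionicVA B)).prod n (tensorEven B k a) (tensorOdd B k b) = 0 :=
  VertexAlgebra.tensor_prod_inl_inr _ _ n _ _

/-- The homomorphism `R^{super} → V^k(𝔤) ⊗ F(𝔤̄)` which sends `x` to the sum of `x ⊗ |0⟩` and of the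
fermionic current of `x`, and `x̄` to `|0⟩ ⊗ x̄`. -/
noncomputable def superToTensorHom [DecidableEq I]
    (hx : ∀ i j, B.form (x i) (x j) = if i = j then 1 else 0)
    (hg : casimir x = (2 * g) • LinearMap.id) (k : ℂ) :
    (RSuper B).HomToVA ((affineVA B k).tensor (fermionicVA B)) :=
  have hψ := isFermion_tensorOdd (B := B) k
  have he := isAffine_tensorEven (B := B) k
  have hJ := hψ.isAffine_current hx hg
  have hJψ := hψ.actsAdjoint hx
  have hcomm := tensorEven_comm_tensorOdd (B := B) k
  have hcomm' : ∀ a b (n : ℕ), ((affineVA B k).tensor (fermionicVA B)).prod n (tensorOdd B k a)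
      (tensorEven B k b) = 0 := fun a b n =>
    ((affineVA B k).tensor (fermionicVA B)).prod_eq_zero_symm (he.mem b) (hψ.mem a) (hcomm b a) n
  superHom (e := tensorEven B k + fermionCurrent _ x (tensorOdd B k)) (ψ := tensorOdd B k)
    (k := k + g)
    (by
      have h := he.add hJ fun a b n => hψ.prod_current_eq_zero (he.mem a) (hcomm a) b n
      rwa [← add_smul] at h)
    hψ
    ⟨fun a b => by
      have h := hcomm a b 0
      rw [Nat.cast_zero] at h
      rw [LinearMap.add_apply, map_add, LinearMap.add_apply, h, zero_add, hJψ.prod_zero],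
     fun n hn a b => by
      rw [LinearMap.add_apply, map_add, LinearMap.add_apply, hcomm, zero_add, hJψ.prod_pos n hn]⟩
    (fun a b => by
      have h := hcomm' a b 0
      rw [Nat.cast_zero] at h
      rw [LinearMap.add_apply, map_add, h, zero_add, hψ.prod_current_zero hx])
    (fun n hn a b => by
      rw [LinearMap.add_apply, map_add, hcomm', zero_add, hψ.prod_current_pos hn])

variable [DecidableEq I] (hx : ∀ i j, B.form (x i) (x j) = if i = j then 1 else 0)
  (hg : casimir x = (2 * g) • LinearMap.id) (k : ℂ)

theorem superToTensorHom_el (a b : 𝔤) :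
    (superToTensorHom hx hg k).toLinearMap (el 0 (a, b)) =
      tensorEven B k a +
        fermionCurrent ((affineVA B k).tensor (fermionicVA B)) x (tensorOdd B k) a +
        tensorOdd B k b :=
  extend_el _ _ _ 0 (a, b)

theorem superToTensorHom_central (s t : ℂ) :
    (superToTensorHom hx hg k).toLinearMap (0, (s, t)) =
      s • (k + g) • ((affineVA B k).tensor (fermionicVA B)).vac +
        t • ((affineVA B k).tensor (fermionicVA B)).vac :=
  extend_central _ _ _ (s, t)

theorem superToTensor_generator :
    ∀ s ∈ ({(RSuper B).ι (0, (1, 0)) - (k + g) • (RSuper B).envelope.vac,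
      (RSuper B).ι (0, (0, 1)) - (RSuper B).envelope.vac} : Set _),
    (superToTensorHom hx hg k).lift.toLinearMap s = 0 := by
  rintro _ (rfl | rfl)
  · rw [map_sub, map_smul, LieConformalSuperalgebra.HomToVA.lift_ι, VertexAlgebra.Hom.map_vac,
      superToTensorHom_central]
    module
  · rw [map_sub, LieConformalSuperalgebra.HomToVA.lift_ι, VertexAlgebra.Hom.map_vac,
      superToTensorHom_central]
    module

/-- The homomorphism `V^{k+g,1}(R^{super}) → V^k(𝔤) ⊗ F(𝔤̄)` inverse to `tensorToSuper`. -/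
noncomputable def superToTensor :
    VertexAlgebra.Hom (superVA B (k + g)) ((affineVA B k).tensor (fermionicVA B)) :=
  (superToTensorHom hx hg k).lift.quotientLift (superToTensor_generator hx hg k)

theorem superToTensor_apply (r : CurrentSpace (𝔤 × 𝔤) (ℂ × ℂ)) :
    (superToTensor hx hg k).toLinearMap (superProj B (k + g) (toSuper₁ B r)) =
      (superToTensorHom hx hg k).toLinearMap r :=
  (superToTensorHom hx hg k).lift_ι r

theorem superToTensor_evenMap (a : 𝔤) :
    (superToTensor hx hg k).toLinearMap (superProj B (k + g) (evenMap B a)) =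
      tensorEven B k a +
        fermionCurrent ((affineVA B k).tensor (fermionicVA B)) x (tensorOdd B k) a := by
  refine (superToTensor_apply hx hg k (el 0 (a, 0))).trans ?_
  rw [superToTensorHom_el, map_zero, add_zero]

theorem superToTensor_oddMap (a : 𝔤) :
    (superToTensor hx hg k).toLinearMap (superProj B (k + g) (oddMap B a)) = tensorOdd B k a := by
  refine (superToTensor_apply hx hg k (el 0 (0, a))).trans ?_
  rw [superToTensorHom_el, map_zero, map_zero, add_zero, zero_add]

theorem superToTensor_tilde (a : 𝔤) :
    (superToTensor hx hg k).toLinearMap (superProj B (k + g) (tilde B x a)) =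
      tensorEven B k a := by
  rw [tilde_eq, map_sub, map_sub, superToTensor_evenMap]
  have h := fermionCurrent_map (superVA₁ B) x
    (VertexAlgebra.Hom.comp (superToTensor hx hg k) (superProjHom B (k + g)))
    (ψ := oddMap B) (ψ' := tensorOdd B k) (superToTensor_oddMap hx hg k) a
  refine Eq.trans (congrArg _ h) ?_
  abel

variable {φ : ((Cur B).directSum (RCl B)).HomToVA (superVA₁ B)} (hφ : IsTildeHom B x g φ)

theorem superToTensor_comp_tensorToSuper :
    (superToTensor hx hg k).toLinearMap ∘ₗ (tensorToSuper hφ k).toLinearMap = LinearMap.id := by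
  refine VertexAlgebra.tensor_hom_ext (F := (superToTensor hx hg k).comp (tensorToSuper hφ k))
    (G := VertexAlgebra.Hom.id _) ?_ ?_
  · refine fun a => congrArg (fun f => f a) (CurrentData.quotient_hom_ext (D := curData B)
      (J := affineIdeal B k)
      (F := ((superToTensor hx hg k).comp (tensorToSuper hφ k)).comp (VertexAlgebra.inl _ _))
      (G := VertexAlgebra.inl _ _) ?_ ?_)
    · intro a
      refine (congrArg (superToTensor hx hg k).toLinearMap
        (tensorToSuper_inl hφ k (el 0 a))).trans ?_
      rw [hφ.map_even, superToTensor_tilde]; rfl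
    · intro c
      have h : (affineIdeal B k).toSubmodule.mkQ ((Cur B).ι (0, c)) =
          (c * k) • (affineVA B k).vac := by
        rw [central_eq_smul, map_smul, map_smul, mul_smul]
        exact congrArg _ (toAffine_K B k)
      exact VertexAlgebra.Hom.eq_of_smul_vac
        (F := ((superToTensor hx hg k).comp (tensorToSuper hφ k)).comp
          (VertexAlgebra.inl (affineVA B k) (fermionicVA B)))
        (G := VertexAlgebra.inl (affineVA B k) (fermionicVA B)) h
  · refine fun b => congrArg (fun f => f b) (CurrentData.quotient_hom_ext (D := cliffordData B)
      (J := fermionicIdeal B)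
      (F := ((superToTensor hx hg k).comp (tensorToSuper hφ k)).comp (VertexAlgebra.inr _ _))
      (G := VertexAlgebra.inr _ _) ?_ ?_)
    · intro a
      refine (congrArg (superToTensor hx hg k).toLinearMap
        (tensorToSuper_inr hφ k (el 0 a))).trans ?_
      rw [hφ.map_odd]
      exact superToTensor_oddMap hx hg k a
    · intro c
      have h : (fermionicIdeal B).toSubmodule.mkQ ((RCl B).ι (0, c)) =
          c • (fermionicVA B).vac := by
        rw [central_eq_smul, map_smul, map_smul]
        exact congrArg _ (toFermionic_K B)
      exact VertexAlgebra.Hom.eq_of_smul_vac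
        (F := ((superToTensor hx hg k).comp (tensorToSuper hφ k)).comp
          (VertexAlgebra.inr (affineVA B k) (fermionicVA B)))
        (G := VertexAlgebra.inr (affineVA B k) (fermionicVA B)) h

theorem tensorToSuper_comp_superToTensor :
    (tensorToSuper hφ k).toLinearMap ∘ₗ (superToTensor hx hg k).toLinearMap = LinearMap.id := by
  have hodd : ∀ a, (tensorToSuper hφ k).toLinearMap (tensorOdd B k a) =
      ((superProj B (k + g)) ∘ₗ oddMap B) a := fun a =>
    (tensorToSuper_inr hφ k (el 0 a)).trans (by rw [hφ.map_odd]; rfl)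
  have heven : ∀ a, (tensorToSuper hφ k).toLinearMap (tensorEven B k a) =
      superProj B (k + g) (evenMap B a) -
        fermionCurrent (superVA B (k + g)) x ((superProj B (k + g)) ∘ₗ oddMap B) a := fun a =>
    (tensorToSuper_inl hφ k (el 0 a)).trans (by
      rw [hφ.map_even, tilde_eq, map_sub]
      congr 1
      exact fermionCurrent_map (superVA₁ B) x (superProjHom B (k + g)) (fun _ => rfl) a)
  refine CurrentData.quotient_hom_ext (D := superData B) (J := superIdeal B (k + g))
    (F := (tensorToSuper hφ k).comp (superToTensor hx hg k)) (G := VertexAlgebra.Hom.id _) ?_ ?_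
  · rintro ⟨a, b⟩
    refine (congrArg (tensorToSuper hφ k).toLinearMap
      ((superToTensor_apply hx hg k (el 0 (a, b))).trans
        (superToTensorHom_el hx hg k a b))).trans ?_
    rw [map_add, map_add, hodd, heven, fermionCurrent_map _ x (tensorToSuper hφ k) hodd,
      sub_add_cancel]
    have h : (el 0 (a, b) : CurrentSpace (𝔤 × 𝔤) (ℂ × ℂ)) = el 0 (a, 0) + el 0 (0, b) := by
      rw [← map_add]; simp
    refine Eq.trans ?_ (congrArg (fun r => superProj B (k + g) (toSuper₁ B r)) h).symm
    simp only [map_add]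
    rfl
  · rintro ⟨s, t⟩
    refine (congrArg (tensorToSuper hφ k).toLinearMap
      ((superToTensor_apply hx hg k (0, (s, t))).trans
        (superToTensorHom_central hx hg k s t))).trans ?_
    have h : ((0, (s, t)) : CurrentSpace (𝔤 × 𝔤) (ℂ × ℂ)) =
        s • ((0, (1, 0)) : CurrentSpace (𝔤 × 𝔤) (ℂ × ℂ)) +
        t • ((0, (0, 1)) : CurrentSpace (𝔤 × 𝔤) (ℂ × ℂ)) := by
      simp
    refine Eq.trans ?_ (congrArg (fun r => superProj B (k + g) (toSuper₁ B r)) h).symm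
    simp only [map_add, map_smul, superProj_K, toSuper₁_K, VertexAlgebra.Hom.map_vac]
    rfl

end FromSuper

end Isomorphism

end SuperAffine

theorem proposition2p1 {𝔤 : Type*} [LieRing 𝔤] [LieAlgebra ℂ 𝔤] [FiniteDimensional ℂ 𝔤]
    (h𝔤 : LieAlgebra.IsSemisimple ℂ 𝔤 ∨ IsLieAbelian 𝔤) (B : InvariantForm 𝔤)
    {I : Type*} [Fintype I] [DecidableEq I] (x : Module.Basis I ℂ 𝔤)
    (hx : ∀ i j, B.form (x i) (x j) = if i = j then 1 else 0)
    (g : ℂ) (hg : casimir x = (2 * g) • LinearMap.id) :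
    (∃! φ : ((Cur B).directSum (RCl B)).HomToVA (superVA₁ B), IsTildeHom B x g φ) ∧
    ∀ φ : ((Cur B).directSum (RCl B)).HomToVA (superVA₁ B), IsTildeHom B x g φ →
      ∀ k : ℂ, ∃ Φ : VertexAlgebra.Iso ((affineVA B k).tensor (fermionicVA B))
          (superVA B (k + g)),
        (∀ r, Φ.toLinearEquiv (toAffine B k r ⊗ₜ (fermionicVA B).vac) =
          superProj B (k + g) (φ.toLinearMap (r, 0))) ∧
        (∀ s, Φ.toLinearEquiv ((affineVA B k).vac ⊗ₜ toFermionic B s) =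
          superProj B (k + g) (φ.toLinearMap (0, s))) := by
  obtain ⟨φ, hφ⟩ := exists_isTildeHom hx hg
  refine ⟨⟨φ, hφ, fun φ' h => isTildeHom_unique h hφ⟩, fun φ hφ k => ?_⟩
  exact ⟨VertexAlgebra.Hom.toIso (tensorToSuper hφ k) (superToTensor hx hg k)
    (tensorToSuper_comp_superToTensor hx hg k hφ) (superToTensor_comp_tensorToSuper hx hg k hφ),
    tensorToSuper_inl hφ k, tensorToSuper_inr hφ k⟩
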